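/- **Setting.** Let $\mathcal U=\bigoplus_{1\le i,j\le r}\mathcal U_{ij}$ be a $T$-algebra of rank $r$ in the sense of Vinberg: a finite dimensional real (not necessarily associative) algebra with a linear involution $x\mapsto x^\star$, $(xy)^\star=y^\star x^\star$, $\mathcal U_{ij}^\star=\mathcal U_{ji}$, with $\mathcal U_{ij}\mathcal U_{jk}\subset\mathcal U_{ik}$, $\mathcal U_{ij}\mathcal U_{lk}=\{0\}$ for $j\ne l$, $\mathcal U_{ii}=\mathbb R c_i$ with $c_i\neq 0$, $c_ix=x=xc_j$ for $x\in\mathcal U_{ij}$; and, with $\rho(\lambda c_i)=\lambda$, $x_{ii}$ the $\mathcal U_{ii}$-component of $x$ and $\operatorname{tr}x=\sum_i\rho(x_{ii})$: $\operatorname{tr}(xy)=\operatorname{tr}(yx)$, $\operatorname{tr}(x(yz))=\operatorname{tr}((xy)z)$, $\operatorname{tr}(xx^\star)>0$ for $x\ne0$, and $x(yz)=(xy)z$, $x(yy^\star)=(xy)y^\star$ for all upper triangular $x,y,z$ (i.e. in $\bigoplus_{i\le j}\mathcal U_{ij}$). Let $H$ be the group of upper triangular elements $t$ with $\rho(t_{jj})>0$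 for all $j$, let $V=\{x\in\mathcal U:x^\star=x\}$, $n=\dim V$, and let $\Omega=\{ss^\star:s\in H\}\subset V$ be the associated homogeneous cone, on which $H$ acts simply transitively by the restrictions of the linear maps $\pi(t)$ of $V$ with $\pi(t)[ss^\star]=(ts)(ts)^\star$ for $s\in H$. Put $n_j=\sum_{i<j}\dim\mathcal U_{ij}$, $m_j=\sum_{k>j}\dim\mathcal U_{jk}$, $\tau_j=1+\frac12(m_j+n_j)$, $Q_j(tt^\star)=\rho(t_{jj})^2$ for $t\in H$, and $Q^a=\prod_jQ_j^{a_j}$ on $\Omega$ for $a\in\mathbb R^r$. Identify $V$ with $\mathbb R^n$ and $V+iV$ with $\mathbb C^n$ through a basis of $V$. Let $F:\mathbb C^m\times\mathbb C^m\to\mathbb C^n$, $F(u,v)=(u\widetilde H_1\bar v',\dots,u\widetilde H_n\bar v')$ with Hermitian $m\times m$ matrices $\widetilde H_k$ (where $'$ denotes the transpose), be an $\Omega$-Hermitian homogeneous form: $F(u,u)\in\overline\Omega$; $F(u,u)=0$ iff $u=0$; and for every $t\in H$ there is $\tilde t\in GL(m,\mathbb C)$ with $\pi(t)[F(u,u)]=F(\tilde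 tu,\tilde tu)$ for all $u$. Let $b_j$ be the rank of the Hermitian form $F_{jj}=\rho(F(\cdot,\cdot)_{jj})$, where $\rho$ of the $jj$-component is extended complex linearly to $V+iV$, let $b=(b_1,\dots,b_r)$, and let $$D=\{(z,u)\in\mathbb C^n\times\mathbb C^m:\ \Im m\,z-F(u,u)\in\Omega\}.$$ For $\nu\in\mathbb R^r$ let $dV_\nu(x+iy,u)=Q^{\nu-\frac b2-\tau}(y-F(u,u))\,dx\,dy\,dv(u)$ on $D$, where $dx$, $dy$, $dv$ are Lebesgue measures; let $A^2_\nu(D)$ be the space of holomorphic functions in $L^2(D,dV_\nu)$ and $B_\nu$ its reproducing kernel (the weighted Bergman kernel): $B_\nu(\cdot,\omega)\in A^2_\nu(D)$ and $f(\omega)=\int_Df\,\overline{B_\nu(\cdot,\omega)}\,dV_\nu$ for $f\in A^2_\nu(D)$, $\omega\in D$. For $1\le p,q\le\infty$ let $L^{p,q}_\nu(D)$ be the space of measurable functions $f:D\to\mathbb C$ with $$\|f\|_{L^{p,q}_\nu(D)}=\Big(\int_{\mathbb C^m}\int_{\Omega+F(u,u)}\Big(\int_V|f(x+iy,u)|^pdx\Big)^{\frac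 qp}Q^{\nu-\frac b2-\tau}(y-F(u,u))\,dy\,dv(u)\Big)^{\frac1q}<\infty$$ (with essential suprema if $p=\infty$ or $q=\infty$). **Theorem 3.8.** Let $\alpha,\nu,\mu\in\mathbb R^r$ and $1\le p,q\le\infty$. Suppose that for all $j=1,\dots,r$ $$\mu_j+\alpha_j>\tfrac12(m_j+n_j+b_j),$$ $$\mu_jq-\nu_j>(q-1)\Big(\frac{m_j}2+\frac{b_j}2\Big)+\frac{n_j}2,\qquad \alpha_jq+\nu_j>\frac{m_j}2+\frac{b_j}2+(q-1)\frac{n_j}2,$$ where for $q=\infty$ the last two conditions are read, after division by $q$, as $\mu_j>\frac{m_j+b_j}2$ and $\alpha_j>\frac{n_j}2$. Then the positive integral operator $$T^+_{\mu,\alpha}f(z,u)=Q^\alpha(\Im m\,z-F(u,u))\int_D\big|B_{\mu+\alpha}((z,u),(w,t))\big|\,f(w,t)\,dV_\mu(w,t)$$ is bounded on $L^{p,q}_\nu(D)$: there is a finite constant $C$ such that for every $f\in L^{p,q}_\nu(D)$ the integral converges absolutely for almost every $(z,u)\in D$, $T^+_{\mu,\alpha}f\in L^{p,q}_\nu(D)$,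 and $\|T^+_{\mu,\alpha}f\|_{L^{p,q}_\nu(D)}\le C\|f\|_{L^{p,q}_\nu(D)}$. -/

import Mathlib

open MeasureTheory
open scoped ENNReal NNReal ComplexConjugate

noncomputable section

/-- A `T`-algebra of rank `r` (in the sense of Vinberg): a finite dimensional real algebra `U`
(not necessarily associative) with a linear involution `star`, bigraded by subspaces `U_ij`
(`comp i j`) that multiply like matrix entries, with `U_ii = ℝ c_i`, and satisfying
Vinberg's axioms for the trace `tr x = ∑ ρ (x_ii)`. -/
structure TAlgebra (r : ℕ) (U : Type*) [NonUnitalNonAssocRing U] [Module ℝ U]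
    [IsScalarTower ℝ U U] [SMulCommClass ℝ U U] [StarRing U] [StarModule ℝ U] where
  /-- the subspaces `U_ij` -/
  comp : Fin r → Fin r → Submodule ℝ U
  internal : DirectSum.IsInternal (fun p : Fin r × Fin r => comp p.1 p.2)
  mul_mem : ∀ i j k x y, x ∈ comp i j → y ∈ comp j k → x * y ∈ comp i k
  mul_eq_zero : ∀ i j l k x y, j ≠ l → x ∈ comp i j → y ∈ comp l k → x * y = 0
  star_mem : ∀ i j x, x ∈ comp i j → star x ∈ comp j i
  /-- the diagonal idempotents `c_i` -/
  c : Fin r → U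
  c_ne_zero : ∀ i, c i ≠ 0
  comp_diag : ∀ i, comp i i = Submodule.span ℝ {c i}
  c_mul : ∀ i j x, x ∈ comp i j → c i * x = x
  mul_c : ∀ i j x, x ∈ comp i j → x * c j = x
  /-- the linear functional `x ↦ ρ (x_ii)` -/
  rho : Fin r → U →ₗ[ℝ] ℝ
  rho_c : ∀ i, rho i (c i) = 1
  rho_comp : ∀ i j k x, (j, k) ≠ (i, i) → x ∈ comp j k → rho i x = 0
  tr_comm : ∀ x y : U, ∑ i, rho i (x * y) = ∑ i, rho i (y * x)
  tr_assoc : ∀ x y z : U, ∑ i, rho i (x * (y * z)) = ∑ i, rho i ((x * y) * z)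
  tr_pos : ∀ x : U, x ≠ 0 → 0 < ∑ i, rho i (x * star x)
  upper_assoc : ∀ x y z : U, x ∈ (⨆ i, ⨆ j, ⨆ _ : i ≤ j, comp i j) →
    y ∈ (⨆ i, ⨆ j, ⨆ _ : i ≤ j, comp i j) → z ∈ (⨆ i, ⨆ j, ⨆ _ : i ≤ j, comp i j) →
    x * (y * z) = (x * y) * z
  upper_mul_star : ∀ x y : U, x ∈ (⨆ i, ⨆ j, ⨆ _ : i ≤ j, comp i j) →
    y ∈ (⨆ i, ⨆ j, ⨆ _ : i ≤ j, comp i j) → x * (y * star y) = (x * y) * star y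

namespace TAlgebra

variable {r : ℕ} {U : Type*} [NonUnitalNonAssocRing U] [Module ℝ U]
  [IsScalarTower ℝ U U] [SMulCommClass ℝ U U] [StarRing U] [StarModule ℝ U]

/-- The upper triangular matrices `⨁_{i ≤ j} U_ij`. -/
def upper (T : TAlgebra r U) : Submodule ℝ U := ⨆ i, ⨆ j, ⨆ _ : i ≤ j, T.comp i j

/-- The group `H` of upper triangular matrices with positive diagonal entries. -/
def H (T : TAlgebra r U) : Set U := {t | t ∈ T.upper ∧ ∀ i, 0 < T.rho i t}

/-- The homogeneous cone `{s s⋆ : s ∈ H}`. -/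
def cone (T : TAlgebra r U) : Set U := {x | ∃ s ∈ T.H, s * star s = x}

/-- `n_j = ∑_{i < j} dim U_ij`. -/
def nDim (T : TAlgebra r U) (j : Fin r) : ℕ :=
  ∑ i ∈ Finset.univ.filter (fun i => i < j), Module.finrank ℝ (T.comp i j)

/-- `m_j = ∑_{k > j} dim U_jk`. -/
def mDim (T : TAlgebra r U) (j : Fin r) : ℕ :=
  ∑ k ∈ Finset.univ.filter (fun k => j < k), Module.finrank ℝ (T.comp j k)

/-- `τ_j = 1 + (m_j + n_j) / 2`. -/
def tau (T : TAlgebra r U) (j : Fin r) : ℝ := 1 + ((T.mDim j : ℝ) + (T.nDim j : ℝ)) / 2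

open Classical in
/-- `Q_j (t t⋆) = ρ (t_jj) ^ 2` for `t ∈ H`; the element `t` is uniquely determined by
`t t⋆`, because `H` acts simply transitively on the cone. (The value off the cone is `0`.) -/
def Q (T : TAlgebra r U) (j : Fin r) (x : U) : ℝ :=
  if h : ∃ t ∈ T.H, t * star t = x then (T.rho j h.choose) ^ 2 else 0

/-- The generalized power `Q^a = ∏_j Q_j ^ {a_j}`, `a ∈ ℝ^r`. -/
def Qpow (T : TAlgebra r U) (a : Fin r → ℝ) (x : U) : ℝ := ∏ j, T.Q j x ^ a j

/-- The linear action `π(t)` on Hermitian matrices, i.e. the linear map that satisfies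
`π(t)[s s⋆] = (t s)(t s)⋆` for all `s ∈ H` (see `act_mul_star`). With `D_t x = t x + x t⋆`
it is `(D_t ∘ D_t - D_{t t}) / 2`, which would be `x ↦ t x t⋆` if `U` were associative. -/
def act (t x : U) : U :=
  (1 / 2 : ℝ) • (t * (t * x + x * star t) + (t * x + x * star t) * star t
    - ((t * t) * x + x * star (t * t)))

theorem upper_mul_mem (T : TAlgebra r U) {x y : U} (hx : x ∈ T.upper) (hy : y ∈ T.upper) :
    x * y ∈ T.upper := by
  have hin : ∀ i j, i ≤ j → T.comp i j ≤ T.upper := fun i j hij =>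
    le_iSup_of_le i (le_iSup_of_le j (le_iSup_of_le hij le_rfl))
  have hL : T.upper ≤ T.upper.comap (LinearMap.mulRight ℝ y) := by
    refine iSup_le fun i => iSup_le fun j => iSup_le fun hij a ha => ?_
    have hR : T.upper ≤ T.upper.comap (LinearMap.mulLeft ℝ a) := by
      refine iSup_le fun k => iSup_le fun l => iSup_le fun hkl b hb => ?_
      simp only [Submodule.mem_comap, LinearMap.mulLeft_apply]
      by_cases hjk : j = k
      · subst hjk
        exact hin i l (hij.trans hkl) (T.mul_mem i j l a b ha hb)
      · rw [T.mul_eq_zero i j k l a b hjk ha hb]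
        exact T.upper.zero_mem
    exact hR hy
  exact hL hx

theorem act_mul_star (T : TAlgebra r U) {t s : U} (ht : t ∈ T.upper) (hs : s ∈ T.upper) :
    act t (s * star s) = (t * s) * star (t * s) := by
  have hts := T.upper_mul_mem ht hs
  have htt := T.upper_mul_mem ht ht
  have h1 := T.upper_mul_star t s ht hs
  have h1' : (s * star s) * star t = s * star (t * s) := by
    have := congrArg star h1
    simpa [star_mul] using this
  have h2 := T.upper_mul_star (t * t) s htt hs
  have h2' : (s * star s) * star (t * t) = s * star ((t * t) * s) := by
    have := congrArg star h2
    simpa [star_mul] using this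
  have h3 := T.upper_mul_star t (t * s + s) ht (T.upper.add_mem hts hs)
  have h4 := T.upper_mul_star t (t * s) ht hts
  have ha : t * (t * s) = (t * t) * s := T.upper_assoc t t s ht ht hs
  have h5 : t * ((t * s) * star s + s * star (t * s))
      = ((t * t) * s) * star s + (t * s) * star (t * s) := by
    have e1 : t * ((t * s) * star s + s * star (t * s))
        = t * ((t * s + s) * star (t * s + s)) - t * ((t * s) * star (t * s))
          - t * (s * star s) := by
      rw [← mul_sub, ← mul_sub]
      congr 1
      rw [star_add]
      simp only [mul_add, add_mul]
      abel
    rw [e1, h3, h4, h1, star_add, mul_add t, ha]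
    simp only [mul_add, add_mul]
    abel
  have h5' : ((t * s) * star s + s * star (t * s)) * star t
      = s * star ((t * t) * s) + (t * s) * star (t * s) := by
    have h6 := congrArg star h5
    rw [star_mul t, star_add, star_add, star_mul (t * s) (star s), star_star,
      star_mul s (star (t * s)), star_star, star_mul (t * t * s) (star s), star_star,
      star_mul (t * s) (star (t * s)), star_star] at h6
    rw [← h6, add_comm]
  unfold act
  rw [h1, h1', h5, h5', h2, h2']
  have key : ∀ A B C : U, (1 / 2 : ℝ) • (A + C + (B + C) - (A + B)) = C := by
    intro A B C
    have h7 : A + C + (B + C) - (A + B) = (2 : ℝ) • C := by rw [two_smul]; abel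
    rw [h7, smul_smul]; norm_num
  exact key _ _ _

/-- The point of `V` with given real coordinates in a basis of
`V = {x ∈ U : x⋆ = x}`, as an element of `U`. -/
def point {n : ℕ} (e : Module.Basis (Fin n) ℝ (selfAdjoint.submodule ℝ U)) (y : Fin n → ℝ) : U :=
  ∑ k, y k • (e k : U)

/-- The cone `Ω` in the coordinates of a basis of `V`. -/
def Omega (T : TAlgebra r U) {n : ℕ}
    (e : Module.Basis (Fin n) ℝ (selfAdjoint.submodule ℝ U)) : Set (Fin n → ℝ) :=
  {y | point e y ∈ T.cone}

end TAlgebra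

/-- The sesquilinear map `F(u, v) = (u H_1 v̄', …, u H_n v̄')` given by matrices `H_k`. -/
def sesq {n m : ℕ} (M : Fin n → Matrix (Fin m) (Fin m) ℂ) (u v : Fin m → ℂ) : Fin n → ℂ :=
  fun k => u ⬝ᵥ (M k).mulVec (star v)

/-- The real vector `F(u, u)` (its coordinates are real because the `H_k` are Hermitian). -/
def sesqDiag {n m : ℕ} (M : Fin n → Matrix (Fin m) (Fin m) ℂ) (u : Fin m → ℂ) : Fin n → ℝ :=
  fun k => (sesq M u u k).re

section Siegel

variable {r n m : ℕ} {U : Type*} [NonUnitalNonAssocRing U] [Module ℝ U]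
  [IsScalarTower ℝ U U] [SMulCommClass ℝ U U] [StarRing U] [StarModule ℝ U]

/-- An `Ω`-Hermitian homogeneous form `F : ℂ^m × ℂ^m → V + iV = ℂ^n`, the coordinates on
`V + iV` being those of the basis `e` of `V`. -/
structure HermitianForm (T : TAlgebra r U)
    (e : Module.Basis (Fin n) ℝ (selfAdjoint.submodule ℝ U)) (m : ℕ) where
  mat : Fin n → Matrix (Fin m) (Fin m) ℂ
  hermitian : ∀ k, (mat k).IsHermitian
  mem_closure : ∀ u, sesqDiag mat u ∈ closure (T.Omega e)
  definite : ∀ u, sesq mat u u = 0 ↔ u = 0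
  homogeneous : ∀ t ∈ T.H, ∃ g : Matrix.GeneralLinearGroup (Fin m) ℂ, ∀ u : Fin m → ℂ,
    TAlgebra.act t (TAlgebra.point e (sesqDiag mat u))
      = TAlgebra.point e (sesqDiag mat ((g : Matrix (Fin m) (Fin m) ℂ).mulVec u))

namespace HermitianForm

variable {T : TAlgebra r U} {e : Module.Basis (Fin n) ℝ (selfAdjoint.submodule ℝ U)}

/-- `b_j`, the rank of the Hermitian form `F_jj = ρ (F(·,·)_jj)`. -/
def b (F : HermitianForm T e m) (j : Fin r) : ℕ :=
  (∑ k, ((T.rho j (e k : U) : ℝ) : ℂ) • F.mat k).rank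

/-- `y - F(u, u)`. -/
def height (F : HermitianForm T e m) (y : Fin n → ℝ) (u : Fin m → ℂ) : Fin n → ℝ :=
  fun k => y k - sesqDiag F.mat u k

/-- The homogeneous Siegel domain `D = {(z, u) : Im z - F(u, u) ∈ Ω}`. -/
def domain (F : HermitianForm T e m) : Set ((Fin n → ℂ) × (Fin m → ℂ)) :=
  {z | F.height (fun k => (z.1 k).im) z.2 ∈ T.Omega e}

/-- `{(y, u) : y ∈ Ω + F(u, u)}`. -/
def base (F : HermitianForm T e m) : Set ((Fin n → ℝ) × (Fin m → ℂ)) :=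
  {y | F.height y.1 y.2 ∈ T.Omega e}

/-- `Q^a (y - F(u, u))`. -/
def weight (F : HermitianForm T e m) (a : Fin r → ℝ) (y : Fin n → ℝ) (u : Fin m → ℂ) : ℝ :=
  T.Qpow a (TAlgebra.point e (F.height y u))

/-- `dV_ν (x + iy, u) = Q^{ν - b/2 - τ} (y - F(u, u)) dx dy dv(u)` on `D`. -/
def V (F : HermitianForm T e m) (ν : Fin r → ℝ) : Measure ((Fin n → ℂ) × (Fin m → ℂ)) :=
  (volume.restrict F.domain).withDensity fun z =>
    ENNReal.ofReal (F.weight (fun j => ν j - F.b j / 2 - T.tau j) (fun k => (z.1 k).im) z.2)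

/-- The measure `Q^{ν - b/2 - τ} (y - F(u, u)) dy dv(u)` on `{(y, u) : y ∈ Ω + F(u, u)}`. -/
def baseV (F : HermitianForm T e m) (ν : Fin r → ℝ) : Measure ((Fin n → ℝ) × (Fin m → ℂ)) :=
  (volume.restrict F.base).withDensity fun y =>
    ENNReal.ofReal (F.weight (fun j => ν j - F.b j / 2 - T.tau j) y.1 y.2)

/-- The weighted Bergman space `A²_ν(D)`: holomorphic functions in `L²(D, dV_ν)`. -/
def bergmanSpace (F : HermitianForm T e m) (ν : Fin r → ℝ) :
    Set ((Fin n → ℂ) × (Fin m → ℂ) → ℂ) :=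
  {f | DifferentiableOn ℂ f F.domain ∧ MemLp f 2 (F.V ν)}

open Classical in
/-- The weighted Bergman kernel `B_ν(z, w)`, the reproducing kernel of `A²_ν(D)`:
`B_ν(·, w)` is the element of `A²_ν(D)`, unique on `D`, with `f(w) = ⟨f, B_ν(·, w)⟩_ν` for all
`f ∈ A²_ν(D)`. -/
def bergmanKernel (F : HermitianForm T e m) (ν : Fin r → ℝ)
    (z w : (Fin n → ℂ) × (Fin m → ℂ)) : ℂ :=
  if h : ∃ g ∈ F.bergmanSpace ν, ∀ f ∈ F.bergmanSpace ν,
      f w = ∫ ζ, f ζ * conj (g ζ) ∂(F.V ν)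
  then h.choose z else 0

/-- The mixed norm of `L^{p,q}_ν(D)`: the `L^q` norm, with respect to
`Q^{ν - b/2 - τ} (y - F(u, u)) dy dv(u)`, of `(y, u) ↦ ‖f(· + iy, u)‖_{L^p(V, dx)}`. -/
def mixedNorm (F : HermitianForm T e m) (p q : ℝ≥0∞) (ν : Fin r → ℝ)
    (f : (Fin n → ℂ) × (Fin m → ℂ) → ℂ) : ℝ≥0∞ :=
  eLpNorm (fun y : (Fin n → ℝ) × (Fin m → ℂ) =>
    eLpNorm (fun x : Fin n → ℝ => f (fun k => (x k : ℂ) + (y.1 k : ℂ) * Complex.I, y.2))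
      p volume) q (F.baseV ν)

/-- Membership in `L^{p,q}_ν(D)`. -/
def MemMixed (F : HermitianForm T e m) (p q : ℝ≥0∞) (ν : Fin r → ℝ)
    (f : (Fin n → ℂ) × (Fin m → ℂ) → ℂ) : Prop :=
  AEStronglyMeasurable f (volume.restrict F.domain) ∧ F.mixedNorm p q ν f < ∞

/-- `T⁺_{μ,α} f(z, u) = Q^α(Im z - F(u, u)) ∫_D |B_{μ+α}((z, u), (w, t))| f(w, t) dV_μ(w, t)`. -/
def Tplus (F : HermitianForm T e m) (μ α : Fin r → ℝ)
    (f : (Fin n → ℂ) × (Fin m → ℂ) → ℂ) (z : (Fin n → ℂ) × (Fin m → ℂ)) : ℂ :=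
  (F.weight α (fun k => (z.1 k).im) z.2 : ℂ) *
    ∫ w, (‖F.bergmanKernel (μ + α) z w‖ : ℂ) * f w ∂(F.V μ)

end HermitianForm

end Siegel

end

/-!
The kernel is computed explicitly, integrated over the real directions, and the remaining operator
on the base `{(y, u) : y - F(u, u) ∈ Ω}` is bounded by Schur's test with powers of `Q` as test
functions.

*The cone.* Half of the diagonal is split off so that `V` itself serves as the space of upper
triangular matrices (`TAlgebra.tri`); the triangular group becomes an open subset `HX` of `V`, with
`psi t = t t⋆` and `sig t y = tr (π(t) y)` as quadratic maps. The cone is the set where all `sig t`,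
`t ≠ 0`, are positive (`TAlgebra.Omega_eq`), hence open and convex. The Laplace transform `ell s` of
a power of the Haar measure of the group is a multiple of `Q^{-s}` on the cone
(`TAlgebra.ell_psi`), and by Fubini's theorem `y' ↦ ell s (y + y')` has an explicit integral against
a power of `Q` (`TAlgebra.lintegral_ell_add`).

*The form.* Each `t` in the group is implemented by some `g ∈ GL(m, ℂ)`, and `|det g|²` is the
character of `t` with exponent `b` (`HermitianForm.detChar_eq_chi`). This gives the integral of
`ell s (y + F(u, u))` over `u` (`HermitianForm.lintegral_ell_add_sesqDiag`) and the factor by which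
the affine automorphisms of `D` change `dV_ν`.

*The Bergman kernel.* These automorphisms act transitively on `D` and determine the kernel on the
diagonal up to a constant. The kernel is holomorphic in one variable and antiholomorphic in the
other, so that it is a multiple of `lap (ν + b/2 + τ) ((z - w̄) / 2i - F(u, t))`, where `lap` is the
analytic continuation of `ell` (`HermitianForm.exists_bergmanKernel_eq`). The value of the constant
is not needed.

*Integration over the real directions.* Since `lap s` is a multiple of the square of `lap (s / 2)`,
a Plancherel inequality bounds the integral of `|lap s|` over the imaginary directions by a multiple
of `ell (s - τ)` (`TAlgebra.lintegral_enorm_lap_le`). The operator acts in the real directions by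
convolution, and Minkowski's inequality (`eLpNorm_lintegral_le`) removes the exponent `p`.

*The base.* What remains is an operator with kernel
`ell (μ + α + b/2) (y + y' - F(u, u) - F(u', u') + F(u - u', u - u'))`. It maps powers of `Q` to
powers of `Q`, within the range of exponents where the integrals converge
(`HermitianForm.exists_lintegral_baseKer_mul_wt`); the hypotheses on `α`, `μ`, `ν` say that Schur's
test applies with a suitable power (`HermitianForm.exists_eLpNorm_baseKer_le`).
-/


set_option linter.unusedSectionVars false

noncomputable section

namespace TAlgebra

variable {r : ℕ} {U : Type*} [NonUnitalNonAssocRing U] [Module ℝ U]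
  [IsScalarTower ℝ U U] [SMulCommClass ℝ U U] [StarRing U] [StarModule ℝ U]

/-! ### Components of elements of a `T`-algebra -/

/-- The projection `x ↦ x_ij` onto the component `U_ij`. -/
def proj (T : TAlgebra r U) (i j : Fin r) : U →ₗ[ℝ] U :=
  (T.comp i j).subtype ∘ₗ
    (DirectSum.component ℝ (Fin r × Fin r) (fun p => T.comp p.1 p.2) (i, j)) ∘ₗ
    (LinearEquiv.ofBijective (DirectSum.coeLinearMap fun p : Fin r × Fin r => T.comp p.1 p.2)
      T.internal).symm.toLinearMap

theorem proj_mem (T : TAlgebra r U) (i j : Fin r) (x : U) : T.proj i j x ∈ T.comp i j := by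
  simp [proj]

theorem proj_of_mem (T : TAlgebra r U) {i j : Fin r} {x : U} (hx : x ∈ T.comp i j) :
    T.proj i j x = x :=
  congrArg Subtype.val (T.internal.ofBijective_coeLinearMap_of_mem (i := (i, j)) hx)

theorem proj_of_mem_ne (T : TAlgebra r U) {i j k l : Fin r} {x : U} (hx : x ∈ T.comp i j)
    (h : (i, j) ≠ (k, l)) : T.proj k l x = 0 :=
  congrArg Subtype.val (T.internal.ofBijective_coeLinearMap_of_mem_ne (i := (i, j)) h hx)

/-- A linear statement about `U` may be checked on the components. -/
theorem linearMap_ext (T : TAlgebra r U) {M : Type*} [AddCommMonoid M] [Module ℝ M]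
    {f g : U →ₗ[ℝ] M} (h : ∀ i j, ∀ x ∈ T.comp i j, f x = g x) : f = g := by
  have key : ∀ x : U, f x = g x := by
    intro x
    have hx : x ∈ ⨆ p : Fin r × Fin r, T.comp p.1 p.2 := by
      rw [T.internal.submodule_iSup_eq_top]; trivial
    refine Submodule.iSup_induction _ (motive := fun x => f x = g x) hx
      (fun p y hy => h p.1 p.2 y hy) (by simp) (fun y z hy hz => by simp [hy, hz])
  exact LinearMap.ext key

theorem sum_proj (T : TAlgebra r U) (x : U) : ∑ i, ∑ j, T.proj i j x = x := by
  have : (∑ i, ∑ j, T.proj i j) = LinearMap.id := by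
    refine T.linearMap_ext fun k l y hy => ?_
    simp only [LinearMap.sum_apply, LinearMap.id_apply]
    rw [Finset.sum_eq_single k, Finset.sum_eq_single l]
    · exact T.proj_of_mem hy
    · intro b _ hb
      exact T.proj_of_mem_ne hy (by simp [Ne.symm hb])
    · simp
    · intro b _ hb
      exact Finset.sum_eq_zero fun j _ => T.proj_of_mem_ne hy (by simp [Ne.symm hb])
    · simp
  simpa using congrArg (fun f : U →ₗ[ℝ] U => f x) this

theorem eq_of_proj_eq (T : TAlgebra r U) {x y : U} (h : ∀ i j, T.proj i j x = T.proj i j y) :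
    x = y := by
  rw [← T.sum_proj x, ← T.sum_proj y]
  simp [h]

/-- The involution as a real linear map. -/
def starLin : U →ₗ[ℝ] U where
  toFun := star
  map_add' := star_add
  map_smul' := by intro c x; simp [star_smul]

@[simp] theorem starLin_apply (x : U) : starLin x = star x := rfl

theorem star_proj (T : TAlgebra r U) (i j : Fin r) (x : U) :
    star (T.proj i j x) = T.proj j i (star x) := by
  have : starLin ∘ₗ T.proj i j = T.proj j i ∘ₗ starLin := by
    refine T.linearMap_ext fun k l y hy => ?_
    simp only [LinearMap.comp_apply, starLin_apply]
    have hy' := T.star_mem k l y hy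
    by_cases h : (k, l) = (i, j)
    · obtain ⟨rfl, rfl⟩ := Prod.mk.inj h
      rw [T.proj_of_mem hy, T.proj_of_mem hy']
    · rw [T.proj_of_mem_ne hy h, T.proj_of_mem_ne hy', star_zero]
      intro h'
      obtain ⟨rfl, rfl⟩ := Prod.mk.inj h'
      exact h rfl
  simpa using congrArg (fun f : U →ₗ[ℝ] U => f x) this

theorem comp_le_upper (T : TAlgebra r U) {i j : Fin r} (h : i ≤ j) : T.comp i j ≤ T.upper :=
  le_iSup_of_le i (le_iSup_of_le j (le_iSup_of_le h le_rfl))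

theorem mem_upper_iff (T : TAlgebra r U) {x : U} :
    x ∈ T.upper ↔ ∀ i j, j < i → T.proj i j x = 0 := by
  constructor
  · intro hx i j hij
    have : T.upper ≤ LinearMap.ker (T.proj i j) := by
      refine iSup_le fun k => iSup_le fun l => iSup_le fun hkl y hy => ?_
      refine T.proj_of_mem_ne hy ?_
      intro h
      obtain ⟨rfl, rfl⟩ := Prod.mk.inj h
      exact absurd hkl (not_le.2 hij)
    exact this hx
  · intro h
    rw [← T.sum_proj x]
    refine Submodule.sum_mem _ fun i _ => Submodule.sum_mem _ fun j _ => ?_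
    by_cases hij : i ≤ j
    · exact T.comp_le_upper hij (T.proj_mem i j x)
    · rw [h i j (not_le.1 hij)]; exact Submodule.zero_mem _

theorem rho_eq_rho_proj (T : TAlgebra r U) (i : Fin r) (x : U) :
    T.rho i x = T.rho i (T.proj i i x) := by
  have : T.rho i = T.rho i ∘ₗ T.proj i i := by
    refine T.linearMap_ext fun k l y hy => ?_
    simp only [LinearMap.comp_apply]
    by_cases h : (k, l) = (i, i)
    · obtain ⟨rfl, rfl⟩ := Prod.mk.inj h
      rw [T.proj_of_mem hy]
    · rw [T.proj_of_mem_ne hy h, T.rho_comp i k l y h hy, map_zero]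
  exact congrArg (fun f : U →ₗ[ℝ] ℝ => f x) this

theorem proj_diag (T : TAlgebra r U) (i : Fin r) (x : U) :
    T.proj i i x = T.rho i x • T.c i := by
  have h := T.proj_mem i i x
  rw [T.comp_diag, Submodule.mem_span_singleton] at h
  obtain ⟨a, ha⟩ := h
  rw [T.rho_eq_rho_proj, ← ha]
  simp [T.rho_c]

theorem c_mem (T : TAlgebra r U) (i : Fin r) : T.c i ∈ T.comp i i := by
  rw [T.comp_diag]; exact Submodule.mem_span_singleton_self _

theorem star_c (T : TAlgebra r U) (i : Fin r) : star (T.c i) = T.c i := by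
  have h := T.star_mem i i _ (T.c_mem i)
  rw [T.comp_diag, Submodule.mem_span_singleton] at h
  obtain ⟨a, ha⟩ := h
  have h2 : a * a = 1 := by
    have := congrArg star ha
    rw [star_star, star_smul, ← ha, smul_smul] at this
    have h3 := congrArg (T.rho i) this
    simpa [T.rho_c] using h3
  have hcc : T.c i * T.c i = T.c i := T.c_mul i i _ (T.c_mem i)
  have h4 := T.tr_pos _ (T.c_ne_zero i)
  rw [← ha, mul_smul_comm, hcc] at h4
  have h5 : ∑ j, T.rho j (a • T.c i) = a := by
    rw [Finset.sum_eq_single i]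
    · simp [T.rho_c]
    · intro j _ hj
      exact T.rho_comp j i i _ (by simp [Ne.symm hj]) (Submodule.smul_mem _ _ (T.c_mem i))
    · simp
  rw [h5] at h4
  have : a = 1 := by nlinarith
  rw [← ha, this, one_smul]

theorem rho_star (T : TAlgebra r U) (i : Fin r) (x : U) : T.rho i (star x) = T.rho i x := by
  rw [T.rho_eq_rho_proj i (star x), ← T.star_proj, T.proj_diag, star_smul, T.star_c]
  simp [T.rho_c]

theorem rho_c_ne (T : TAlgebra r U) {i j : Fin r} (h : i ≠ j) : T.rho i (T.c j) = 0 :=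
  T.rho_comp i j j _ (by simp [Ne.symm h]) (T.c_mem j)

/-- The unit `∑ c_i` of the `T`-algebra. -/
def unit (T : TAlgebra r U) : U := ∑ i, T.c i

theorem c_mul_of_mem (T : TAlgebra r U) (i j k : Fin r) {x : U} (hx : x ∈ T.comp j k) :
    T.c i * x = if i = j then x else 0 := by
  split_ifs with h
  · subst h; exact T.c_mul i k x hx
  · exact T.mul_eq_zero i i j k _ x h (T.c_mem i) hx

theorem mul_c_of_mem (T : TAlgebra r U) (i j k : Fin r) {x : U} (hx : x ∈ T.comp j k) :
    x * T.c i = if k = i then x else 0 := by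
  split_ifs with h
  · subst h; exact T.mul_c j k x hx
  · exact T.mul_eq_zero j k i i x _ h hx (T.c_mem i)

theorem unit_mul (T : TAlgebra r U) (x : U) : T.unit * x = x := by
  have : LinearMap.mulLeft ℝ T.unit = LinearMap.id := by
    refine T.linearMap_ext fun k l y hy => ?_
    simp [unit, Finset.sum_mul, T.c_mul_of_mem _ k l hy]
  simpa using congrArg (fun f : U →ₗ[ℝ] U => f x) this

theorem mul_unit (T : TAlgebra r U) (x : U) : x * T.unit = x := by
  have : LinearMap.mulRight ℝ T.unit = LinearMap.id := by
    refine T.linearMap_ext fun k l y hy => ?_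
    simp [unit, Finset.mul_sum, T.mul_c_of_mem _ k l hy]
  simpa using congrArg (fun f : U →ₗ[ℝ] U => f x) this

theorem star_unit (T : TAlgebra r U) : star T.unit = T.unit := by
  simp [unit, star_sum, T.star_c]

theorem rho_unit (T : TAlgebra r U) (i : Fin r) : T.rho i T.unit = 1 := by
  rw [unit, map_sum, Finset.sum_eq_single i]
  · exact T.rho_c i
  · intro j _ hj; exact T.rho_c_ne (Ne.symm hj)
  · simp

theorem unit_mem_upper (T : TAlgebra r U) : T.unit ∈ T.upper :=
  Submodule.sum_mem _ fun i _ => T.comp_le_upper le_rfl (T.c_mem i)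

theorem proj_mul (T : TAlgebra r U) (i k : Fin r) (x y : U) :
    T.proj i k (x * y) = ∑ j, T.proj i j x * T.proj j k y := by
  have h : ∀ (j l j' l' : Fin r), T.proj i k (T.proj j l x * T.proj j' l' y) =
      if l = j' then if j = i then if l' = k then T.proj j l x * T.proj j' l' y else 0 else 0
      else 0 := by
    intro j l j' l'
    by_cases h1 : l = j'
    · subst h1
      have hm := T.mul_mem j l l' _ _ (T.proj_mem j l x) (T.proj_mem l l' y)
      by_cases h2 : (j, l') = (i, k)
      · obtain ⟨rfl, rfl⟩ := Prod.mk.inj h2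
        simp [T.proj_of_mem hm]
      · rw [T.proj_of_mem_ne hm h2, if_pos rfl, ← ite_and, if_neg]
        rintro ⟨rfl, rfl⟩; exact h2 rfl
    · rw [T.mul_eq_zero j l j' l' _ _ h1 (T.proj_mem j l x) (T.proj_mem j' l' y), map_zero]
      simp
  conv_lhs => rw [← T.sum_proj x, ← T.sum_proj y]
  simp only [Finset.sum_mul, Finset.mul_sum, map_sum, h]
  simp

theorem rho_mul_of_mem_upper (T : TAlgebra r U) {x y : U} (hx : x ∈ T.upper) (hy : y ∈ T.upper)
    (i : Fin r) : T.rho i (x * y) = T.rho i x * T.rho i y := by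
  rw [T.rho_eq_rho_proj i (x * y), T.proj_mul, Finset.sum_eq_single i]
  · rw [T.proj_diag, T.proj_diag, smul_mul_smul_comm, T.c_mul i i _ (T.c_mem i), map_smul, T.rho_c,
      smul_eq_mul, mul_one]
  · intro j _ hj
    rcases lt_or_gt_of_ne hj with h | h
    · rw [T.mem_upper_iff.1 hx i j h, zero_mul]
    · rw [T.mem_upper_iff.1 hy j i h, mul_zero]
  · simp

/-- The trace `tr x = ∑ ρ(x_ii)`. -/
def tr (T : TAlgebra r U) : U →ₗ[ℝ] ℝ := ∑ i, T.rho i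

theorem tr_apply (T : TAlgebra r U) (x : U) : T.tr x = ∑ i, T.rho i x := by simp [tr]

theorem tr_mul_comm (T : TAlgebra r U) (x y : U) : T.tr (x * y) = T.tr (y * x) := by
  simpa [tr_apply] using T.tr_comm x y

theorem tr_mul_assoc (T : TAlgebra r U) (x y z : U) : T.tr (x * (y * z)) = T.tr ((x * y) * z) := by
  simpa [tr_apply] using T.tr_assoc x y z

theorem tr_mul_star_pos (T : TAlgebra r U) {x : U} (hx : x ≠ 0) : 0 < T.tr (x * star x) := by
  simpa [tr_apply] using T.tr_pos x hx

theorem tr_mul_star_nonneg (T : TAlgebra r U) (x : U) : 0 ≤ T.tr (x * star x) := by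
  by_cases hx : x = 0
  · simp [hx]
  · exact (T.tr_mul_star_pos hx).le

theorem tr_star (T : TAlgebra r U) (x : U) : T.tr (star x) = T.tr x := by
  simp [tr_apply, T.rho_star]

/-- Upper triangular part of `x`, with half of the diagonal: `x` is self-adjoint if and only if
it is the sum of this part and its adjoint. -/
def half (T : TAlgebra r U) : U →ₗ[ℝ] U :=
  ∑ i, ∑ j, (if i < j then (1 : ℝ) else if i = j then 1 / 2 else 0) • T.proj i j

theorem proj_half (T : TAlgebra r U) (i j : Fin r) (x : U) :
    T.proj i j (T.half x) = (if i < j then (1 : ℝ) else if i = j then 1 / 2 else 0) •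
      T.proj i j x := by
  simp only [half, LinearMap.sum_apply, map_sum, LinearMap.smul_apply, map_smul]
  rw [Finset.sum_eq_single i, Finset.sum_eq_single j]
  · rw [T.proj_of_mem (T.proj_mem i j x)]
  · intro b _ hb
    rw [T.proj_of_mem_ne (T.proj_mem i b x) (by simp [hb]), smul_zero]
  · simp
  · intro b _ hb
    refine Finset.sum_eq_zero fun l _ => ?_
    rw [T.proj_of_mem_ne (T.proj_mem b l x) (by simp [hb]), smul_zero]
  · simp

theorem half_mem_upper (T : TAlgebra r U) (x : U) : T.half x ∈ T.upper := by
  rw [T.mem_upper_iff]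
  intro i j hij
  rw [T.proj_half, if_neg (not_lt.2 hij.le), if_neg hij.ne', zero_smul]

theorem half_add_star (T : TAlgebra r U) {x : U} (hx : star x = x) :
    T.half x + star (T.half x) = x := by
  refine T.eq_of_proj_eq fun i j => ?_
  rw [map_add, ← T.star_proj, T.proj_half, T.proj_half, star_smul, T.star_proj, hx, ← add_smul]
  rcases lt_trichotomy i j with h | h | h
  · simp [h, h.ne', not_lt.2 h.le]
  · subst h; simp only [lt_irrefl, if_false, if_true, star_trivial]; norm_num
  · simp [h, h.ne', not_lt.2 h.le]

theorem half_of_upper (T : TAlgebra r U) {b : U} (hb : b ∈ T.upper) : T.half (b + star b) = b := by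
  refine T.eq_of_proj_eq fun i j => ?_
  rw [T.proj_half, map_add, ← T.star_proj]
  rcases lt_trichotomy i j with h | h | h
  · simp [h, T.mem_upper_iff.1 hb j i h]
  · subst h
    simp only [lt_irrefl, if_false, if_true, T.proj_diag, star_smul, T.star_c, star_trivial]
    rw [← add_smul, smul_smul]; congr 1; ring
  · simp [h.ne', not_lt.2 h.le, T.mem_upper_iff.1 hb i j h]

attribute [irreducible] proj half

end TAlgebra

end

noncomputable section

namespace TAlgebra

variable {r : ℕ} {U : Type*} [NonUnitalNonAssocRing U] [Module ℝ U]
  [IsScalarTower ℝ U U] [SMulCommClass ℝ U U] [StarRing U] [StarModule ℝ U]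
  {n : ℕ}

/-! ### The triangular group in the coordinates of `V` -/

/-- `point e` as a linear map. -/
def pointLin (e : Module.Basis (Fin n) ℝ (selfAdjoint.submodule ℝ U)) : (Fin n → ℝ) →ₗ[ℝ] U :=
  (selfAdjoint.submodule ℝ U).subtype ∘ₗ e.equivFun.symm.toLinearMap

theorem pointLin_apply (e : Module.Basis (Fin n) ℝ (selfAdjoint.submodule ℝ U)) (y : Fin n → ℝ) :
    pointLin e y = point e y := by
  simp [pointLin, point, Module.Basis.equivFun_symm_apply]

theorem star_pointLin (e : Module.Basis (Fin n) ℝ (selfAdjoint.submodule ℝ U)) (y : Fin n → ℝ) :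
    star (pointLin e y) = pointLin e y :=
  (e.equivFun.symm y).2

/-- The coordinates of the self-adjoint part `(x + x⋆) / 2`. -/
def coord (e : Module.Basis (Fin n) ℝ (selfAdjoint.submodule ℝ U)) : U →ₗ[ℝ] (Fin n → ℝ) :=
  e.equivFun.toLinearMap ∘ₗ LinearMap.codRestrict (selfAdjoint.submodule ℝ U)
    ((1 / 2 : ℝ) • (LinearMap.id + starLin)) (by
      intro x
      change star ((1 / 2 : ℝ) • (x + star x)) = (1 / 2 : ℝ) • (x + star x)
      rw [star_smul, star_add, star_star, add_comm (star x)]; simp)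

theorem pointLin_coord (e : Module.Basis (Fin n) ℝ (selfAdjoint.submodule ℝ U)) (x : U) :
    pointLin e (coord e x) = (1 / 2 : ℝ) • (x + star x) := by
  simp [pointLin, coord]

theorem pointLin_injective (e : Module.Basis (Fin n) ℝ (selfAdjoint.submodule ℝ U)) :
    Function.Injective (pointLin e) := by
  intro x y h
  exact e.equivFun.symm.injective (Subtype.ext h)

theorem pointLin_coord_of_star (e : Module.Basis (Fin n) ℝ (selfAdjoint.submodule ℝ U)) {x : U}
    (hx : star x = x) : pointLin e (coord e x) = x := by
  rw [pointLin_coord, hx, ← two_smul ℝ x, smul_smul]; norm_num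

theorem coord_star (e : Module.Basis (Fin n) ℝ (selfAdjoint.submodule ℝ U)) (x : U) :
    coord e (star x) = coord e x := by
  apply pointLin_injective e
  rw [pointLin_coord, pointLin_coord, star_star, add_comm]

/-- The upper triangular element `a` with `a + a⋆` the given point of `V`: this identifies `V`
with the algebra of upper triangular elements. -/
def tri (T : TAlgebra r U) (e : Module.Basis (Fin n) ℝ (selfAdjoint.submodule ℝ U)) :
    (Fin n → ℝ) →ₗ[ℝ] U := T.half ∘ₗ pointLin e

/-- The inverse of `tri` on upper triangular elements. -/
def untri (e : Module.Basis (Fin n) ℝ (selfAdjoint.submodule ℝ U)) : U →ₗ[ℝ] (Fin n → ℝ) :=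
  (2 : ℝ) • coord e

variable (T : TAlgebra r U) (e : Module.Basis (Fin n) ℝ (selfAdjoint.submodule ℝ U))

theorem tri_mem_upper (a : Fin n → ℝ) : T.tri e a ∈ T.upper := T.half_mem_upper _

theorem tri_add_star (a : Fin n → ℝ) : T.tri e a + star (T.tri e a) = pointLin e a :=
  T.half_add_star (star_pointLin e a)

theorem pointLin_untri (b : U) : pointLin e (untri e b) = b + star b := by
  rw [untri, LinearMap.smul_apply, map_smul, pointLin_coord, smul_smul]; norm_num

theorem tri_untri {b : U} (hb : b ∈ T.upper) : T.tri e (untri e b) = b := by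
  rw [tri, LinearMap.comp_apply, pointLin_untri, T.half_of_upper hb]

theorem untri_tri (a : Fin n → ℝ) : untri e (T.tri e a) = a := by
  apply pointLin_injective e
  rw [pointLin_untri, tri_add_star]

theorem tri_injective : Function.Injective (T.tri e) :=
  Function.LeftInverse.injective (T.untri_tri e)

/-- The product of upper triangular elements, in coordinates. -/
def xmul : (Fin n → ℝ) →ₗ[ℝ] (Fin n → ℝ) →ₗ[ℝ] (Fin n → ℝ) :=
  ((LinearMap.mul ℝ U).compl₁₂ (T.tri e) (T.tri e)).compr₂ (untri e)

theorem tri_xmul (a b : Fin n → ℝ) : T.tri e (T.xmul e a b) = T.tri e a * T.tri e b := by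
  simp only [xmul, LinearMap.compr₂_apply, LinearMap.compl₁₂_apply, LinearMap.mul_apply']
  exact T.tri_untri e (T.upper_mul_mem (T.tri_mem_upper e a) (T.tri_mem_upper e b))

/-- The coordinates of the unit of the algebra of upper triangular elements. -/
def xone : Fin n → ℝ := untri e T.unit

theorem tri_xone : T.tri e (T.xone e) = T.unit := T.tri_untri e T.unit_mem_upper

theorem xmul_assoc (a b c : Fin n → ℝ) :
    T.xmul e (T.xmul e a b) c = T.xmul e a (T.xmul e b c) := by
  apply T.tri_injective e
  simp only [tri_xmul]
  exact (T.upper_assoc _ _ _ (T.tri_mem_upper e a) (T.tri_mem_upper e b)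
    (T.tri_mem_upper e c)).symm

theorem xone_xmul (a : Fin n → ℝ) : T.xmul e (T.xone e) a = a := by
  apply T.tri_injective e
  rw [tri_xmul, tri_xone, T.unit_mul]

theorem xmul_xone (a : Fin n → ℝ) : T.xmul e a (T.xone e) = a := by
  apply T.tri_injective e
  rw [tri_xmul, tri_xone, T.mul_unit]

/-- The diagonal entries of an upper triangular element, in coordinates. -/
def dg (j : Fin r) : (Fin n → ℝ) →ₗ[ℝ] ℝ := T.rho j ∘ₗ T.tri e

theorem dg_apply (j : Fin r) (a : Fin n → ℝ) : T.dg e j a = T.rho j (T.tri e a) := rfl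

theorem dg_xmul (j : Fin r) (a b : Fin n → ℝ) :
    T.dg e j (T.xmul e a b) = T.dg e j a * T.dg e j b := by
  simp only [dg, LinearMap.comp_apply, tri_xmul]
  exact T.rho_mul_of_mem_upper (T.tri_mem_upper e a) (T.tri_mem_upper e b) j

theorem dg_xone (j : Fin r) : T.dg e j (T.xone e) = 1 := by
  simp [dg, tri_xone, rho_unit]

/-- The triangular group `H` in coordinates. -/
def HX : Set (Fin n → ℝ) := {a | ∀ j, 0 < T.dg e j a}

theorem mem_HX {a : Fin n → ℝ} : a ∈ T.HX e ↔ ∀ j, 0 < T.dg e j a := Iff.rfl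

theorem tri_mem_H {a : Fin n → ℝ} : T.tri e a ∈ T.H ↔ a ∈ T.HX e :=
  ⟨fun h => h.2, fun h => ⟨T.tri_mem_upper e a, h⟩⟩

theorem xone_mem_HX : T.xone e ∈ T.HX e := fun j => by rw [dg_xone]; exact one_pos

theorem xmul_mem_HX {a b : Fin n → ℝ} (ha : a ∈ T.HX e) (hb : b ∈ T.HX e) :
    T.xmul e a b ∈ T.HX e := fun j => by rw [dg_xmul]; exact mul_pos (ha j) (hb j)

/-- The symmetrization of `(a, b) ↦ a b⋆`, in coordinates. -/
def psi₂ : (Fin n → ℝ) →ₗ[ℝ] (Fin n → ℝ) →ₗ[ℝ] (Fin n → ℝ) :=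
  ((LinearMap.mul ℝ U).compl₁₂ (T.tri e) (starLin ∘ₗ T.tri e)).compr₂ (coord e)

theorem psi₂_apply (a b : Fin n → ℝ) :
    T.psi₂ e a b = coord e (T.tri e a * star (T.tri e b)) := rfl

theorem psi₂_comm (a b : Fin n → ℝ) : T.psi₂ e a b = T.psi₂ e b a := by
  rw [psi₂_apply, psi₂_apply, ← coord_star, star_mul, star_star]

/-- The map `t ↦ t t⋆`, in coordinates. -/
def psi (a : Fin n → ℝ) : Fin n → ℝ := T.psi₂ e a a

theorem psi_eq (a : Fin n → ℝ) : T.psi e a = T.psi₂ e a a := rfl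

theorem pointLin_psi (a : Fin n → ℝ) :
    pointLin e (T.psi e a) = T.tri e a * star (T.tri e a) :=
  pointLin_coord_of_star e
    (show star (T.tri e a * star (T.tri e a)) = T.tri e a * star (T.tri e a) by
      rw [star_mul, star_star])

theorem psi₂_xone (b : Fin n → ℝ) : T.psi₂ e b (T.xone e) = (1 / 2 : ℝ) • b := by
  rw [psi₂_apply, tri_xone, star_unit, mul_unit]
  conv_rhs => rw [← T.untri_tri e b, untri, LinearMap.smul_apply, smul_smul]
  norm_num

theorem psi_add (a b : Fin n → ℝ) :
    T.psi e (a + b) = T.psi e a + (2 : ℝ) • T.psi₂ e a b + T.psi e b := by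
  simp only [psi, map_add, LinearMap.add_apply]
  rw [T.psi₂_comm e b a, two_smul]; abel

theorem psi_smul (c : ℝ) (a : Fin n → ℝ) : T.psi e (c • a) = (c ^ 2) • T.psi e a := by
  simp only [psi, map_smul, LinearMap.smul_apply, smul_smul, sq]

/-- Every vector is a difference of values of `psi`. -/
theorem eq_psi_sub (b : Fin n → ℝ) :
    b = T.psi e (b + T.xone e) - T.psi e b - T.psi e (T.xone e) := by
  rw [psi_add, psi₂_xone, smul_smul, show (2 : ℝ) * (1 / 2) = 1 by norm_num, one_smul]
  abel

/-- The values of `psi` determine a linear map. -/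
theorem linearMap_ext_psi {M : Type*} [AddCommGroup M] [Module ℝ M]
    {f g : (Fin n → ℝ) →ₗ[ℝ] M} (h : ∀ a, f (T.psi e a) = g (T.psi e a)) : f = g := by
  refine LinearMap.ext fun b => ?_
  rw [T.eq_psi_sub e b, map_sub, map_sub, map_sub, map_sub, h, h, h]

/-- `act t` as a linear map. -/
def actLin (t : U) : U →ₗ[ℝ] U :=
  (1 / 2 : ℝ) • ((LinearMap.mulLeft ℝ t + LinearMap.mulRight ℝ (star t)) ∘ₗ
    (LinearMap.mulLeft ℝ t + LinearMap.mulRight ℝ (star t)) -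
    (LinearMap.mulLeft ℝ (t * t) + LinearMap.mulRight ℝ (star (t * t))))

theorem actLin_apply (t x : U) : actLin t x = act t x := by
  simp [actLin, act]

/-- The representation `π`, in coordinates. -/
def pi (a : Fin n → ℝ) : (Fin n → ℝ) →ₗ[ℝ] (Fin n → ℝ) :=
  coord e ∘ₗ actLin (T.tri e a) ∘ₗ pointLin e

theorem star_act (t x : U) : star (act t x) = act t (star x) := by
  simp only [act, star_smul, star_sub, star_add, star_mul, star_star, star_trivial]
  rw [add_comm (star x * star t) (t * star x), add_comm (star x * (star t * star t)),
    add_comm (_ * star t)]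

theorem pointLin_pi (a y : Fin n → ℝ) : pointLin e (T.pi e a y) = act (T.tri e a) (point e y) := by
  simp only [pi, LinearMap.comp_apply, actLin_apply]
  rw [pointLin_coord_of_star, pointLin_apply]
  rw [star_act, star_pointLin]

theorem pi_psi (a b : Fin n → ℝ) : T.pi e a (T.psi e b) = T.psi e (T.xmul e a b) := by
  apply pointLin_injective e
  rw [pointLin_pi, ← pointLin_apply, pointLin_psi, pointLin_psi, tri_xmul,
    T.act_mul_star (T.tri_mem_upper e a) (T.tri_mem_upper e b)]

theorem pi_xmul (a b : Fin n → ℝ) : T.pi e (T.xmul e a b) = T.pi e a ∘ₗ T.pi e b := by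
  refine T.linearMap_ext_psi e fun c => ?_
  rw [LinearMap.comp_apply, pi_psi, pi_psi, pi_psi, xmul_assoc]

theorem pi_xone : T.pi e (T.xone e) = LinearMap.id := by
  refine T.linearMap_ext_psi e fun c => ?_
  rw [pi_psi, xone_xmul, LinearMap.id_apply]

/-- The trace on `V`, in coordinates. -/
def trX : (Fin n → ℝ) →ₗ[ℝ] ℝ := T.tr ∘ₗ pointLin e

theorem trX_psi (a : Fin n → ℝ) :
    T.trX e (T.psi e a) = T.tr (T.tri e a * star (T.tri e a)) := by
  rw [trX, LinearMap.comp_apply, pointLin_psi]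

theorem trX_psi_pos {a : Fin n → ℝ} (ha : a ≠ 0) : 0 < T.trX e (T.psi e a) := by
  rw [trX_psi]
  exact T.tr_mul_star_pos fun h => ha (T.tri_injective e (by rw [h, map_zero]))

theorem trX_psi_nonneg (a : Fin n → ℝ) : 0 ≤ T.trX e (T.psi e a) := by
  rw [trX_psi]; exact T.tr_mul_star_nonneg _

/-- The functional `y ↦ tr (π(a) y)`; as `a` runs through `H` these functionals fill the open dual
cone. -/
def sig (a : Fin n → ℝ) : (Fin n → ℝ) →ₗ[ℝ] ℝ := T.trX e ∘ₗ T.pi e a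

theorem sig_apply (a y : Fin n → ℝ) : T.sig e a y = T.trX e (T.pi e a y) := rfl

theorem sig_psi (a b : Fin n → ℝ) : T.sig e a (T.psi e b) = T.trX e (T.psi e (T.xmul e a b)) := by
  rw [sig_apply, pi_psi]

theorem sig_xmul (a b : Fin n → ℝ) : T.sig e (T.xmul e a b) = T.sig e a ∘ₗ T.pi e b := by
  rw [sig, pi_xmul]; rfl

theorem sig_xone : T.sig e (T.xone e) = T.trX e := by
  rw [sig, pi_xone]; rfl

/-- The bilinear form in `(a, b)` with `sig a = sig₂ a a`. -/
def sig₂ : (Fin n → ℝ) →ₗ[ℝ] (Fin n → ℝ) →ₗ[ℝ] (Fin n → ℝ) →ₗ[ℝ] ℝ :=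
  LinearMap.mk₂ ℝ (fun a b => T.tr ∘ₗ LinearMap.mulLeft ℝ (star (T.tri e b) * T.tri e a) ∘ₗ
      pointLin e)
    (by intro a a' b; ext; simp [mul_add, add_mul])
    (by intro c a b; ext; simp [mul_smul_comm, smul_mul_assoc])
    (by intro a b b'; ext; simp [add_mul])
    (by intro c a b; ext; simp [star_smul, smul_mul_assoc])

theorem sig₂_apply (a b y : Fin n → ℝ) :
    T.sig₂ e a b y = T.tr (star (T.tri e b) * T.tri e a * pointLin e y) := rfl

theorem sig₂_comm (a b : Fin n → ℝ) : T.sig₂ e a b = T.sig₂ e b a := by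
  refine LinearMap.ext fun y => ?_
  rw [sig₂_apply, sig₂_apply, ← T.tr_star, star_mul, star_mul, star_star, star_pointLin,
    T.tr_mul_comm]

theorem sig_eq_sig₂ (a : Fin n → ℝ) : T.sig e a = T.sig₂ e a a := by
  refine LinearMap.ext fun y => ?_
  rw [sig₂_apply, sig_apply, trX, LinearMap.comp_apply, pointLin_pi, ← pointLin_apply, act]
  set t := T.tri e a
  set x := pointLin e y
  simp only [map_smul, map_sub, map_add, mul_add, add_mul, smul_eq_mul]
  have h1 : T.tr (t * (t * x)) = T.tr (t * t * x) := T.tr_mul_assoc t t x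
  have h2 : T.tr (t * (x * star t)) = T.tr (star t * t * x) := by
    rw [T.tr_mul_assoc, T.tr_mul_comm, T.tr_mul_assoc]
  have h3 : T.tr (t * x * star t) = T.tr (star t * t * x) := by
    rw [T.tr_mul_comm, T.tr_mul_assoc]
  have h4 : T.tr (x * star t * star t) = T.tr (x * star (t * t)) := by
    rw [← T.tr_mul_assoc, star_mul]
  rw [h1, h2, h3, h4]; ring

theorem sig₂_xone (b y : Fin n → ℝ) : T.sig₂ e b (T.xone e) y = T.tr (T.tri e b * pointLin e y) := by
  rw [sig₂_apply, tri_xone, star_unit, unit_mul]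

theorem mem_Omega_iff {y : Fin n → ℝ} : y ∈ T.Omega e ↔ ∃ a ∈ T.HX e, T.psi e a = y := by
  constructor
  · rintro ⟨s, hs, h⟩
    have hs' := T.tri_untri e hs.1
    refine ⟨untri e s, by rw [← tri_mem_H, hs']; exact hs, ?_⟩
    apply pointLin_injective e
    rw [pointLin_psi, hs', h, pointLin_apply]
  · rintro ⟨a, ha, rfl⟩
    exact ⟨T.tri e a, (T.tri_mem_H e).2 ha, by rw [← pointLin_psi, pointLin_apply]⟩

theorem psi_mem_Omega {a : Fin n → ℝ} (ha : a ∈ T.HX e) : T.psi e a ∈ T.Omega e :=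
  (T.mem_Omega_iff e).2 ⟨a, ha, rfl⟩

attribute [irreducible] coord untri tri xmul xone dg psi₂ psi pi trX sig sig₂ pointLin

end TAlgebra

end

noncomputable section

/-- A bilinear map on finite dimensional spaces is jointly continuous. -/
theorem continuous_bilin {E F G : Type*} [NormedAddCommGroup E] [NormedSpace ℝ E]
    [FiniteDimensional ℝ E] [NormedAddCommGroup F] [NormedSpace ℝ F] [FiniteDimensional ℝ F]
    [NormedAddCommGroup G] [NormedSpace ℝ G] (f : E →ₗ[ℝ] F →ₗ[ℝ] G) :
    Continuous fun p : E × F => f p.1 p.2 := by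
  let g : E →L[ℝ] F →L[ℝ] G :=
    LinearMap.toContinuousLinearMap (LinearMap.toContinuousLinearMap.toLinearMap ∘ₗ f)
  exact g.continuous₂

namespace TAlgebra

variable {r : ℕ} {U : Type*} [NonUnitalNonAssocRing U] [Module ℝ U]
  [IsScalarTower ℝ U U] [SMulCommClass ℝ U U] [StarRing U] [StarModule ℝ U]
  {n : ℕ}
variable (T : TAlgebra r U) (e : Module.Basis (Fin n) ℝ (selfAdjoint.submodule ℝ U))

/-! ### Continuity -/

theorem continuous_xmul : Continuous fun p : (Fin n → ℝ) × (Fin n → ℝ) => T.xmul e p.1 p.2 :=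
  continuous_bilin _

theorem continuous_psi : Continuous (T.psi e) := by
  change Continuous fun a => T.psi e a
  simp_rw [psi_eq]
  exact (continuous_bilin (T.psi₂ e)).comp (continuous_id.prodMk continuous_id)

theorem continuous_dg (j : Fin r) : Continuous (T.dg e j) :=
  LinearMap.continuous_of_finiteDimensional _

theorem continuous_pi : Continuous fun p : (Fin n → ℝ) × (Fin n → ℝ) => T.pi e p.1 p.2 := by
  have : (fun p : (Fin n → ℝ) × (Fin n → ℝ) => T.pi e p.1 p.2) = fun p =>
      T.psi e (T.xmul e p.1 (p.2 + T.xone e)) - T.psi e (T.xmul e p.1 p.2) - T.psi e p.1 := by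
    funext p
    conv_lhs => rw [T.eq_psi_sub e p.2]
    rw [map_sub, map_sub, pi_psi, pi_psi, pi_psi, xmul_xone]
  rw [this]
  have h1 := T.continuous_psi e
  have h2 := T.continuous_xmul e
  exact ((h1.comp (h2.comp (continuous_fst.prodMk (continuous_snd.add continuous_const)))).sub
    (h1.comp h2)).sub (h1.comp continuous_fst)

theorem isOpen_HX : IsOpen (T.HX e) := by
  have : T.HX e = ⋂ j, T.dg e j ⁻¹' Set.Ioi 0 := by
    ext a; simp [mem_HX]
  rw [this]
  exact isOpen_iInter_of_finite fun j => isOpen_Ioi.preimage (T.continuous_dg e j)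

/-! ### Diagonal elements and characters of the triangular group -/

/-- The diagonal element `∑ d_i c_i`, in coordinates. -/
def diagX (d : Fin r → ℝ) : Fin n → ℝ := untri e (∑ i, d i • T.c i)

theorem tri_diagX (d : Fin r → ℝ) : T.tri e (T.diagX e d) = ∑ i, d i • T.c i :=
  T.tri_untri e (Submodule.sum_mem _ fun i _ =>
    Submodule.smul_mem _ _ (T.comp_le_upper le_rfl (T.c_mem i)))

theorem dg_diagX (d : Fin r → ℝ) (j : Fin r) : T.dg e j (T.diagX e d) = d j := by
  rw [dg_apply, tri_diagX, map_sum, Finset.sum_eq_single j]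
  · simp [T.rho_c]
  · intro i _ hi; rw [map_smul, T.rho_c_ne (Ne.symm hi), smul_zero]
  · simp

theorem diagX_mem_HX {d : Fin r → ℝ} (hd : ∀ j, 0 < d j) : T.diagX e d ∈ T.HX e :=
  fun j => by rw [dg_diagX]; exact hd j

theorem diagX_one : T.diagX e 1 = T.xone e := by simp [diagX, xone, unit]

theorem diag_mul_of_mem (d : Fin r → ℝ) {i j : Fin r} {x : U} (hx : x ∈ T.comp i j) :
    (∑ k, d k • T.c k) * x = d i • x := by
  simp [Finset.sum_mul, smul_mul_assoc, T.c_mul_of_mem _ i j hx]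

theorem mul_diag_of_mem (d : Fin r → ℝ) {i j : Fin r} {x : U} (hx : x ∈ T.comp i j) :
    x * (∑ k, d k • T.c k) = d j • x := by
  simp [Finset.mul_sum, mul_smul_comm, T.mul_c_of_mem _ i j hx]

theorem diagX_xmul_diagX (d d' : Fin r → ℝ) :
    T.xmul e (T.diagX e d) (T.diagX e d') = T.diagX e (d * d') := by
  apply T.tri_injective e
  rw [tri_xmul, tri_diagX, tri_diagX, tri_diagX, Finset.mul_sum]
  refine Finset.sum_congr rfl fun i _ => ?_
  rw [mul_smul_comm, T.diag_mul_of_mem d (T.c_mem i), smul_smul, Pi.mul_apply, mul_comm]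

theorem eq_diagX {a : Fin n → ℝ} (h : ∀ i j, i < j → T.proj i j (T.tri e a) = 0) :
    a = T.diagX e (fun j => T.dg e j a) := by
  apply T.tri_injective e
  rw [tri_diagX]
  conv_lhs => rw [← T.sum_proj (T.tri e a)]
  refine Finset.sum_congr rfl fun i _ => ?_
  rw [Finset.sum_eq_single i]
  · rw [T.proj_diag, ← dg_apply]
  · intro j _ hj
    rcases lt_or_gt_of_ne hj with h' | h'
    · exact T.mem_upper_iff.1 (T.tri_mem_upper e a) i j h'
    · exact h i j h'
  · simp

/-- A continuous character of the triangular group depends on the diagonal entries only: conjugation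
by diagonal elements contracts `t` to its diagonal. -/
theorem char_eq_diagX {χ : (Fin n → ℝ) → ℝ} (hc : Continuous χ)
    (hχ : ∀ a ∈ T.HX e, ∀ b ∈ T.HX e, χ (T.xmul e a b) = χ a * χ b) {t : Fin n → ℝ}
    (ht : t ∈ T.HX e) : χ t = χ (T.diagX e (fun j => T.dg e j t)) := by
  -- the conjugate of `t` by the diagonal element with entries `ε ^ (-i)`; it is polynomial in `ε`
  set g : ℝ → Fin n → ℝ := fun ε => ∑ i : Fin r, ∑ j : Fin r,
    (if i ≤ j then ε ^ ((j : ℕ) - (i : ℕ)) else 0) • untri e (T.proj i j (T.tri e t)) with hg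
  have hgc : Continuous g := by
    refine continuous_finsetSum _ fun i _ => continuous_finsetSum _ fun j _ => ?_
    split_ifs
    · fun_prop
    · fun_prop
  have hg0 : g 0 = T.diagX e (fun j => T.dg e j t) := by
    simp only [hg, diagX, map_sum]
    refine Finset.sum_congr rfl fun i _ => ?_
    rw [Finset.sum_eq_single i]
    · simp only [le_refl, if_true, Nat.sub_self, pow_zero, one_smul, T.proj_diag, ← dg_apply]
    · intro j _ hj
      by_cases h : i ≤ j
      · rw [if_pos h, zero_pow, zero_smul]
        have : i < j := lt_of_le_of_ne h (Ne.symm hj)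
        have : (i : ℕ) < j := this
        omega
      · rw [if_neg h, zero_smul]
    · simp
  have hgε : ∀ ε : ℝ, 0 < ε → χ (g ε) = χ t := by
    intro ε hε
    set d : Fin r → ℝ := fun i => (ε ^ (i : ℕ))⁻¹ with hd
    have hdpos : ∀ i, 0 < d i := fun i => by positivity
    have hdi : ∀ i, 0 < d⁻¹ i := fun i => inv_pos.2 (hdpos i)
    have h1 : T.xmul e (T.xmul e (T.diagX e d) t) (T.diagX e d⁻¹) = g ε := by
      apply T.tri_injective e
      rw [tri_xmul, tri_xmul, tri_diagX, tri_diagX]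
      have hl := fun i j x (hx : x ∈ T.comp i j) => T.diag_mul_of_mem d hx
      have hr := fun i j x (hx : x ∈ T.comp i j) => T.mul_diag_of_mem d⁻¹ hx
      generalize (∑ i, d i • T.c i) = D at hl ⊢
      generalize (∑ i, d⁻¹ i • T.c i) = D' at hr ⊢
      simp only [hg, map_sum, map_smul]
      conv_lhs => rw [← T.sum_proj (T.tri e t)]
      rw [Finset.mul_sum, Finset.sum_mul]
      refine Finset.sum_congr rfl fun i _ => ?_
      rw [Finset.mul_sum, Finset.sum_mul]
      refine Finset.sum_congr rfl fun j _ => ?_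
      have hm := T.proj_mem i j (T.tri e t)
      rw [hl _ _ _ hm, smul_mul_assoc, hr _ _ _ hm, smul_smul]
      by_cases h : i ≤ j
      · rw [if_pos h, T.tri_untri e (T.comp_le_upper h hm)]
        congr 1
        have h' : (i : ℕ) ≤ j := h
        rw [pow_sub₀ _ hε.ne' h']
        simp [hd, mul_comm]
      · rw [T.mem_upper_iff.1 (T.tri_mem_upper e t) i j (not_le.1 h)]
        simp
    have hD := T.diagX_mem_HX e hdpos
    have hD' := T.diagX_mem_HX e hdi
    have h2 : χ (T.diagX e d) * χ (T.diagX e d⁻¹) = χ (T.xone e) := by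
      rw [← hχ _ hD _ hD', diagX_xmul_diagX, ← diagX_one]
      congr 2
      funext i; simp [(hdpos i).ne']
    have h3 : χ t = χ (T.xone e) * χ t := by
      rw [← hχ _ (T.xone_mem_HX e) _ ht, xone_xmul]
    rw [← h1, hχ _ (T.xmul_mem_HX e hD ht) _ hD', hχ _ hD _ ht, mul_right_comm, h2, ← h3]
  have hlim : Filter.Tendsto (fun ε => χ (g ε)) (nhdsWithin 0 (Set.Ioi 0)) (nhds (χ (g 0))) :=
    ((hc.comp hgc).tendsto 0).mono_left nhdsWithin_le_nhds
  have hlim' : Filter.Tendsto (fun ε => χ (g ε)) (nhdsWithin 0 (Set.Ioi 0)) (nhds (χ t)) :=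
    tendsto_const_nhds.congr' (by
      filter_upwards [self_mem_nhdsWithin] with ε hε using (hgε ε hε).symm)
  rw [← hg0]
  exact tendsto_nhds_unique hlim' hlim

section Basis

variable [FiniteDimensional ℝ U]

/-- Index set of a basis of the upper triangular elements that is adapted to the components. -/
abbrev TriIdx (T : TAlgebra r U) : Type :=
  Σ p : {p : Fin r × Fin r // p.1 ≤ p.2}, Fin (Module.finrank ℝ (T.comp p.1.1 p.1.2))

/-- The coordinates of the members of an adapted basis of the upper triangular elements. -/
def triVec (k : T.TriIdx) : Fin n → ℝ :=
  untri e ((Module.finBasis ℝ (T.comp k.1.1.1 k.1.1.2) k.2 : T.comp k.1.1.1 k.1.1.2) : U)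

theorem tri_triVec (k : T.TriIdx) : T.tri e (T.triVec e k) =
    ((Module.finBasis ℝ (T.comp k.1.1.1 k.1.1.2) k.2 : T.comp k.1.1.1 k.1.1.2) : U) :=
  T.tri_untri e (T.comp_le_upper k.1.2 (Submodule.coe_mem _))

theorem tri_triVec_mem (k : T.TriIdx) : T.tri e (T.triVec e k) ∈ T.comp k.1.1.1 k.1.1.2 := by
  rw [tri_triVec]; exact Submodule.coe_mem _

theorem linearIndependent_triVec : LinearIndependent ℝ (T.triVec e) := by
  apply LinearIndependent.of_comp (T.tri e)
  set b := T.internal.collectedBasis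
    (fun p : Fin r × Fin r => Module.finBasis ℝ (T.comp p.1 p.2)) with hb
  have h := b.linearIndependent.comp
    (fun k : T.TriIdx => (⟨k.1.1, k.2⟩ : Σ p : Fin r × Fin r,
      Fin (Module.finrank ℝ (T.comp p.1 p.2)))) (by
      rintro ⟨⟨p, hp⟩, a⟩ ⟨⟨q, hq⟩, b⟩ h
      simp only [Sigma.mk.injEq] at h
      obtain ⟨rfl, h2⟩ := h
      obtain rfl := eq_of_heq h2
      rfl)
  convert h using 1
  funext k
  simp only [Function.comp_apply, tri_triVec, hb, DirectSum.IsInternal.collectedBasis_coe]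

theorem span_triVec : ⊤ ≤ Submodule.span ℝ (Set.range (T.triVec e)) := by
  intro a _
  rw [← T.untri_tri e a, ← T.sum_proj (T.tri e a), map_sum]
  refine Submodule.sum_mem _ fun i _ => ?_
  rw [map_sum]
  refine Submodule.sum_mem _ fun j _ => ?_
  by_cases h : i ≤ j
  · have hx := (Module.finBasis ℝ (T.comp i j)).sum_repr ⟨_, T.proj_mem i j (T.tri e a)⟩
    have hx' := congrArg Subtype.val hx
    simp only [Submodule.coe_sum, Submodule.coe_smul] at hx'
    rw [← hx', map_sum]
    refine Submodule.sum_mem _ fun k _ => ?_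
    rw [map_smul]
    exact Submodule.smul_mem _ _ (Submodule.subset_span ⟨⟨⟨(i, j), h⟩, k⟩, rfl⟩)
  · rw [T.mem_upper_iff.1 (T.tri_mem_upper e a) i j (not_le.1 h), map_zero]
    exact Submodule.zero_mem _

/-- An adapted basis of the upper triangular elements, in coordinates. -/
def triBasis : Module.Basis T.TriIdx ℝ (Fin n → ℝ) :=
  Module.Basis.mk (T.linearIndependent_triVec e) (T.span_triVec e)

theorem triBasis_apply (k : T.TriIdx) : T.triBasis e k = T.triVec e k := by
  simp [triBasis]

theorem det_eq_prod_of_triBasis (f : (Fin n → ℝ) →ₗ[ℝ] (Fin n → ℝ)) (c : T.TriIdx → ℝ)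
    (h : ∀ k, f (T.triVec e k) = c k • T.triVec e k) : LinearMap.det f = ∏ k, c k := by
  rw [← LinearMap.det_toMatrix (T.triBasis e)]
  have : LinearMap.toMatrix (T.triBasis e) (T.triBasis e) f = Matrix.diagonal c := by
    ext i j
    rw [LinearMap.toMatrix_apply, triBasis_apply, h, ← triBasis_apply, map_smul,
      Module.Basis.repr_self, Finsupp.smul_apply, Finsupp.single_apply, Matrix.diagonal_apply]
    by_cases hij : i = j
    · subst hij; simp
    · rw [if_neg (Ne.symm hij), if_neg hij]; simp
  rw [this, Matrix.det_diagonal]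

theorem finrank_comp_diag (i : Fin r) : Module.finrank ℝ (T.comp i i) = 1 := by
  rw [T.comp_diag]; exact finrank_span_singleton (T.c_ne_zero i)

theorem prod_triIdx (f : Fin r → Fin r → ℝ) :
    ∏ k : T.TriIdx, f k.1.1.1 k.1.1.2 =
      ∏ i, ∏ j, if i ≤ j then f i j ^ Module.finrank ℝ (T.comp i j) else 1 := by
  rw [Fintype.prod_sigma]
  simp only [Finset.prod_const, Finset.card_univ, Fintype.card_fin]
  rw [← Fintype.prod_prod_type' (f := fun i j => if i ≤ j then
    f i j ^ Module.finrank ℝ (T.comp i j) else 1)]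
  rw [← Finset.prod_filter]
  rw [Finset.prod_subtype (p := fun p : Fin r × Fin r => p.1 ≤ p.2) _ (by simp)]

theorem prod_triIdx_fst (d : Fin r → ℝ) :
    ∏ k : T.TriIdx, d k.1.1.1 = ∏ j, d j ^ (1 + T.mDim j) := by
  rw [T.prod_triIdx fun i _ => d i]
  refine Finset.prod_congr rfl fun i _ => ?_
  rw [← Finset.prod_filter, Finset.prod_pow_eq_pow_sum]
  congr 1
  rw [mDim, ← T.finrank_comp_diag i]
  have : Finset.univ.filter (fun k => i ≤ k) = insert i (Finset.univ.filter fun k => i < k) := by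
    ext k; simp [le_iff_eq_or_lt, eq_comm]
  rw [this, Finset.sum_insert (by simp)]

theorem prod_triIdx_snd (d : Fin r → ℝ) :
    ∏ k : T.TriIdx, d k.1.1.2 = ∏ j, d j ^ (1 + T.nDim j) := by
  rw [T.prod_triIdx fun _ j => d j, Finset.prod_comm]
  refine Finset.prod_congr rfl fun i _ => ?_
  rw [← Finset.prod_filter, Finset.prod_pow_eq_pow_sum]
  congr 1
  rw [nDim, ← T.finrank_comp_diag i]
  have : Finset.univ.filter (fun k => k ≤ i) = insert i (Finset.univ.filter fun k => k < i) := by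
    ext k; simp [le_iff_eq_or_lt]
  rw [this, Finset.sum_insert (by simp)]

theorem diagX_xmul_triVec (d : Fin r → ℝ) (k : T.TriIdx) :
    T.xmul e (T.diagX e d) (T.triVec e k) = d k.1.1.1 • T.triVec e k := by
  apply T.tri_injective e
  rw [tri_xmul, tri_diagX, T.diag_mul_of_mem d (T.tri_triVec_mem e k), map_smul]

theorem triVec_xmul_diagX (d : Fin r → ℝ) (k : T.TriIdx) :
    T.xmul e (T.triVec e k) (T.diagX e d) = d k.1.1.2 • T.triVec e k := by
  apply T.tri_injective e
  rw [tri_xmul, tri_diagX, T.mul_diag_of_mem d (T.tri_triVec_mem e k), map_smul]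

theorem pi_diagX_triVec (d : Fin r → ℝ) (k : T.TriIdx) :
    T.pi e (T.diagX e d) (T.triVec e k) = (d k.1.1.1 * d k.1.1.2) • T.triVec e k := by
  have h1 := T.tri_triVec_mem e k
  set x := T.tri e (T.triVec e k) with hx
  have h2 := T.star_mem _ _ _ h1
  have h3 : T.tri e (T.diagX e d) * T.tri e (T.diagX e d) = ∑ i, (d * d) i • T.c i := by
    rw [← tri_xmul, diagX_xmul_diagX, tri_diagX]
  have h4 : ∀ d : Fin r → ℝ, star (∑ i, d i • T.c i) = ∑ i, d i • T.c i := by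
    intro d; simp [star_sum, star_smul, T.star_c]
  apply pointLin_injective e
  rw [pointLin_pi, ← pointLin_apply, map_smul, ← T.tri_add_star e (T.triVec e k), ← hx]
  rw [act, h3, T.tri_diagX, h4, h4]
  simp only [mul_add, add_mul, mul_smul_comm, smul_mul_assoc, T.diag_mul_of_mem _ h1,
    T.diag_mul_of_mem _ h2, T.mul_diag_of_mem _ h1, T.mul_diag_of_mem _ h2, smul_smul,
    Pi.mul_apply, smul_add, smul_sub]
  module

/-- Left multiplication, as a linear map. -/
abbrev xleft (a : Fin n → ℝ) : (Fin n → ℝ) →ₗ[ℝ] (Fin n → ℝ) := T.xmul e a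

/-- Right multiplication, as a linear map. -/
abbrev xright (a : Fin n → ℝ) : (Fin n → ℝ) →ₗ[ℝ] (Fin n → ℝ) := (T.xmul e).flip a

theorem continuous_det_of {f : (Fin n → ℝ) → (Fin n → ℝ) →ₗ[ℝ] (Fin n → ℝ)}
    (hf : ∀ y, Continuous fun a => f a y) : Continuous fun a => LinearMap.det (f a) := by
  simp_rw [← LinearMap.det_toMatrix']
  refine Continuous.matrix_det (continuous_matrix fun i j => ?_)
  simp only [LinearMap.toMatrix'_apply]
  exact (continuous_apply i).comp (hf _)

theorem continuous_det_xleft : Continuous fun a => LinearMap.det (T.xleft e a) :=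
  continuous_det_of (f := T.xleft e) fun _ => (T.continuous_xmul e).comp (continuous_id.prodMk continuous_const)

theorem continuous_det_xright : Continuous fun a => LinearMap.det (T.xright e a) :=
  continuous_det_of (f := T.xright e) fun _ => (T.continuous_xmul e).comp (continuous_const.prodMk continuous_id)

theorem continuous_det_pi : Continuous fun a => LinearMap.det (T.pi e a) :=
  continuous_det_of (f := T.pi e) fun _ => (T.continuous_pi e).comp (continuous_id.prodMk continuous_const)

theorem det_xleft {a : Fin n → ℝ} (ha : a ∈ T.HX e) :
    LinearMap.det (T.xleft e a) = ∏ j, T.dg e j a ^ (1 + T.mDim j) := by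
  rw [T.char_eq_diagX e (T.continuous_det_xleft e) (fun a _ b _ => ?_) ha]
  · rw [T.det_eq_prod_of_triBasis e _ _ (T.diagX_xmul_triVec e _)]
    exact T.prod_triIdx_fst fun j => T.dg e j a
  · rw [← LinearMap.det_comp]; congr 1
    exact LinearMap.ext fun c => T.xmul_assoc e a b c

theorem det_xright {a : Fin n → ℝ} (ha : a ∈ T.HX e) :
    LinearMap.det (T.xright e a) = ∏ j, T.dg e j a ^ (1 + T.nDim j) := by
  rw [T.char_eq_diagX e (T.continuous_det_xright e) (fun a _ b _ => ?_) ha]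
  · rw [T.det_eq_prod_of_triBasis e _ _ (T.triVec_xmul_diagX e _)]
    exact T.prod_triIdx_snd fun j => T.dg e j a
  · rw [mul_comm, ← LinearMap.det_comp]; congr 1
    exact LinearMap.ext fun c => (T.xmul_assoc e c a b).symm

theorem det_pi {a : Fin n → ℝ} (ha : a ∈ T.HX e) :
    LinearMap.det (T.pi e a) = ∏ j, T.dg e j a ^ (2 + T.mDim j + T.nDim j) := by
  rw [T.char_eq_diagX e (T.continuous_det_pi e) (fun a _ b _ => ?_) ha]
  · rw [T.det_eq_prod_of_triBasis e _ _ (T.pi_diagX_triVec e _), Finset.prod_mul_distrib]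
    rw [T.prod_triIdx_fst fun j => T.dg e j a, T.prod_triIdx_snd fun j => T.dg e j a,
      ← Finset.prod_mul_distrib]
    refine Finset.prod_congr rfl fun j _ => ?_
    rw [← pow_add]; congr 1; ring
  · rw [pi_xmul, LinearMap.det_comp]

theorem exists_inv {a : Fin n → ℝ} (ha : a ∈ T.HX e) :
    ∃ b ∈ T.HX e, T.xmul e a b = T.xone e ∧ T.xmul e b a = T.xone e := by
  have key : ∀ a ∈ T.HX e, ∃ b ∈ T.HX e, T.xmul e a b = T.xone e := by
    intro a ha
    have hd : IsUnit (LinearMap.det (T.xleft e a)) := by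
      rw [T.det_xleft e ha]
      exact (Finset.prod_pos fun j _ => pow_pos (ha j) _).ne'.isUnit
    obtain ⟨b, hb'⟩ := ((Module.End.isUnit_iff _).1
      ((LinearMap.isUnit_iff_isUnit_det _).2 hd)).2 (T.xone e)
    refine ⟨b, fun j => ?_, hb'⟩
    have := congrArg (T.dg e j) hb'
    rw [dg_xmul, dg_xone] at this
    exact pos_of_mul_pos_right (by rw [this]; exact one_pos) (ha j).le
  obtain ⟨b, hb, hab⟩ := key a ha
  obtain ⟨c, _, hbc⟩ := key b hb
  have : a = c := by
    rw [← T.xmul_xone e a, ← hbc, ← xmul_assoc, hab, xone_xmul]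
  exact ⟨b, hb, hab, by rw [this]; exact hbc⟩

end Basis

end TAlgebra

end

noncomputable section

/-- A positive, continuous, `2`-homogeneous function dominates a multiple of the squared norm. -/
theorem exists_pos_mul_norm_sq_le {E : Type*} [NormedAddCommGroup E] [NormedSpace ℝ E]
    [FiniteDimensional ℝ E] {q : E → ℝ} (hc : Continuous q)
    (hq : ∀ (t : ℝ) (x : E), q (t • x) = t ^ 2 * q x) (hpos : ∀ x, x ≠ 0 → 0 < q x) :
    ∃ c : ℝ, 0 < c ∧ ∀ x, c * ‖x‖ ^ 2 ≤ q x := by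
  have : ProperSpace E := FiniteDimensional.proper ℝ E
  have hq0 : q 0 = 0 := by simpa using hq 0 0
  by_cases hne : (Metric.sphere (0 : E) 1).Nonempty
  · obtain ⟨x₀, hx₀, hmin⟩ := (isCompact_sphere (0 : E) 1).exists_isMinOn hne hc.continuousOn
    refine ⟨q x₀, hpos x₀ (by rintro rfl; simp at hx₀), fun x => ?_⟩
    by_cases hx : x = 0
    · simp [hx, hq0]
    · have hx' : 0 < ‖x‖ := norm_pos_iff.2 hx
      have h1 : ‖x‖⁻¹ • x ∈ Metric.sphere (0 : E) 1 := by
        simp [norm_smul, hx'.ne']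
      have h2 : q x₀ ≤ q (‖x‖⁻¹ • x) := hmin h1
      rw [hq, inv_pow, inv_mul_eq_div, le_div_iff₀ (by positivity)] at h2
      exact h2
  · refine ⟨1, one_pos, fun x => ?_⟩
    have : x = 0 := by
      by_contra hx
      exact hne ⟨‖x‖⁻¹ • x, by simp [norm_smul, (norm_pos_iff.2 hx).ne']⟩
    simp [this, hq0]

/-- The quadratic map of a symmetric bilinear map `B` has derivative `2 B(a, ·)` at `a`. -/
theorem hasStrictFDerivAt_quadratic {E F : Type*} [NormedAddCommGroup E] [NormedSpace ℝ E]
    [FiniteDimensional ℝ E] [NormedAddCommGroup F] [NormedSpace ℝ F]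
    (B : E →ₗ[ℝ] E →ₗ[ℝ] F) (hB : ∀ a b, B a b = B b a) (a : E) :
    HasStrictFDerivAt (fun x => B x x) (LinearMap.toContinuousLinearMap ((2 : ℝ) • B a)) a := by
  let g : E →L[ℝ] E →L[ℝ] F :=
    LinearMap.toContinuousLinearMap (LinearMap.toContinuousLinearMap.toLinearMap ∘ₗ B)
  have h := g.hasStrictFDerivAt_of_bilinear (hasStrictFDerivAt_id a) (hasStrictFDerivAt_id a)
  refine h.congr_fderiv (ContinuousLinearMap.ext fun b => ?_)
  change B a b + B b a = (2 : ℝ) • B a b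
  rw [hB b a, two_smul]

namespace TAlgebra

variable {r : ℕ} {U : Type*} [NonUnitalNonAssocRing U] [Module ℝ U]
  [IsScalarTower ℝ U U] [SMulCommClass ℝ U U] [StarRing U] [StarModule ℝ U]
  {n : ℕ}
variable (T : TAlgebra r U) (e : Module.Basis (Fin n) ℝ (selfAdjoint.submodule ℝ U))

/-! ### Injectivity of the parametrizations of the cone and of its dual -/

theorem tr_of_mem_ne {i j : Fin r} (h : i ≠ j) {x : U} (hx : x ∈ T.comp i j) : T.tr x = 0 := by
  rw [tr_apply]
  refine Finset.sum_eq_zero fun k _ => T.rho_comp k i j x ?_ hx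
  intro h'
  obtain ⟨rfl, h2⟩ := Prod.mk.inj h'
  exact h h2.symm

theorem tr_mul_star_of_mem {i j : Fin r} {x : U} (hx : x ∈ T.comp i j) (y : U) :
    T.tr (x * star y) = T.tr (x * star (T.proj i j y)) := by
  conv_lhs => rw [← T.sum_proj y]
  simp only [star_sum, Finset.mul_sum, map_sum]
  rw [Finset.sum_eq_single i, Finset.sum_eq_single j]
  · intro l _ hl
    rw [T.mul_eq_zero i j l i x _ (Ne.symm hl) hx (T.star_mem _ _ _ (T.proj_mem i l y)), map_zero]
  · simp
  · intro k _ hk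
    refine Finset.sum_eq_zero fun l _ => ?_
    by_cases hl : j = l
    · subst hl
      exact T.tr_of_mem_ne (Ne.symm hk)
        (T.mul_mem i j k x _ hx (T.star_mem _ _ _ (T.proj_mem k j y)))
    · rw [T.mul_eq_zero i j l k x _ hl hx (T.star_mem _ _ _ (T.proj_mem k l y)), map_zero]
  · simp

theorem tr_mul_of_mem_of_upper {i j : Fin r} (h : i < j) {x y : U} (hx : x ∈ T.comp i j)
    (hy : y ∈ T.upper) : T.tr (x * y) = 0 := by
  rw [tr_apply]
  refine Finset.sum_eq_zero fun k _ => ?_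
  rw [T.rho_mul_of_mem_upper (T.comp_le_upper h.le hx) hy, T.rho_comp k i j x _ hx, zero_mul]
  intro h'
  obtain ⟨rfl, h2⟩ := Prod.mk.inj h'
  exact h.ne h2.symm

theorem trX_coord (x : U) : T.trX e (coord e x) = T.tr x := by
  rw [trX, LinearMap.comp_apply, pointLin_coord, map_smul, map_add, tr_star, smul_eq_mul]; ring

theorem pi_psi₂ (h a b : Fin n → ℝ) :
    T.pi e h (T.psi₂ e a b) = T.psi₂ e (T.xmul e h a) (T.xmul e h b) := by
  have h1 := T.pi_psi e h (a + b)
  rw [map_add (T.xmul e h), psi_add, psi_add, map_add, map_add, pi_psi, pi_psi, map_smul] at h1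
  have h2 := add_left_cancel (add_right_cancel h1)
  exact smul_right_injective _ (two_ne_zero' ℝ) h2

variable [FiniteDimensional ℝ U]

/-- The stabilizer of the trace in the triangular group is trivial: if `sig h` is the trace, then
`h` and `g = h⁻¹` satisfy `tr (c h⋆) = tr (c g)` for all upper triangular `c`; testing with the
off-diagonal components of `h` shows that `h` is diagonal, and then `h_jj = 1 / h_jj`. -/
theorem eq_xone_of_sig_eq {h : Fin n → ℝ} (hh : h ∈ T.HX e) (hs : T.sig e h = T.trX e) :
    h = T.xone e := by
  obtain ⟨g, hg, h1, -⟩ := T.exists_inv e hh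
  have key : ∀ c : U, c ∈ T.upper → T.tr (c * star (T.tri e h)) = T.tr (c * T.tri e g) := by
    intro c hc
    have h2 : T.sig e h (T.psi₂ e (T.xmul e g (untri e c)) (T.xone e)) =
        T.trX e (T.psi₂ e (T.xmul e g (untri e c)) (T.xone e)) := by rw [hs]
    rw [sig_apply, pi_psi₂, ← xmul_assoc, h1, xone_xmul, xmul_xone, psi₂_apply, psi₂_apply,
      trX_coord, trX_coord, tri_xone, star_unit, mul_unit, tri_xmul, T.tri_untri e hc] at h2
    rw [h2, T.tr_mul_comm]
  have hoff : ∀ i j, i < j → T.proj i j (T.tri e h) = 0 := by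
    intro i j hij
    have hm := T.proj_mem i j (T.tri e h)
    have h2 := key _ (T.comp_le_upper hij.le hm)
    rw [T.tr_mul_of_mem_of_upper hij hm (T.tri_mem_upper e g), T.tr_mul_star_of_mem hm] at h2
    by_contra hne
    exact (T.tr_mul_star_pos hne).ne' h2
  rw [T.eq_diagX e hoff, ← diagX_one]
  congr 1
  funext j
  have h2 := key _ (T.comp_le_upper le_rfl (T.c_mem j))
  rw [T.tr_mul_star_of_mem (T.c_mem j), T.proj_diag, star_smul, T.star_c, mul_smul_comm,
    T.c_mul j j _ (T.c_mem j)] at h2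
  have h3 : ∀ x ∈ T.upper, T.tr (T.c j * x) = T.rho j x := by
    intro x hx
    rw [tr_apply, Finset.sum_eq_single j]
    · rw [T.rho_mul_of_mem_upper (T.comp_le_upper le_rfl (T.c_mem j)) hx, T.rho_c, one_mul]
    · intro i _ hi
      rw [T.rho_mul_of_mem_upper (T.comp_le_upper le_rfl (T.c_mem j)) hx, T.rho_c_ne hi, zero_mul]
    · simp
  have h4 : T.tr (T.c j) = 1 := by
    rw [tr_apply, Finset.sum_eq_single j (fun i _ hi => T.rho_c_ne hi) (by simp), T.rho_c]
  rw [h3 _ (T.tri_mem_upper e g), map_smul, h4, star_trivial, smul_eq_mul, mul_one,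
    ← dg_apply, ← dg_apply] at h2
  have h5 := congrArg (T.dg e j) h1
  rw [dg_xmul, dg_xone, ← h2] at h5
  have := hh j
  rw [Pi.one_apply]
  nlinarith

theorem eq_xone_of_psi_eq {h : Fin n → ℝ} (hh : h ∈ T.HX e)
    (hs : T.psi e h = T.psi e (T.xone e)) : h = T.xone e := by
  obtain ⟨g, hg, h1, h2⟩ := T.exists_inv e hh
  have hu : T.tri e h * star (T.tri e h) = T.unit := by
    rw [← pointLin_psi, hs, pointLin_psi, tri_xone, star_unit, unit_mul]
  have h3 := T.upper_mul_star _ _ (T.tri_mem_upper e g) (T.tri_mem_upper e h)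
  rw [hu, mul_unit, ← tri_xmul, h2, tri_xone, unit_mul] at h3
  have hoff : ∀ i j, i < j → T.proj i j (T.tri e h) = 0 := by
    intro i j hij
    have := T.mem_upper_iff.1 (T.tri_mem_upper e g) j i hij
    rw [h3, ← star_proj] at this
    exact star_eq_zero.1 this
  rw [T.eq_diagX e hoff, ← diagX_one]
  congr 1
  funext j
  have h4 : T.dg e j g = T.dg e j h := by rw [dg_apply, dg_apply, h3, rho_star]
  have h5 := congrArg (T.dg e j) h1
  rw [dg_xmul, dg_xone, h4] at h5
  have := hh j
  rw [Pi.one_apply]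
  nlinarith

theorem psi_injOn : Set.InjOn (T.psi e) (T.HX e) := by
  intro a ha b hb hab
  obtain ⟨c, hc, h1, h2⟩ := T.exists_inv e hb
  have h3 : T.xmul e c a = T.xone e := by
    refine T.eq_xone_of_psi_eq e (T.xmul_mem_HX e hc ha) ?_
    rw [← pi_psi, hab, pi_psi, h2]
  rw [← T.xone_xmul e a, ← h1, xmul_assoc, h3, xmul_xone]

theorem sig_injOn : Set.InjOn (T.sig e) (T.HX e) := by
  intro a ha b hb hab
  obtain ⟨c, hc, h1, h2⟩ := T.exists_inv e hb
  have h3 : T.xmul e a c = T.xone e := by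
    refine T.eq_xone_of_sig_eq e (T.xmul_mem_HX e ha hc) ?_
    rw [sig_xmul, hab, ← sig_xmul, h1, sig_xone]
  rw [← T.xmul_xone e a, ← h2, ← xmul_assoc, h3, xone_xmul]

/-! ### Jacobians of the two parametrizations -/

theorem hasStrictFDerivAt_psi (a : Fin n → ℝ) :
    HasStrictFDerivAt (T.psi e) (LinearMap.toContinuousLinearMap ((2 : ℝ) • T.psi₂ e a)) a := by
  have h : T.psi e = fun x => T.psi₂ e x x := funext (T.psi_eq e)
  rw [h]
  exact hasStrictFDerivAt_quadratic _ (T.psi₂_comm e) a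

theorem det_dpsi {a : Fin n → ℝ} (ha : a ∈ T.HX e) :
    LinearMap.det ((2 : ℝ) • T.psi₂ e a) = ∏ j, T.dg e j a ^ (1 + T.nDim j) := by
  have h : ((2 : ℝ) • T.psi₂ e a) ∘ₗ T.xleft e a = T.pi e a := by
    refine LinearMap.ext fun b => ?_
    have h1 := T.pi_psi₂ e a b (T.xone e)
    rw [psi₂_xone, xmul_xone, psi₂_comm, map_smul] at h1
    rw [LinearMap.comp_apply, LinearMap.smul_apply, ← h1, smul_smul]
    norm_num
  have h2 := congrArg LinearMap.det h
  rw [LinearMap.det_comp, T.det_xleft e ha, T.det_pi e ha] at h2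
  have h3 : (∏ j, T.dg e j a ^ (2 + T.mDim j + T.nDim j)) =
      (∏ j, T.dg e j a ^ (1 + T.nDim j)) * ∏ j, T.dg e j a ^ (1 + T.mDim j) := by
    rw [← Finset.prod_mul_distrib]
    refine Finset.prod_congr rfl fun j _ => ?_
    rw [← pow_add]; congr 1; ring
  rw [h3] at h2
  exact mul_right_cancel₀ (Finset.prod_pos fun j _ => pow_pos (ha j) _).ne' h2

/-- The vector that represents the functional `sig a`. -/
def sigv (a : Fin n → ℝ) : Fin n → ℝ := fun k => T.sig e a (Pi.single k 1)

theorem sig_eq_sum (a y : Fin n → ℝ) : T.sig e a y = ∑ k, T.sigv e a k * y k := by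
  conv_lhs => rw [LinearMap.pi_apply_eq_sum_univ (T.sig e a) y]
  refine Finset.sum_congr rfl fun k _ => ?_
  rw [smul_eq_mul, mul_comm, sigv]
  congr 2
  funext j; simp [Pi.single_apply, eq_comm]

theorem sigv_injOn : Set.InjOn (T.sigv e) (T.HX e) := by
  intro a ha b hb hab
  refine T.sig_injOn e ha hb (LinearMap.ext fun y => ?_)
  rw [sig_eq_sum, sig_eq_sum, hab]

/-- The bilinear map `(a, b) ↦ sig₂ a b` with values in coordinate vectors. -/
def sigv₂ : (Fin n → ℝ) →ₗ[ℝ] (Fin n → ℝ) →ₗ[ℝ] (Fin n → ℝ) :=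
  LinearMap.mk₂ ℝ (fun a b k => T.sig₂ e a b (Pi.single k 1))
    (by intro a a' b; ext; simp) (by intro c a b; ext; simp)
    (by intro a b b'; ext; simp) (by intro c a b; ext; simp)

theorem sigv₂_apply (a b : Fin n → ℝ) (k : Fin n) :
    T.sigv₂ e a b k = T.sig₂ e a b (Pi.single k 1) := rfl

theorem hasStrictFDerivAt_sigv (a : Fin n → ℝ) :
    HasStrictFDerivAt (T.sigv e) (LinearMap.toContinuousLinearMap ((2 : ℝ) • T.sigv₂ e a)) a := by
  have h : T.sigv e = fun x => T.sigv₂ e x x := by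
    funext x k; rw [sigv₂_apply, sigv, sig_eq_sig₂]
  rw [h]
  exact hasStrictFDerivAt_quadratic _ (fun a b => by
    funext k; rw [sigv₂_apply, sigv₂_apply, sig₂_comm]) a

theorem sig₂_xmul (a b h y : Fin n → ℝ) :
    T.sig₂ e (T.xmul e a h) (T.xmul e b h) y = T.sig₂ e a b (T.pi e h y) := by
  have key : ∀ a, T.sig₂ e (T.xmul e a h) (T.xmul e a h) y = T.sig₂ e a a (T.pi e h y) := by
    intro a
    rw [← sig_eq_sig₂, ← sig_eq_sig₂, sig_xmul]; rfl
  have h1 := key (a + b)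
  simp only [map_add, LinearMap.add_apply] at h1
  rw [key a, key b, T.sig₂_comm e (T.xmul e b h), T.sig₂_comm e b a] at h1
  linarith

theorem det_dsigv_one_ne_zero : LinearMap.det ((2 : ℝ) • T.sigv₂ e (T.xone e)) ≠ 0 := by
  intro h0
  obtain ⟨b, hb, hb0⟩ := Submodule.exists_mem_ne_zero_of_ne_bot
    (LinearMap.bot_lt_ker_of_det_eq_zero h0).ne'
  have h1 : T.sig₂ e b (T.xone e) = 0 := by
    refine LinearMap.pi_ext' fun k => LinearMap.ext_ring ?_
    have := congrFun (LinearMap.mem_ker.1 hb) k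
    simp only [LinearMap.smul_apply, Pi.smul_apply, smul_eq_mul, Pi.zero_apply,
      sigv₂_apply] at this
    rw [sig₂_comm]
    simpa using this
  have h2 : T.tr (T.tri e b * pointLin e b) = 0 := by
    rw [← sig₂_xone, h1, LinearMap.zero_apply]
  rw [← T.tri_add_star e b, mul_add, map_add] at h2
  have h3 : 0 ≤ T.tr (T.tri e b * T.tri e b) := by
    rw [tr_apply]
    refine Finset.sum_nonneg fun i _ => ?_
    rw [T.rho_mul_of_mem_upper (T.tri_mem_upper e b) (T.tri_mem_upper e b)]
    exact mul_self_nonneg _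
  have h4 := T.trX_psi_pos e hb0
  rw [trX_psi] at h4
  linarith

theorem det_dsigv {a : Fin n → ℝ} (ha : a ∈ T.HX e) :
    LinearMap.det ((2 : ℝ) • T.sigv₂ e a) =
      LinearMap.det ((2 : ℝ) • T.sigv₂ e (T.xone e)) * ∏ j, T.dg e j a ^ (1 + T.mDim j) := by
  set P : (Fin n → ℝ) →ₗ[ℝ] (Fin n → ℝ) :=
    Matrix.toLin' (LinearMap.toMatrix' (T.pi e a)).transpose with hP
  have hdP : LinearMap.det P = LinearMap.det (T.pi e a) := by
    rw [hP, LinearMap.det_toLin', Matrix.det_transpose, LinearMap.det_toMatrix']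
  have h : ((2 : ℝ) • T.sigv₂ e a) ∘ₗ T.xright e a = P ∘ₗ ((2 : ℝ) • T.sigv₂ e (T.xone e)) := by
    refine LinearMap.ext fun b => ?_
    funext k
    simp only [LinearMap.comp_apply, LinearMap.smul_apply, map_smul, Pi.smul_apply]
    congr 1
    have h1 := T.sig₂_xmul e (T.xone e) b a (Pi.single k 1)
    rw [xone_xmul] at h1
    rw [sigv₂_apply, LinearMap.flip_apply, h1, hP, Matrix.toLin'_apply, Matrix.mulVec,
      dotProduct]
    conv_lhs => rw [LinearMap.pi_apply_eq_sum_univ (T.sig₂ e (T.xone e) b)]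
    refine Finset.sum_congr rfl fun i _ => ?_
    rw [Matrix.transpose_apply, LinearMap.toMatrix'_apply, sigv₂_apply, smul_eq_mul]
    congr 2
    funext j; simp [Pi.single_apply, eq_comm]
  have h2 := congrArg LinearMap.det h
  rw [LinearMap.det_comp, LinearMap.det_comp, hdP, T.det_xright e ha, T.det_pi e ha] at h2
  have h3 : (∏ j, T.dg e j a ^ (2 + T.mDim j + T.nDim j)) =
      (∏ j, T.dg e j a ^ (1 + T.mDim j)) * ∏ j, T.dg e j a ^ (1 + T.nDim j) := by
    rw [← Finset.prod_mul_distrib]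
    refine Finset.prod_congr rfl fun j _ => ?_
    rw [← pow_add]; congr 1; ring
  rw [h3] at h2
  have h4 : (∏ j, T.dg e j a ^ (1 + T.nDim j)) ≠ 0 :=
    (Finset.prod_pos fun j _ => pow_pos (ha j) _).ne'
  refine mul_right_cancel₀ h4 ?_
  rw [h2]; ring

/-! ### The cone is open and convex -/

theorem Omega_eq_image : T.Omega e = T.psi e '' T.HX e := by
  ext y; rw [mem_Omega_iff]; rfl

theorem isOpen_psi_image {S : Set (Fin n → ℝ)} (hS : IsOpen S) (hSH : S ⊆ T.HX e) :
    IsOpen (T.psi e '' S) := by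
  rw [isOpen_iff_mem_nhds]
  rintro _ ⟨a, ha, rfl⟩
  have hsurj : LinearMap.range
      (LinearMap.toContinuousLinearMap ((2 : ℝ) • T.psi₂ e a)).toLinearMap = ⊤ := by
    have hu : IsUnit (LinearMap.det ((2 : ℝ) • T.psi₂ e a)) := by
      rw [T.det_dpsi e (hSH ha)]
      exact (Finset.prod_pos fun j _ => pow_pos (hSH ha j) _).ne'.isUnit
    exact LinearMap.range_eq_top.2
      ((Module.End.isUnit_iff _).1 ((LinearMap.isUnit_iff_isUnit_det _).2 hu)).2
  have hmap := (T.hasStrictFDerivAt_psi e a).map_nhds_eq_of_surj hsurj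
  rw [← hmap]
  exact Filter.image_mem_map (hS.mem_nhds ha)

theorem isOpen_Omega : IsOpen (T.Omega e) := by
  rw [Omega_eq_image]; exact T.isOpen_psi_image e (T.isOpen_HX e) subset_rfl

theorem psi_bound : ∃ C : ℝ, 0 ≤ C ∧ ∀ a, ‖T.psi e a‖ ≤ C * ‖a‖ ^ 2 := by
  let g : (Fin n → ℝ) →L[ℝ] (Fin n → ℝ) →L[ℝ] (Fin n → ℝ) :=
    LinearMap.toContinuousLinearMap (LinearMap.toContinuousLinearMap.toLinearMap ∘ₗ T.psi₂ e)
  refine ⟨‖g‖, norm_nonneg g, fun a => ?_⟩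
  have := g.le_opNorm₂ a a
  rw [psi_eq, sq, ← mul_assoc]
  exact this

theorem continuous_trX : Continuous (T.trX e) := LinearMap.continuous_of_finiteDimensional _

theorem trX_psi_ge : ∃ c : ℝ, 0 < c ∧ ∀ a, c * ‖a‖ ^ 2 ≤ T.trX e (T.psi e a) :=
  exists_pos_mul_norm_sq_le ((T.continuous_trX e).comp (T.continuous_psi e))
    (fun t a => by
      change T.trX e (T.psi e (t • a)) = t ^ 2 * T.trX e (T.psi e a)
      rw [psi_smul, map_smul, smul_eq_mul])
    (fun _ ha => T.trX_psi_pos e ha)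

theorem sig_nonneg_of_mem_closure {y : Fin n → ℝ} (hy : y ∈ closure (T.Omega e))
    (a : Fin n → ℝ) : 0 ≤ T.sig e a y := by
  have hc : IsClosed {y | 0 ≤ T.sig e a y} :=
    isClosed_Ici.preimage (LinearMap.continuous_of_finiteDimensional (T.sig e a))
  refine closure_minimal ?_ hc hy
  intro y hy
  obtain ⟨b, hb, rfl⟩ := (T.mem_Omega_iff e).1 hy
  rw [Set.mem_ofPred_eq, sig_psi]
  exact T.trX_psi_nonneg e _

theorem trX_nonneg_of_mem_closure {y : Fin n → ℝ} (hy : y ∈ closure (T.Omega e)) :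
    0 ≤ T.trX e y := by
  rw [← sig_xone]; exact T.sig_nonneg_of_mem_closure e hy _

theorem eq_zero_of_mem_closure {y : Fin n → ℝ} (hy : y ∈ closure (T.Omega e))
    (h : T.trX e y = 0) : y = 0 := by
  obtain ⟨C, hC, h1⟩ := T.psi_bound e
  obtain ⟨c, hc, h2⟩ := T.trX_psi_ge e
  have hcl : IsClosed {y | c * ‖y‖ ≤ C * T.trX e y} :=
    isClosed_le (by fun_prop) ((T.continuous_trX e).const_smul C)
  have h3 : c * ‖y‖ ≤ C * T.trX e y := by
    refine closure_minimal ?_ hcl hy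
    intro y hy
    obtain ⟨b, hb, rfl⟩ := (T.mem_Omega_iff e).1 hy
    change c * ‖T.psi e b‖ ≤ C * T.trX e (T.psi e b)
    calc c * ‖T.psi e b‖ ≤ c * (C * ‖b‖ ^ 2) := by gcongr; exact h1 b
      _ = C * (c * ‖b‖ ^ 2) := by ring
      _ ≤ _ := by gcongr; exact h2 b
  rw [h, mul_zero] at h3
  have h4 : ‖y‖ ≤ 0 := nonpos_of_mul_nonpos_right h3 hc
  exact norm_le_zero_iff.1 h4

theorem det_xright_of_closure {a : Fin n → ℝ} (ha : a ∈ closure (T.HX e)) :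
    LinearMap.det (T.xright e a) = ∏ j, T.dg e j a ^ (1 + T.nDim j) := by
  have hc : IsClosed {a | LinearMap.det (T.xright e a) = ∏ j, T.dg e j a ^ (1 + T.nDim j)} :=
    isClosed_eq (T.continuous_det_xright e)
      (continuous_finsetProd _ fun j _ => (T.continuous_dg e j).pow _)
  exact closure_minimal (fun a ha => T.det_xright e ha) hc ha

/-- The points of the cone are those at which all the functionals `sig a`, `a ≠ 0`, are positive:
in the convex set of all such points, the cone is open and closed. -/
theorem Omega_eq : T.Omega e = {y | ∀ a, a ≠ 0 → 0 < T.sig e a y} := by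
  set P : Set (Fin n → ℝ) := {y | ∀ a, a ≠ 0 → 0 < T.sig e a y} with hP
  have hPconv : Convex ℝ P := by
    intro x hx y hy s t hs ht hst a ha
    rw [map_add, map_smul, map_smul, smul_eq_mul, smul_eq_mul]
    have h1 := hx a ha
    have h2 := hy a ha
    rcases hs.eq_or_lt with h | h
    · have : t = 1 := by linarith
      subst this; rw [← h]; linarith
    · have := mul_pos h h1
      have := mul_nonneg ht h2.le
      linarith
  apply subset_antisymm
  · intro y hy a ha
    obtain ⟨b, hb, rfl⟩ := (T.mem_Omega_iff e).1 hy
    rw [sig_psi]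
    apply T.trX_psi_pos e
    intro h0
    obtain ⟨c, hc, hbc, -⟩ := T.exists_inv e hb
    apply ha
    rw [← T.xmul_xone e a, ← hbc, ← xmul_assoc, h0, map_zero, LinearMap.zero_apply]
  · refine hPconv.isPreconnected.subset_of_closure_inter_subset (T.isOpen_Omega e)
      ⟨T.psi e (T.xone e), fun a ha => ?_, T.psi_mem_Omega e (T.xone_mem_HX e)⟩ ?_
    · rw [sig_psi, xmul_xone]; exact T.trX_psi_pos e ha
    · rintro y ⟨hy, hyP⟩
      -- the trace bounds `‖a‖`, so a limit of points `psi b` is `psi a` with `a` in the closure of `H`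
      obtain ⟨c, hc, h2⟩ := T.trX_psi_ge e
      set K : Set (Fin n → ℝ) := closure (T.HX e) ∩ {a | T.trX e (T.psi e a) ≤ T.trX e y + 1}
        with hK
      have hKcl : IsClosed K := isClosed_closure.inter
        (isClosed_Iic.preimage ((T.continuous_trX e).comp (T.continuous_psi e)))
      have hKb : Bornology.IsBounded K := by
        rw [isBounded_iff_forall_norm_le]
        refine ⟨(T.trX e y + 1) / c + 1, fun a ha => ?_⟩
        have h3 : c * ‖a‖ ^ 2 ≤ T.trX e y + 1 := (h2 a).trans ha.2
        have h4 : ‖a‖ ^ 2 ≤ (T.trX e y + 1) / c := by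
          rw [le_div_iff₀ hc]; linarith
        nlinarith [norm_nonneg a, sq_nonneg (‖a‖ - 1)]
      have hKc : IsCompact K := Metric.isCompact_of_isClosed_isBounded hKcl hKb
      have himg : IsClosed (T.psi e '' K) := (hKc.image (T.continuous_psi e)).isClosed
      have hopen : IsOpen {x | T.trX e x < T.trX e y + 1} :=
        isOpen_Iio.preimage (T.continuous_trX e)
      have hy' : y ∈ closure (T.Omega e ∩ {x | T.trX e x < T.trX e y + 1}) := by
        rw [Set.inter_comm]
        refine hopen.inter_closure ⟨?_, hy⟩
        simp
      have hyK : y ∈ T.psi e '' K := by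
        refine closure_minimal ?_ himg hy'
        rintro x ⟨hx, hx'⟩
        obtain ⟨b, hb, rfl⟩ := (T.mem_Omega_iff e).1 hx
        have hx'' : T.trX e (T.psi e b) < T.trX e y + 1 := hx'
        exact ⟨b, ⟨subset_closure hb, hx''.le⟩, rfl⟩
      obtain ⟨a, ⟨ha, -⟩, rfl⟩ := hyK
      refine T.psi_mem_Omega e ?_
      by_contra hna
      have hnn : ∀ j, 0 ≤ T.dg e j a := fun j =>
        closure_minimal (fun b hb => (hb j).le)
          (isClosed_Ici.preimage (T.continuous_dg e j)) ha
      -- if `a` is not in `H`, right multiplication by `a` has a kernel, so `sig b` vanishes at `psi a`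
      -- for some `b ≠ 0`
      obtain ⟨j, hj⟩ : ∃ j, T.dg e j a = 0 := by
        by_contra hcon
        push Not at hcon
        exact hna fun j => lt_of_le_of_ne (hnn j) (hcon j).symm
      have hdet : LinearMap.det (T.xright e a) = 0 := by
        rw [T.det_xright_of_closure e ha]
        exact Finset.prod_eq_zero (Finset.mem_univ j) (by rw [hj]; simp)
      obtain ⟨b, hb, hb0⟩ := Submodule.exists_mem_ne_zero_of_ne_bot
        (LinearMap.bot_lt_ker_of_det_eq_zero hdet).ne'
      have h5 := hyP b hb0
      rw [sig_psi] at h5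
      have h6 : T.xmul e b a = 0 := hb
      rw [h6, psi_eq, map_zero] at h5
      exact absurd h5 (by simp)

theorem sig_pos {y : Fin n → ℝ} (hy : y ∈ T.Omega e) {a : Fin n → ℝ} (ha : a ≠ 0) :
    0 < T.sig e a y := by
  rw [Omega_eq] at hy; exact hy a ha

theorem add_mem_Omega {x y : Fin n → ℝ} (hx : x ∈ T.Omega e) (hy : y ∈ closure (T.Omega e)) :
    x + y ∈ T.Omega e := by
  rw [Omega_eq]
  intro a ha
  rw [map_add]
  exact add_pos_of_pos_of_nonneg (T.sig_pos e hx ha) (T.sig_nonneg_of_mem_closure e hy a)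

theorem smul_mem_Omega {x : Fin n → ℝ} (hx : x ∈ T.Omega e) {t : ℝ} (ht : 0 < t) :
    t • x ∈ T.Omega e := by
  rw [Omega_eq]
  intro a ha
  rw [map_smul]
  exact mul_pos ht (T.sig_pos e hx ha)

theorem convex_Omega : Convex ℝ (T.Omega e) := by
  intro x hx y hy s t hs ht hst
  rcases hs.eq_or_lt with h | h
  · have : t = 1 := by linarith
    subst this; subst h; simpa using hy
  rcases ht.eq_or_lt with h' | h'
  · have : s = 1 := by linarith
    subst this; subst h'; simpa using hx
  exact T.add_mem_Omega e (T.smul_mem_Omega e hx h) (subset_closure (T.smul_mem_Omega e hy h'))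

theorem pi_mem_Omega {h y : Fin n → ℝ} (hh : h ∈ T.HX e) :
    T.pi e h y ∈ T.Omega e ↔ y ∈ T.Omega e := by
  have key : ∀ h ∈ T.HX e, ∀ y ∈ T.Omega e, T.pi e h y ∈ T.Omega e := by
    intro h hh y hy
    obtain ⟨b, hb, rfl⟩ := (T.mem_Omega_iff e).1 hy
    rw [pi_psi]; exact T.psi_mem_Omega e (T.xmul_mem_HX e hh hb)
  refine ⟨fun hy => ?_, key h hh y⟩
  obtain ⟨g, hg, -, h2⟩ := T.exists_inv e hh
  have := key g hg _ hy
  rwa [← LinearMap.comp_apply, ← pi_xmul, h2, pi_xone] at this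

end TAlgebra

end

noncomputable section

/-! ### Generalities on integrals -/

theorem integrable_sq_rpow_mul_exp {c : ℝ} (hc : 0 < c) {p : ℝ} (hp : -1 < 2 * p) :
    Integrable fun x : ℝ => (x ^ 2) ^ p * Real.exp (-c * x ^ 2) := by
  have h1 : IntegrableOn (fun x : ℝ => (x ^ 2) ^ p * Real.exp (-c * x ^ 2)) (Set.Ioi 0) := by
    refine (integrableOn_rpow_mul_exp_neg_mul_sq hc hp).congr_fun (fun x hx => ?_)
      measurableSet_Ioi
    have hx' : (0 : ℝ) ≤ x := le_of_lt hx
    simp only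
    rw [Real.rpow_mul hx', Real.rpow_two]
  rw [← integrableOn_univ, ← @Set.Iio_union_Ici _ _ (0 : ℝ), integrableOn_union,
    integrableOn_Ici_iff_integrableOn_Ioi]
  refine ⟨?_, h1⟩
  rw [← (Measure.measurePreserving_neg (volume : Measure ℝ)).integrableOn_comp_preimage
      (Homeomorph.neg ℝ).measurableEmbedding]
  simpa [Function.comp_def] using h1

/-- Linear change of variables. -/
theorem lintegral_comp_linearMap {E : Type*} [NormedAddCommGroup E] [NormedSpace ℝ E]
    [FiniteDimensional ℝ E] [MeasurableSpace E] [BorelSpace E] (μ : Measure E)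
    [μ.IsAddHaarMeasure] (f : E →ₗ[ℝ] E) (hf : LinearMap.det f ≠ 0) (g : E → ℝ≥0∞) :
    ∫⁻ x, g (f x) ∂μ = ENNReal.ofReal |(LinearMap.det f)⁻¹| * ∫⁻ x, g x ∂μ := by
  have hemb : MeasurableEmbedding f :=
    (LinearMap.equivOfDetNeZero f hf).toContinuousLinearEquiv.toHomeomorph.measurableEmbedding
  have h := hemb.lintegral_map (μ := μ) g
  rw [← h, Measure.map_linearMap_addHaar_eq_smul_addHaar μ hf, lintegral_smul_measure,
    smul_eq_mul]

/-- A nonnegative function on a finite dimensional space has finite integral if it has in the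
coordinates of a basis. -/
theorem lintegral_lt_top_of_basis {E ι : Type*} [NormedAddCommGroup E] [NormedSpace ℝ E]
    [FiniteDimensional ℝ E] [MeasurableSpace E] [BorelSpace E] (μ : Measure E)
    [μ.IsAddHaarMeasure] [Fintype ι] (b : Module.Basis ι ℝ E) (g : E → ℝ≥0∞)
    (hg : ∫⁻ x : ι → ℝ, g (b.equivFun.symm x) < ∞) : ∫⁻ x, g x ∂μ < ∞ := by
  set L := b.equivFun.symm.toContinuousLinearEquiv with hL
  have h1 := L.toHomeomorph.measurableEmbedding.lintegral_map (μ := (volume : Measure (ι → ℝ))) g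
  have h2 : (Measure.map L (volume : Measure (ι → ℝ))).IsAddHaarMeasure :=
    L.isAddHaarMeasure_map _
  have h3 := Measure.isAddLeftInvariant_eq_smul μ (Measure.map L (volume : Measure (ι → ℝ)))
  rw [h3, lintegral_smul_measure]
  refine ENNReal.mul_lt_top (by simp) ?_
  have h4 : ∫⁻ x, g x ∂(Measure.map L (volume : Measure (ι → ℝ))) =
    ∫⁻ x : ι → ℝ, g (b.equivFun.symm x) := h1
  rw [h4]; exact hg

namespace TAlgebra

variable {r : ℕ} {U : Type*} [NonUnitalNonAssocRing U] [Module ℝ U]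
  [IsScalarTower ℝ U U] [SMulCommClass ℝ U U] [StarRing U] [StarModule ℝ U]
  {n : ℕ}
variable (T : TAlgebra r U) (e : Module.Basis (Fin n) ℝ (selfAdjoint.submodule ℝ U))

/-! ### Generalized powers -/

/-- The character `t ↦ ∏ ρ(t_jj)^{2 a_j}` of the triangular group. -/
def chi (a : Fin r → ℝ) (h : Fin n → ℝ) : ℝ := ∏ j, (T.dg e j h ^ 2) ^ a j

theorem chi_nonneg (a : Fin r → ℝ) (h : Fin n → ℝ) : 0 ≤ T.chi e a h :=
  Finset.prod_nonneg fun _ _ => Real.rpow_nonneg (sq_nonneg _) _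

theorem chi_pos (a : Fin r → ℝ) {h : Fin n → ℝ} (hh : h ∈ T.HX e) : 0 < T.chi e a h :=
  Finset.prod_pos fun j _ => Real.rpow_pos_of_pos (pow_pos (hh j) 2) _

theorem chi_xmul (a : Fin r → ℝ) (g h : Fin n → ℝ) :
    T.chi e a (T.xmul e g h) = T.chi e a g * T.chi e a h := by
  simp only [chi, dg_xmul, mul_pow, ← Finset.prod_mul_distrib]
  exact Finset.prod_congr rfl fun j _ => Real.mul_rpow (sq_nonneg _) (sq_nonneg _)

theorem chi_add (a b : Fin r → ℝ) {h : Fin n → ℝ} (hh : h ∈ T.HX e) :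
    T.chi e (a + b) h = T.chi e a h * T.chi e b h := by
  simp only [chi, Pi.add_apply, ← Finset.prod_mul_distrib]
  exact Finset.prod_congr rfl fun j _ => Real.rpow_add (pow_pos (hh j) 2) _ _

theorem chi_zero (h : Fin n → ℝ) : T.chi e 0 h = 1 := by simp [chi]

theorem chi_neg (a : Fin r → ℝ) {h : Fin n → ℝ} (hh : h ∈ T.HX e) :
    T.chi e (-a) h = (T.chi e a h)⁻¹ := by
  refine eq_inv_of_mul_eq_one_left ?_
  rw [← T.chi_add e _ _ hh, neg_add_cancel, chi_zero]

theorem prod_dg_pow (k : Fin r → ℕ) {h : Fin n → ℝ} (hh : h ∈ T.HX e) :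
    ∏ j, T.dg e j h ^ k j = T.chi e (fun j => (k j : ℝ) / 2) h := by
  refine Finset.prod_congr rfl fun j _ => ?_
  rw [← Real.rpow_natCast, ← Real.rpow_natCast, ← Real.rpow_mul (hh j).le]
  congr 1; push_cast; ring

theorem measurable_chi (a : Fin r → ℝ) : Measurable (T.chi e a) := by
  unfold chi
  exact Finset.measurable_prod _ fun j _ =>
    (((T.continuous_dg e j).measurable.pow_const 2).pow_const _)

theorem continuousOn_chi (a : Fin r → ℝ) : ContinuousOn (T.chi e a) (T.HX e) := by
  unfold chi
  refine continuousOn_finsetProd _ fun j _ => ContinuousOn.rpow_const ?_ ?_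
  · exact ((T.continuous_dg e j).pow 2).continuousOn
  · intro h hh; exact Or.inl (pow_pos (hh j) 2).ne'

variable [FiniteDimensional ℝ U]

theorem Q_psi (j : Fin r) {h : Fin n → ℝ} (hh : h ∈ T.HX e) :
    T.Q j (point e (T.psi e h)) = T.dg e j h ^ 2 := by
  have hex : ∃ t ∈ T.H, t * star t = point e (T.psi e h) :=
    ⟨T.tri e h, (T.tri_mem_H e).2 hh, by rw [← pointLin_psi, pointLin_apply]⟩
  rw [Q, dif_pos hex]
  obtain ⟨h1, h2⟩ := hex.choose_spec
  set t := hex.choose with ht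
  have h3 := T.tri_untri e h1.1
  have h4 : untri e t ∈ T.HX e := by rw [← tri_mem_H, h3]; exact h1
  have h5 : untri e t = h := by
    refine T.psi_injOn e h4 hh (pointLin_injective e ?_)
    rw [pointLin_psi, h3, h2, pointLin_apply]
  rw [dg_apply, ← h5, h3]

theorem Qpow_psi (a : Fin r → ℝ) {h : Fin n → ℝ} (hh : h ∈ T.HX e) :
    T.Qpow a (point e (T.psi e h)) = T.chi e a h := by
  rw [Qpow, chi]
  exact Finset.prod_congr rfl fun j _ => by rw [T.Q_psi e j hh]

theorem Qpow_pos (a : Fin r → ℝ) {y : Fin n → ℝ} (hy : y ∈ T.Omega e) :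
    0 < T.Qpow a (point e y) := by
  obtain ⟨h, hh, rfl⟩ := (T.mem_Omega_iff e).1 hy
  rw [T.Qpow_psi e a hh]; exact T.chi_pos e a hh

theorem Qpow_add (a b : Fin r → ℝ) {y : Fin n → ℝ} (hy : y ∈ T.Omega e) :
    T.Qpow (a + b) (point e y) = T.Qpow a (point e y) * T.Qpow b (point e y) := by
  obtain ⟨h, hh, rfl⟩ := (T.mem_Omega_iff e).1 hy
  rw [T.Qpow_psi e _ hh, T.Qpow_psi e _ hh, T.Qpow_psi e _ hh, T.chi_add e _ _ hh]

theorem Qpow_pi (a : Fin r → ℝ) {h y : Fin n → ℝ} (hh : h ∈ T.HX e) (hy : y ∈ T.Omega e) :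
    T.Qpow a (point e (T.pi e h y)) = T.chi e a h * T.Qpow a (point e y) := by
  obtain ⟨g, hg, rfl⟩ := (T.mem_Omega_iff e).1 hy
  rw [pi_psi, T.Qpow_psi e _ hg, T.Qpow_psi e _ (T.xmul_mem_HX e hh hg), chi_xmul]

theorem continuousOn_Qpow (a : Fin r → ℝ) :
    ContinuousOn (fun y => T.Qpow a (point e y)) (T.Omega e) := by
  rw [continuousOn_open_iff (T.isOpen_Omega e)]
  intro V hV
  have h1 := (continuousOn_open_iff (T.isOpen_HX e)).1 (T.continuousOn_chi e a) V hV
  have h2 := T.isOpen_psi_image e h1 Set.inter_subset_left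
  convert h2 using 1
  ext y
  constructor
  · rintro ⟨hy, hyV⟩
    obtain ⟨h, hh, rfl⟩ := (T.mem_Omega_iff e).1 hy
    refine ⟨h, ⟨hh, ?_⟩, rfl⟩
    rw [Set.mem_preimage, T.Qpow_psi e a hh] at hyV
    exact hyV
  · rintro ⟨h, ⟨hh, hV⟩, rfl⟩
    refine ⟨T.psi_mem_Omega e hh, ?_⟩
    rw [Set.mem_preimage, T.Qpow_psi e a hh]
    exact hV

/-! ### Gamma integrals -/

theorem det_pi_pos {h : Fin n → ℝ} (hh : h ∈ T.HX e) : 0 < LinearMap.det (T.pi e h) := by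
  rw [T.det_pi e hh]; exact Finset.prod_pos fun j _ => pow_pos (hh j) _

theorem det_pi_eq_chi {h : Fin n → ℝ} (hh : h ∈ T.HX e) :
    LinearMap.det (T.pi e h) = T.chi e T.tau h := by
  rw [T.det_pi e hh, T.prod_dg_pow e _ hh]
  congr 1; funext j; simp only [tau]; push_cast; ring

/-- The multiplicity of a component in the adapted basis is reflected by its diagonal entry. -/
theorem dg_triVec_of_ne {j : Fin r} {k : T.TriIdx} (h : ¬(k.1.1.1 = j ∧ k.1.1.2 = j)) :
    T.dg e j (T.triVec e k) = 0 := by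
  rw [dg_apply]
  refine T.rho_comp j _ _ _ ?_ (T.tri_triVec_mem e k)
  intro h'
  exact h (Prod.mk.inj h')

/-- The Gaussian integral `∫_H exp(-tr(t t⋆)) ∏ t_jj^{2 a_j} dt` is finite. -/
theorem lintegral_exp_trX_psi_lt_top {a : Fin r → ℝ} (ha : ∀ j, -1 < 2 * a j) :
    ∫⁻ h in T.HX e, ENNReal.ofReal (Real.exp (-T.trX e (T.psi e h)) * T.chi e a h) < ∞ := by
  refine (setLIntegral_le_lintegral _ _).trans_lt ?_
  refine lintegral_lt_top_of_basis volume (T.triBasis e) _ ?_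
  obtain ⟨c, hc, hcb⟩ : ∃ c : ℝ, 0 < c ∧ ∀ x : T.TriIdx → ℝ, c * ‖x‖ ^ 2 ≤
      T.trX e (T.psi e ((T.triBasis e).equivFun.symm x)) := by
    have hcont : Continuous fun x : T.TriIdx → ℝ => (T.triBasis e).equivFun.symm x :=
      LinearMap.continuous_of_finiteDimensional
        ((T.triBasis e).equivFun.symm : (T.TriIdx → ℝ) →ₗ[ℝ] (Fin n → ℝ))
    refine exists_pos_mul_norm_sq_le
      (((T.continuous_trX e).comp (T.continuous_psi e)).comp hcont) (fun t x => ?_) (fun x hx => ?_)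
    · rw [map_smul, psi_smul, map_smul, smul_eq_mul]
    · refine T.trX_psi_pos e fun h => hx ?_
      exact (T.triBasis e).equivFun.symm.injective (by rw [h, map_zero])
  set N : ℝ := (Fintype.card T.TriIdx : ℝ) + 1 with hN
  have hNpos : 0 < N := by positivity
  set c' := c / N with hc'
  have hc'pos : 0 < c' := div_pos hc hNpos
  have hsum : ∀ x : T.TriIdx → ℝ, ∑ k, c' * x k ^ 2 ≤ c * ‖x‖ ^ 2 := by
    intro x
    have h1 : ∀ k, c' * x k ^ 2 ≤ c' * ‖x‖ ^ 2 := fun k => by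
      have := norm_le_pi_norm x k
      rw [← sq_abs (x k), ← Real.norm_eq_abs]
      gcongr
    calc ∑ k, c' * x k ^ 2 ≤ ∑ _k : T.TriIdx, c' * ‖x‖ ^ 2 := Finset.sum_le_sum fun k _ => h1 k
      _ = (Fintype.card T.TriIdx : ℝ) * (c' * ‖x‖ ^ 2) := by simp
      _ ≤ N * (c' * ‖x‖ ^ 2) := by
        have : (0 : ℝ) ≤ c' * ‖x‖ ^ 2 := by positivity
        nlinarith
      _ = c * ‖x‖ ^ 2 := by rw [hc']; field_simp
  -- the exponent and the scale of the coordinate with index `k`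
  set p : T.TriIdx → ℝ := fun k => if k.1.1.1 = k.1.1.2 then a k.1.1.1 else 0 with hp
  set l : T.TriIdx → ℝ := fun k => T.dg e k.1.1.1 (T.triVec e k) with hl
  have hchi : ∀ x : T.TriIdx → ℝ, T.chi e a ((T.triBasis e).equivFun.symm x) =
      ∏ k, ((l k * x k) ^ 2) ^ p k := by
    intro x
    set ι : Fin r → T.TriIdx := fun j => ⟨⟨(j, j), le_rfl⟩,
      ⟨0, by rw [T.finrank_comp_diag j]; exact one_pos⟩⟩ with hι
    have hι' : ∀ k : T.TriIdx, k.1.1.1 = k.1.1.2 → k = ι k.1.1.1 := by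
      rintro ⟨⟨⟨i, j⟩, hij⟩, s⟩ h
      simp only at h
      subst h
      have hs : s = ⟨0, by rw [T.finrank_comp_diag i]; exact one_pos⟩ := by
        ext
        have := s.2
        simp only [T.finrank_comp_diag i] at this
        simp only; omega
      rw [hs]
    refine Fintype.prod_of_injective ι (fun i j h => ?_) _ _ (fun k hk => ?_) (fun j => ?_)
    · exact congrArg (fun k : T.TriIdx => k.1.1.1) h
    · have : k.1.1.1 ≠ k.1.1.2 := fun h => hk ⟨_, (hι' k h).symm⟩
      simp [hp, this]
    · have h1 : T.dg e j ((T.triBasis e).equivFun.symm x) = l (ι j) * x (ι j) := by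
        rw [Module.Basis.equivFun_symm_apply, map_sum, Finset.sum_eq_single (ι j)]
        · rw [map_smul, triBasis_apply, smul_eq_mul, mul_comm]
        · intro k _ hk
          rw [map_smul, triBasis_apply, T.dg_triVec_of_ne e, smul_zero]
          rintro ⟨h1, h2⟩
          exact hk (by rw [hι' k (h1.trans h2.symm), h1])
        · simp
      rw [h1]; simp [hp, hι]
  have hint : Integrable fun x : T.TriIdx → ℝ =>
      ∏ k, (((l k) ^ 2) ^ p k * (((x k) ^ 2) ^ p k * Real.exp (-c' * x k ^ 2))) := by
    refine Integrable.fintype_prod (f := fun k (s : ℝ) =>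
      ((l k) ^ 2) ^ p k * ((s ^ 2) ^ p k * Real.exp (-c' * s ^ 2))) fun k => ?_
    refine (integrable_sq_rpow_mul_exp hc'pos ?_).const_mul _
    simp only [hp]
    split_ifs
    · exact ha _
    · norm_num
  refine lt_of_le_of_lt (lintegral_mono fun x => ?_) hint.lintegral_lt_top
  apply ENNReal.ofReal_le_ofReal
  rw [hchi]
  have h1 : ∏ k, (((l k) ^ 2) ^ p k * (((x k) ^ 2) ^ p k * Real.exp (-c' * x k ^ 2))) =
      Real.exp (-∑ k, c' * x k ^ 2) * ∏ k, ((l k * x k) ^ 2) ^ p k := by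
    rw [← Finset.sum_neg_distrib, Real.exp_sum, ← Finset.prod_mul_distrib]
    refine Finset.prod_congr rfl fun k _ => ?_
    rw [mul_pow, Real.mul_rpow (sq_nonneg _) (sq_nonneg _)]
    ring_nf
  rw [h1]
  refine mul_le_mul_of_nonneg_right ?_
    (Finset.prod_nonneg fun _ _ => Real.rpow_nonneg (sq_nonneg _) _)
  exact Real.exp_le_exp.2 (by linarith [hsum x, hcb x])

/-- The Laplace transform of a power of the right invariant measure of the triangular group:
`ell a` is a multiple of `Q^{-a}`, see `ell_psi`. -/
def ell (a : Fin r → ℝ) (y : Fin n → ℝ) : ℝ≥0∞ :=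
  ∫⁻ h in T.HX e, ENNReal.ofReal
    (Real.exp (-T.sig e h y) * T.chi e (fun j => a j - (1 + T.nDim j) / 2) h)

theorem det_xright_eq_chi {h : Fin n → ℝ} (hh : h ∈ T.HX e) :
    LinearMap.det (T.xright e h) = T.chi e (fun j => (1 + T.nDim j) / 2) h := by
  rw [T.det_xright e hh, T.prod_dg_pow e _ hh]
  congr 1; funext j; push_cast; ring

theorem measurableSet_HX : MeasurableSet (T.HX e) := (T.isOpen_HX e).measurableSet

/-- Right translation by `h` turns `sig t (π(h) y)` into `sig t y`, and its Jacobian is absorbed in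
the shift of the exponent in the definition of `ell`. -/
theorem ell_pi (a : Fin r → ℝ) {h : Fin n → ℝ} (hh : h ∈ T.HX e) (y : Fin n → ℝ) :
    T.ell e a (T.pi e h y) = ENNReal.ofReal (T.chi e (-a) h) * T.ell e a y := by
  set a' : Fin r → ℝ := fun j => a j - (1 + T.nDim j) / 2 with ha'
  set G : (Fin n → ℝ) → ℝ≥0∞ := (T.HX e).indicator fun t =>
    ENNReal.ofReal (Real.exp (-T.sig e t y) * T.chi e a' t) with hG
  have hdet : LinearMap.det (T.xright e h) ≠ 0 := by
    rw [T.det_xright_eq_chi e hh]; exact (T.chi_pos e _ hh).ne'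
  have hmem : ∀ t, T.xmul e t h ∈ T.HX e ↔ t ∈ T.HX e := by
    intro t
    refine forall_congr' fun j => ?_
    rw [dg_xmul]
    exact mul_pos_iff_of_pos_right (hh j)
  have h1 : ∀ t, (T.HX e).indicator (fun t => ENNReal.ofReal
      (Real.exp (-T.sig e t (T.pi e h y)) * T.chi e a' t)) t =
      ENNReal.ofReal (T.chi e (-a') h) * G (T.xright e h t) := by
    intro t
    rw [LinearMap.flip_apply, hG]
    by_cases ht : t ∈ T.HX e
    · rw [Set.indicator_of_mem ht, Set.indicator_of_mem ((hmem t).2 ht),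
        ← ENNReal.ofReal_mul (T.chi_nonneg e _ _), sig_xmul, chi_xmul, T.chi_neg e _ hh,
        LinearMap.comp_apply]
      congr 1
      have := (T.chi_pos e a' hh).ne'
      field_simp
    · rw [Set.indicator_of_notMem ht, Set.indicator_of_notMem (fun h' => ht ((hmem t).1 h')),
        mul_zero]
  rw [ell, ← lintegral_indicator (T.measurableSet_HX e)]
  refine (lintegral_congr h1).trans ?_
  rw [lintegral_const_mul' _ _ ENNReal.ofReal_ne_top, lintegral_comp_linearMap volume _ hdet,
    ← mul_assoc, ← ENNReal.ofReal_mul (T.chi_nonneg e _ _), ell,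
    ← lintegral_indicator (T.measurableSet_HX e)]
  congr 2
  rw [T.det_xright_eq_chi e hh, ← T.chi_neg e _ hh, abs_of_pos (T.chi_pos e _ hh),
    ← T.chi_add e _ _ hh]
  congr 1; funext j; simp only [ha', Pi.add_apply, Pi.neg_apply]; ring

theorem ell_psi (a : Fin r → ℝ) {h : Fin n → ℝ} (hh : h ∈ T.HX e) :
    T.ell e a (T.psi e h) =
      ENNReal.ofReal (T.chi e (-a) h) * T.ell e a (T.psi e (T.xone e)) := by
  rw [← T.ell_pi e a hh, pi_psi, xmul_xone]

theorem ell_xone_lt_top {a : Fin r → ℝ} (ha : ∀ j, (T.nDim j : ℝ) / 2 < a j) :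
    T.ell e a (T.psi e (T.xone e)) < ∞ := by
  have h := T.lintegral_exp_trX_psi_lt_top e (a := fun j => a j - (1 + T.nDim j) / 2)
    (fun j => by have := ha j; linarith)
  refine lt_of_eq_of_lt ?_ h
  unfold ell
  congr 1; funext t
  rw [sig_psi, xmul_xone]

theorem ell_lt_top {a : Fin r → ℝ} (ha : ∀ j, (T.nDim j : ℝ) / 2 < a j) {y : Fin n → ℝ}
    (hy : y ∈ T.Omega e) : T.ell e a y < ∞ := by
  obtain ⟨h, hh, rfl⟩ := (T.mem_Omega_iff e).1 hy
  rw [T.ell_psi e a hh]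
  exact ENNReal.mul_lt_top ENNReal.ofReal_lt_top (T.ell_xone_lt_top e ha)

/-- The Gamma integral of the cone. -/
def gam (a : Fin r → ℝ) : ℝ≥0∞ :=
  ∫⁻ y in T.Omega e, ENNReal.ofReal
    (Real.exp (-T.trX e y) * T.Qpow (fun j => a j - T.tau j) (point e y))

theorem gam_lt_top {a : Fin r → ℝ} (ha : ∀ j, (T.mDim j : ℝ) / 2 < a j) :
    T.gam e a < ∞ := by
  have h := T.lintegral_exp_trX_psi_lt_top e (a := fun j => a j - (1 + T.mDim j) / 2)
    (fun j => by have := ha j; linarith)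
  refine lt_of_eq_of_lt ?_ h
  rw [gam, Omega_eq_image, lintegral_image_eq_lintegral_abs_det_fderiv_mul volume
    (T.measurableSet_HX e)
    (fun x _ => (T.hasStrictFDerivAt_psi e x).hasFDerivAt.hasFDerivWithinAt) (T.psi_injOn e)]
  refine setLIntegral_congr_fun (T.measurableSet_HX e) fun t ht => ?_
  have hdet : (LinearMap.toContinuousLinearMap ((2 : ℝ) • T.psi₂ e t)).det =
      T.chi e (fun j => (1 + T.nDim j) / 2) t := by
    rw [ContinuousLinearMap.det]
    change LinearMap.det ((2 : ℝ) • T.psi₂ e t) = _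
    rw [T.det_dpsi e ht, T.prod_dg_pow e _ ht]
    congr 1; funext j; push_cast; ring
  rw [hdet, abs_of_pos (T.chi_pos e _ ht), ← ENNReal.ofReal_mul (T.chi_nonneg e _ _),
    T.Qpow_psi e _ ht, mul_left_comm, ← T.chi_add e _ _ ht]
  congr 3; funext j; simp only [Pi.add_apply, tau]; ring

theorem measurableSet_Omega : MeasurableSet (T.Omega e) := (T.isOpen_Omega e).measurableSet

theorem lintegral_Omega_exp_sig (a : Fin r → ℝ) {t : Fin n → ℝ} (ht : t ∈ T.HX e) :
    ∫⁻ y in T.Omega e, ENNReal.ofReal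
      (Real.exp (-T.sig e t y) * T.Qpow (fun j => a j - T.tau j) (point e y)) =
      ENNReal.ofReal (T.chi e (-a) t) * T.gam e a := by
  set a' : Fin r → ℝ := fun j => a j - T.tau j with ha'
  set G : (Fin n → ℝ) → ℝ≥0∞ := (T.Omega e).indicator fun y =>
    ENNReal.ofReal (Real.exp (-T.trX e y) * T.Qpow a' (point e y)) with hG
  have h1 : ∀ y, (T.Omega e).indicator (fun y => ENNReal.ofReal
      (Real.exp (-T.sig e t y) * T.Qpow a' (point e y))) y =
      ENNReal.ofReal (T.chi e (-a') t) * G (T.pi e t y) := by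
    intro y
    by_cases hy : y ∈ T.Omega e
    · rw [hG, Set.indicator_of_mem hy, Set.indicator_of_mem ((T.pi_mem_Omega e ht).2 hy),
        ← ENNReal.ofReal_mul (T.chi_nonneg e _ _), sig_apply, T.Qpow_pi e _ ht hy,
        T.chi_neg e _ ht]
      congr 1
      have := (T.chi_pos e a' ht).ne'
      field_simp
    · rw [hG, Set.indicator_of_notMem hy,
        Set.indicator_of_notMem (fun h' => hy ((T.pi_mem_Omega e ht).1 h')), mul_zero]
  rw [← lintegral_indicator (T.measurableSet_Omega e)]
  refine (lintegral_congr h1).trans ?_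
  rw [lintegral_const_mul' _ _ ENNReal.ofReal_ne_top,
    lintegral_comp_linearMap volume _ (T.det_pi_pos e ht).ne', ← mul_assoc,
    ← ENNReal.ofReal_mul (T.chi_nonneg e _ _), gam, ← lintegral_indicator (T.measurableSet_Omega e)]
  congr 2
  rw [T.det_pi_eq_chi e ht, ← T.chi_neg e _ ht, abs_of_pos (T.chi_pos e _ ht),
    ← T.chi_add e _ _ ht]
  congr 1; funext j; simp only [ha', Pi.add_apply, Pi.neg_apply]; ring

end TAlgebra

end

noncomputable section

/-! ### A Plancherel inequality -/

/-- The Fourier transform of the Gaussian `X ↦ exp (-ε |X|²)`. -/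
def gaussKernel {n : ℕ} (ε : ℝ) (ξ : Fin n → ℝ) : ℝ :=
  ∏ k, ((Real.pi / ε) ^ (1 / 2 : ℝ) * Real.exp (-ξ k ^ 2 / (4 * ε)))

theorem gaussKernel_nonneg {n : ℕ} {ε : ℝ} (hε : 0 < ε) (ξ : Fin n → ℝ) : 0 ≤ gaussKernel ε ξ :=
  Finset.prod_nonneg fun _ _ => mul_nonneg
    (Real.rpow_nonneg (div_nonneg Real.pi_pos.le hε.le) _) (Real.exp_pos _).le

theorem continuous_gaussKernel {n : ℕ} (ε : ℝ) : Continuous (gaussKernel (n := n) ε) := by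
  unfold gaussKernel; fun_prop

theorem gaussKernel_neg {n : ℕ} (ε : ℝ) (ξ : Fin n → ℝ) : gaussKernel ε (-ξ) = gaussKernel ε ξ := by
  simp [gaussKernel]

theorem integral_cexp_mul_gauss {n : ℕ} {ε : ℝ} (hε : 0 < ε) (ξ : Fin n → ℝ) :
    ∫ X : Fin n → ℝ, Complex.exp (-(Complex.I * ∑ k, (ξ k : ℂ) * X k)) *
      (Real.exp (-ε * ∑ k, X k ^ 2) : ℝ) = (gaussKernel ε ξ : ℂ) := by
  have h1 : ∀ X : Fin n → ℝ, Complex.exp (-(Complex.I * ∑ k, (ξ k : ℂ) * X k)) *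
      (Real.exp (-ε * ∑ k, X k ^ 2) : ℝ) =
      ∏ k, (Complex.exp (Complex.I * (-(ξ k : ℂ)) * X k) *
        Complex.exp (-(ε : ℂ) * (X k : ℂ) ^ 2)) := by
    intro X
    rw [Finset.prod_mul_distrib, ← Complex.exp_sum, ← Complex.exp_sum, Complex.ofReal_exp]
    congr 2
    · rw [Finset.mul_sum, ← Finset.sum_neg_distrib]
      exact Finset.sum_congr rfl fun k _ => by ring
    · push_cast; rw [Finset.mul_sum]
  simp_rw [h1]
  rw [integral_fintype_prod_volume_eq_prod (f := fun k (x : ℝ) =>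
    Complex.exp (Complex.I * (-(ξ k : ℂ)) * x) * Complex.exp (-(ε : ℂ) * (x : ℂ) ^ 2)),
    gaussKernel, Complex.ofReal_prod]
  refine Finset.prod_congr rfl fun k _ => ?_
  rw [fourierIntegral_gaussian (b := (ε : ℂ)) (by simpa using hε)]
  rw [Complex.ofReal_mul, Complex.ofReal_cpow (div_nonneg Real.pi_pos.le hε.le), Complex.ofReal_exp]
  push_cast
  congr 2
  ring

theorem lintegral_gaussKernel {n : ℕ} {ε : ℝ} (hε : 0 < ε) :
    ∫⁻ ξ : Fin n → ℝ, ENNReal.ofReal (gaussKernel ε ξ) = ENNReal.ofReal ((2 * Real.pi) ^ n) := by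
  have h0 : (0 : ℝ) < 1 / (4 * ε) := by positivity
  have h1 : ∀ x : ℝ, Real.exp (-x ^ 2 / (4 * ε)) = Real.exp (-(1 / (4 * ε)) * x ^ 2) := fun x => by
    congr 1; ring
  have hi : Integrable (gaussKernel (n := n) ε) := by
    refine Integrable.fintype_prod (f := fun (_ : Fin n) (x : ℝ) =>
      (Real.pi / ε) ^ (1 / 2 : ℝ) * Real.exp (-x ^ 2 / (4 * ε))) fun _ => ?_
    simp_rw [h1]
    exact (integrable_exp_neg_mul_sq h0).const_mul _
  rw [← ofReal_integral_eq_lintegral_ofReal hi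
    (Filter.Eventually.of_forall (gaussKernel_nonneg hε))]
  congr 1
  unfold gaussKernel
  rw [integral_fintype_prod_volume_eq_prod (f := fun (_ : Fin n) (x : ℝ) =>
      (Real.pi / ε) ^ (1 / 2 : ℝ) * Real.exp (-x ^ 2 / (4 * ε)))]
  simp_rw [h1, integral_const_mul, integral_gaussian]
  rw [Finset.prod_const, Finset.card_univ, Fintype.card_fin]
  congr 1
  rw [Real.sqrt_eq_rpow, ← Real.mul_rpow (by positivity) (by positivity)]
  have : Real.pi / ε * (Real.pi / (1 / (4 * ε))) = (2 * Real.pi) ^ 2 := by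
    field_simp; ring
  rw [this, ← Real.sqrt_eq_rpow, Real.sqrt_sq (by positivity)]

theorem lintegral_gaussKernel_sub {n : ℕ} {ε : ℝ} (hε : 0 < ε) (η : Fin n → ℝ) :
    ∫⁻ ξ : Fin n → ℝ, ENNReal.ofReal (gaussKernel ε (η - ξ)) =
      ENNReal.ofReal ((2 * Real.pi) ^ n) := by
  rw [lintegral_sub_left_eq_self (fun ξ : Fin n → ℝ => ENNReal.ofReal (gaussKernel ε ξ)) η,
    lintegral_gaussKernel hε]

section Plancherel

variable {A : Type*} [MeasurableSpace A] {n : ℕ} {μ : Measure A} [SFinite μ]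
  {σ : A → Fin n → ℝ} {φ w : A → ℝ}

theorem stronglyMeasurable_fourier (hσ : Measurable σ) (hφ : Measurable φ) :
    StronglyMeasurable fun X : Fin n → ℝ =>
      ∫ a, Complex.exp (-(Complex.I * ∑ k, (σ a k : ℂ) * X k)) * φ a ∂μ := by
  refine StronglyMeasurable.integral_prod_right (f := fun X : Fin n → ℝ => fun a =>
    Complex.exp (-(Complex.I * ∑ k, (σ a k : ℂ) * X k)) * φ a) ?_
  refine Measurable.stronglyMeasurable ?_
  simp only [Function.uncurry_def]
  fun_prop

/-- Schur's test for the kernel `K(σ a - σ b)`: the product `φ a φ b` is at most the mean of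
`φ a ^ 2 * w b / w a` and the expression with `a` and `b` exchanged. -/
theorem lintegral_prod_gaussKernel_le (hσ : Measurable σ) (hφ : Measurable φ)
    (hw : Measurable w) (hw0 : ∀ᵐ a ∂μ, 0 < w a)
    (hpush : ∀ g : (Fin n → ℝ) → ℝ≥0∞, Measurable g →
      ∫⁻ a, ENNReal.ofReal (w a) * g (σ a) ∂μ ≤ ∫⁻ x, g x) {ε : ℝ} (hε : 0 < ε) :
    ∫⁻ p, ENNReal.ofReal (φ p.1 * φ p.2 * gaussKernel ε (σ p.1 - σ p.2)) ∂(μ.prod μ) ≤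
      ENNReal.ofReal ((2 * Real.pi) ^ n) * ∫⁻ a, ENNReal.ofReal (φ a ^ 2 / w a) ∂μ := by
  have hK : Measurable (gaussKernel (n := n) ε) := (continuous_gaussKernel ε).measurable
  set B : A × A → ℝ≥0∞ := fun p => ENNReal.ofReal (φ p.1 ^ 2 / w p.1) *
    (ENNReal.ofReal (w p.2) * ENNReal.ofReal (gaussKernel ε (σ p.1 - σ p.2))) with hB
  have hBm : Measurable B := by
    simp only [hB]; fun_prop
  have hBle : ∫⁻ p, B p ∂(μ.prod μ) ≤
      ENNReal.ofReal ((2 * Real.pi) ^ n) * ∫⁻ a, ENNReal.ofReal (φ a ^ 2 / w a) ∂μ := by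
    rw [lintegral_prod _ hBm.aemeasurable, ← lintegral_const_mul _ (by fun_prop)]
    refine lintegral_mono fun a => ?_
    simp only [hB]
    rw [lintegral_const_mul _ (by fun_prop), mul_comm]
    gcongr
    refine (hpush (fun ξ => ENNReal.ofReal (gaussKernel ε (σ a - ξ))) (by fun_prop)).trans ?_
    rw [lintegral_gaussKernel_sub hε]
  refine le_trans ?_ hBle
  have h2 : 2 * ∫⁻ p, ENNReal.ofReal (φ p.1 * φ p.2 * gaussKernel ε (σ p.1 - σ p.2)) ∂(μ.prod μ)
      ≤ 2 * ∫⁻ p, B p ∂(μ.prod μ) := by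
    have hsw : ∫⁻ p, B p.swap ∂(μ.prod μ) = ∫⁻ p, B p ∂(μ.prod μ) :=
      lintegral_prod_swap B
    rw [two_mul (∫⁻ p, B p ∂(μ.prod μ))]
    conv_rhs => rw [← hsw]
    nth_rw 2 [hsw]
    rw [add_comm, ← lintegral_add_left hBm, ← lintegral_const_mul' _ _ (by simp)]
    have hw1 : ∀ᵐ p ∂(μ.prod μ), 0 < w p.1 := Measure.quasiMeasurePreserving_fst.ae hw0
    have hw2 : ∀ᵐ p ∂(μ.prod μ), 0 < w p.2 := Measure.quasiMeasurePreserving_snd.ae hw0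
    refine lintegral_mono_ae ?_
    filter_upwards [hw1, hw2] with p h1 h2
    simp only [hB, Prod.fst_swap, Prod.snd_swap]
    have hKs : gaussKernel ε (σ p.2 - σ p.1) = gaussKernel ε (σ p.1 - σ p.2) := by
      rw [← gaussKernel_neg]; congr 1; abel
    have hK0 := gaussKernel_nonneg hε (σ p.1 - σ p.2)
    rw [hKs, ← ENNReal.ofReal_mul h2.le, ← ENNReal.ofReal_mul h1.le,
      ← ENNReal.ofReal_mul (by positivity), ← ENNReal.ofReal_mul (by positivity),
      ← ENNReal.ofReal_add (by positivity) (by positivity),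
      show (2 : ℝ≥0∞) = ENNReal.ofReal 2 by simp, ← ENNReal.ofReal_mul (by norm_num)]
    apply ENNReal.ofReal_le_ofReal
    have key : 2 * (φ p.1 * φ p.2) ≤ φ p.1 ^ 2 / w p.1 * w p.2 + φ p.2 ^ 2 / w p.2 * w p.1 := by
      have h3 : φ p.1 ^ 2 / w p.1 * w p.2 + φ p.2 ^ 2 / w p.2 * w p.1 - 2 * (φ p.1 * φ p.2) =
        (φ p.1 * w p.2 - φ p.2 * w p.1) ^ 2 / (w p.1 * w p.2) := by
        field_simp; ring
      have h4 : 0 ≤ (φ p.1 * w p.2 - φ p.2 * w p.1) ^ 2 / (w p.1 * w p.2) := by positivity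
      linarith
    nlinarith [mul_le_mul_of_nonneg_right key hK0]
  exact (ENNReal.mul_le_mul_iff_right (by simp) (by simp)).1 h2

/-- The square of the Fourier transform against a Gaussian, written by Fubini's theorem as a double
integral against the Fourier transform of the Gaussian. -/
theorem lintegral_fourier_mul_gauss_le (hσ : Measurable σ) (hφ : Measurable φ)
    (hφ0 : ∀ a, 0 ≤ φ a) (hφi : Integrable φ μ) {ε : ℝ} (hε : 0 < ε) :
    ∫⁻ X : Fin n → ℝ, ‖∫ a, Complex.exp (-(Complex.I * ∑ k, (σ a k : ℂ) * X k)) * φ a ∂μ‖ₑ ^ 2 *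
      ENNReal.ofReal (Real.exp (-ε * ∑ k, X k ^ 2)) ≤
    ∫⁻ p, ENNReal.ofReal (φ p.1 * φ p.2 * gaussKernel ε (σ p.1 - σ p.2)) ∂(μ.prod μ) := by
  set F : (Fin n → ℝ) → ℂ := fun X =>
    ∫ a, Complex.exp (-(Complex.I * ∑ k, (σ a k : ℂ) * X k)) * φ a ∂μ with hF
  set G : (Fin n → ℝ) → ℝ := fun X => Real.exp (-ε * ∑ k, X k ^ 2) with hG
  have hGi : Integrable G := by
    have : G = fun X : Fin n → ℝ => ∏ k, Real.exp (-ε * X k ^ 2) := by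
      funext X; rw [← Real.exp_sum, ← Finset.mul_sum]
    rw [this]
    exact Integrable.fintype_prod (f := fun (_ : Fin n) (x : ℝ) => Real.exp (-ε * x ^ 2))
      fun _ => integrable_exp_neg_mul_sq hε
  set K : (Fin n → ℝ) → A × A → ℂ := fun X p =>
    Complex.exp (-(Complex.I * ∑ k, ((σ p.1 - σ p.2) k : ℂ) * X k)) * (G X : ℝ) *
      ((φ p.1 * φ p.2 : ℝ) : ℂ) with hK
  have hGm : Measurable G := by simp only [hG]; fun_prop
  have hKi : Integrable (Function.uncurry K) (volume.prod (μ.prod μ)) := by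
    have h1 : Integrable (fun x : (Fin n → ℝ) × (A × A) => G x.1 * (φ x.2.1 * φ x.2.2))
        (volume.prod (μ.prod μ)) := hGi.mul_prod (hφi.mul_prod hφi)
    refine h1.mono' ?_ (Filter.Eventually.of_forall fun x => ?_)
    · refine Measurable.aestronglyMeasurable ?_
      simp only [hK, Function.uncurry_def, Pi.sub_apply]
      fun_prop
    · simp only [hK, Function.uncurry_def]
      rw [norm_mul, norm_mul, Complex.norm_real, Complex.norm_real, Complex.norm_exp]
      have : (-(Complex.I * ∑ k, ((σ x.2.1 - σ x.2.2) k : ℂ) * x.1 k)).re = 0 := by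
        have : (∑ k, ((σ x.2.1 - σ x.2.2) k : ℂ) * x.1 k) =
          ((∑ k, (σ x.2.1 - σ x.2.2) k * x.1 k : ℝ) : ℂ) := by push_cast; rfl
        rw [this]; simp
      rw [this, Real.exp_zero, one_mul, Real.norm_of_nonneg (Real.exp_pos _).le,
        Real.norm_of_nonneg (mul_nonneg (hφ0 _) (hφ0 _))]
  have hinner : ∀ X, ∫ p, K X p ∂(μ.prod μ) = ((‖F X‖ ^ 2 * G X : ℝ) : ℂ) := by
    intro X
    have h1 : ∀ p : A × A, K X p = (G X : ℂ) *
        ((Complex.exp (-(Complex.I * ∑ k, (σ p.1 k : ℂ) * X k)) * φ p.1) *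
        (conj (Complex.exp (-(Complex.I * ∑ k, (σ p.2 k : ℂ) * X k)) * φ p.2))) := by
      intro p
      simp only [hK]
      rw [map_mul, ← Complex.exp_conj]
      simp only [map_neg, map_mul, map_sum, Complex.conj_I, Complex.conj_ofReal]
      rw [show ∀ a b c d g : ℂ, g * (a * b * (c * d)) = (a * c) * g * (b * d) by intros; ring,
        ← Complex.exp_add]
      push_cast
      congr 3
      simp only [Pi.sub_apply, Complex.ofReal_sub, sub_mul, Finset.sum_sub_distrib]
      ring
    simp_rw [h1]
    rw [integral_const_mul, integral_prod_mul
      (f := fun a => Complex.exp (-(Complex.I * ∑ k, (σ a k : ℂ) * X k)) * φ a)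
      (g := fun a => conj (Complex.exp (-(Complex.I * ∑ k, (σ a k : ℂ) * X k)) * φ a)),
      integral_conj, Complex.mul_conj, Complex.normSq_eq_norm_sq]
    push_cast; ring
  have hFi : Integrable fun X => ‖F X‖ ^ 2 * G X := by
    have h1 := hKi.integral_prod_left.re
    refine h1.congr (Filter.Eventually.of_forall fun X => ?_)
    simp only [Function.uncurry_apply_pair, hinner]
    exact Complex.ofReal_re _
  have hmain : ∫ X, ‖F X‖ ^ 2 * G X =
      ∫ p, φ p.1 * φ p.2 * gaussKernel ε (σ p.1 - σ p.2) ∂(μ.prod μ) := by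
    have h1 := integral_integral_swap hKi
    simp_rw [hinner] at h1
    rw [integral_complex_ofReal] at h1
    have h2 : ∀ p : A × A, ∫ X, K X p =
        ((φ p.1 * φ p.2 * gaussKernel ε (σ p.1 - σ p.2) : ℝ) : ℂ) := by
      intro p
      simp only [hK]
      rw [integral_mul_const, hG, integral_cexp_mul_gauss hε]
      push_cast; ring
    simp_rw [h2] at h1
    rw [integral_complex_ofReal] at h1
    exact_mod_cast h1
  calc _ = ∫⁻ X, ENNReal.ofReal (‖F X‖ ^ 2 * G X) := by
        refine lintegral_congr fun X => ?_
        rw [ENNReal.ofReal_mul (by positivity), ENNReal.ofReal_pow (norm_nonneg _),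
          ofReal_norm]
    _ = ENNReal.ofReal (∫ X, ‖F X‖ ^ 2 * G X) :=
        (ofReal_integral_eq_lintegral_ofReal hFi (Filter.Eventually.of_forall fun X =>
          mul_nonneg (by positivity) (Real.exp_pos _).le)).symm
    _ ≤ _ := by
        rw [hmain, integral_eq_lintegral_of_nonneg_ae]
        · exact ENNReal.ofReal_toReal_le
        · exact Filter.Eventually.of_forall fun p =>
            mul_nonneg (mul_nonneg (hφ0 _) (hφ0 _)) (gaussKernel_nonneg hε _)
        · refine Measurable.aestronglyMeasurable ?_
          have := (continuous_gaussKernel (n := n) ε).measurable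
          fun_prop

/-- The Plancherel inequality for the Fourier transform of the image under `σ` of the measure
`φ dμ`, when `w dμ` has image at most Lebesgue measure. -/
theorem lintegral_enorm_sq_fourier_le (hσ : Measurable σ) (hφ : Measurable φ)
    (hφ0 : ∀ a, 0 ≤ φ a) (hφi : Integrable φ μ) (hw : Measurable w) (hw0 : ∀ᵐ a ∂μ, 0 < w a)
    (hpush : ∀ g : (Fin n → ℝ) → ℝ≥0∞, Measurable g →
      ∫⁻ a, ENNReal.ofReal (w a) * g (σ a) ∂μ ≤ ∫⁻ x, g x) :
    ∫⁻ X : Fin n → ℝ, ‖∫ a, Complex.exp (-(Complex.I * ∑ k, (σ a k : ℂ) * X k)) * φ a ∂μ‖ₑ ^ 2 ≤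
      ENNReal.ofReal ((2 * Real.pi) ^ n) * ∫⁻ a, ENNReal.ofReal (φ a ^ 2 / w a) ∂μ := by
  set F : (Fin n → ℝ) → ℂ := fun X =>
    ∫ a, Complex.exp (-(Complex.I * ∑ k, (σ a k : ℂ) * X k)) * φ a ∂μ with hF
  have hFm : Measurable F := (stronglyMeasurable_fourier hσ hφ).measurable
  -- remove the Gaussian factor by Fatou's lemma
  set f : ℕ → (Fin n → ℝ) → ℝ≥0∞ := fun N X =>
    ‖F X‖ₑ ^ 2 * ENNReal.ofReal (Real.exp (-(1 / ((N : ℝ) + 1)) * ∑ k, X k ^ 2)) with hf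
  have hlim : ∀ X, Filter.liminf (fun N => f N X) Filter.atTop = ‖F X‖ₑ ^ 2 := by
    intro X
    apply Filter.Tendsto.liminf_eq
    have h1 : Filter.Tendsto (fun N : ℕ => ENNReal.ofReal
        (Real.exp (-(1 / ((N : ℝ) + 1)) * ∑ k, X k ^ 2))) Filter.atTop (nhds (ENNReal.ofReal 1)) := by
      refine ENNReal.tendsto_ofReal ?_
      rw [← Real.exp_zero]
      refine (Real.continuous_exp.tendsto 0).comp ?_
      have := (tendsto_one_div_add_atTop_nhds_zero_nat (𝕜 := ℝ)).neg.mul_const (∑ k, X k ^ 2)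
      simpa using this
    have h2 := ENNReal.Tendsto.const_mul (a := ‖F X‖ₑ ^ 2) h1 (Or.inr (by simp))
    simpa [hf] using h2
  calc ∫⁻ X, ‖F X‖ₑ ^ 2 = ∫⁻ X, Filter.liminf (fun N => f N X) Filter.atTop :=
        lintegral_congr fun X => (hlim X).symm
    _ ≤ Filter.liminf (fun N => ∫⁻ X, f N X) Filter.atTop :=
        lintegral_liminf_le fun N => by simp only [hf]; fun_prop
    _ ≤ _ := by
        refine Filter.liminf_le_of_le (by isBoundedDefault) fun b hb => ?_
        obtain ⟨N, hN⟩ := hb.exists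
        have hε : (0 : ℝ) < 1 / ((N : ℝ) + 1) := by positivity
        exact hN.trans ((lintegral_fourier_mul_gauss_le hσ hφ hφ0 hφi hε).trans
          (lintegral_prod_gaussKernel_le hσ hφ hw hw0 hpush hε))

end Plancherel

end

noncomputable section

/-! ### The Laplace transform on the tube domain -/

/-- A holomorphic function on a convex open set that vanishes at the real points near `0`
vanishes. -/
theorem eq_zero_of_forall_real_eq_zero {S : Set ℂ} (hS : IsOpen S) (hc : Convex ℝ S)
    (h0 : (0 : ℂ) ∈ S) {f : ℂ → ℂ} (hf : DifferentiableOn ℂ f S)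
    (hz : ∀ x : ℝ, (x : ℂ) ∈ S → f x = 0) {ζ : ℂ} (hζ : ζ ∈ S) : f ζ = 0 := by
  refine (hf.analyticOnNhd hS).eqOn_zero_of_preconnected_of_frequently_eq_zero
    hc.isPreconnected h0 ?_ hζ
  have ht : Filter.Tendsto (fun N : ℕ => ((1 / ((N : ℝ) + 1) : ℝ) : ℂ)) Filter.atTop
      (nhdsWithin 0 {0}ᶜ) := by
    rw [tendsto_nhdsWithin_iff]
    constructor
    · have := (Complex.continuous_ofReal.tendsto 0).comp
        (tendsto_one_div_add_atTop_nhds_zero_nat (𝕜 := ℝ))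
      simpa [Function.comp_def] using this
    · refine Filter.Eventually.of_forall fun N => ?_
      have : (1 / ((N : ℝ) + 1)) ≠ 0 := by positivity
      exact Complex.ofReal_ne_zero.2 this
  refine ht.frequently (Filter.Eventually.frequently ?_)
  have := (tendsto_nhdsWithin_iff.1 ht).1.eventually (hS.mem_nhds h0)
  filter_upwards [this] with N hN using hz _ hN

namespace TAlgebra

variable {r : ℕ} {U : Type*} [NonUnitalNonAssocRing U] [Module ℝ U]
  [IsScalarTower ℝ U U] [SMulCommClass ℝ U U] [StarRing U] [StarModule ℝ U]
  {n : ℕ}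
variable (T : TAlgebra r U) (e : Module.Basis (Fin n) ℝ (selfAdjoint.submodule ℝ U))

/-- The complex linear extension of `sig a`. -/
def sigC (a : Fin n → ℝ) : (Fin n → ℂ) →L[ℂ] ℂ :=
  ∑ k, (T.sigv e a k : ℂ) • ContinuousLinearMap.proj k

theorem sigC_apply (a : Fin n → ℝ) (Z : Fin n → ℂ) :
    T.sigC e a Z = ∑ k, (T.sigv e a k : ℂ) * Z k := by
  simp [sigC]

variable [FiniteDimensional ℝ U]

theorem sigC_re (a : Fin n → ℝ) (Z : Fin n → ℂ) :
    (T.sigC e a Z).re = T.sig e a (fun k => (Z k).re) := by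
  rw [sigC_apply, sig_eq_sum, Complex.re_sum]
  exact Finset.sum_congr rfl fun k _ => by rw [Complex.re_ofReal_mul]

theorem sigC_ofReal (a y : Fin n → ℝ) :
    T.sigC e a (fun k => (y k : ℂ)) = (T.sig e a y : ℂ) := by
  rw [sigC_apply, sig_eq_sum]; push_cast; rfl

theorem norm_sigC_le (a : Fin n → ℝ) : ‖T.sigC e a‖ ≤ ∑ k, |T.sigv e a k| := by
  refine ContinuousLinearMap.opNorm_le_bound _ (Finset.sum_nonneg fun _ _ => abs_nonneg _)
    fun Z => ?_
  rw [sigC_apply, Finset.sum_mul]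
  refine (norm_sum_le _ _).trans (Finset.sum_le_sum fun k _ => ?_)
  rw [norm_mul, Complex.norm_real, Real.norm_eq_abs]
  gcongr
  exact norm_le_pi_norm Z k

/-- The Laplace transform of a power of the right invariant measure of the triangular group, on
the tube over the cone. It is the analytic continuation of `ell s`. -/
def lap (s : Fin r → ℝ) (Z : Fin n → ℂ) : ℂ :=
  ∫ h in T.HX e, Complex.exp (-T.sigC e h Z) *
    (T.chi e (fun j => s j - (1 + T.nDim j) / 2) h : ℝ)

theorem continuous_sigv : Continuous (T.sigv e) :=
  continuous_iff_continuousAt.2 fun a => (T.hasStrictFDerivAt_sigv e a).hasFDerivAt.continuousAt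

theorem continuous_sig_left (y : Fin n → ℝ) : Continuous fun a => T.sig e a y := by
  simp_rw [sig_eq_sum]
  have := T.continuous_sigv e
  fun_prop

theorem continuous_sigC : Continuous (T.sigC e) := by
  unfold sigC
  have := T.continuous_sigv e
  fun_prop

theorem norm_exp_sigC_mul (a : Fin r → ℝ) (h : Fin n → ℝ) (Z : Fin n → ℂ) :
    ‖Complex.exp (-T.sigC e h Z) * (T.chi e a h : ℝ)‖ =
      Real.exp (-T.sig e h (fun k => (Z k).re)) * T.chi e a h := by
  rw [norm_mul, Complex.norm_exp, Complex.norm_real, Real.norm_of_nonneg (T.chi_nonneg e _ _),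
    Complex.neg_re, sigC_re]

theorem integrableOn_exp_sig {s : Fin r → ℝ} {y : Fin n → ℝ} (hy : T.ell e s y < ∞) :
    IntegrableOn (fun h => Real.exp (-T.sig e h y) *
      T.chi e (fun j => s j - (1 + T.nDim j) / 2) h) (T.HX e) := by
  have hm : Measurable fun h => Real.exp (-T.sig e h y) *
      T.chi e (fun j => s j - (1 + T.nDim j) / 2) h :=
    (Real.measurable_exp.comp (T.continuous_sig_left e y).measurable.neg).mul
      (T.measurable_chi e _)
  refine ⟨hm.aestronglyMeasurable, ?_⟩
  rw [hasFiniteIntegral_iff_ofReal (Filter.Eventually.of_forall fun h =>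
    mul_nonneg (Real.exp_pos _).le (T.chi_nonneg e _ _))]
  exact hy

theorem measurable_exp_sigC_mul (a : Fin r → ℝ) (Z : Fin n → ℂ) :
    Measurable fun h => Complex.exp (-T.sigC e h Z) * ((T.chi e a h : ℝ) : ℂ) := by
  have h1 : Continuous fun h => T.sigC e h Z := by
    have := T.continuous_sigC e
    fun_prop
  exact (Complex.measurable_exp.comp h1.measurable.neg).mul
    (Complex.measurable_ofReal.comp (T.measurable_chi e a))

theorem integrableOn_exp_sigC {s : Fin r → ℝ} {Z : Fin n → ℂ}
    (hZ : T.ell e s (fun k => (Z k).re) < ∞) :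
    IntegrableOn (fun h => Complex.exp (-T.sigC e h Z) *
      (T.chi e (fun j => s j - (1 + T.nDim j) / 2) h : ℝ)) (T.HX e) := by
  refine (T.integrableOn_exp_sig e hZ).mono' (T.measurable_exp_sigC_mul e _ Z).aestronglyMeasurable
    (Filter.Eventually.of_forall fun h => ?_)
  rw [norm_exp_sigC_mul]

theorem measurable_lap (s : Fin r → ℝ) : Measurable (T.lap e s) := by
  refine StronglyMeasurable.measurable ?_
  refine StronglyMeasurable.integral_prod_right (f := fun (Z : Fin n → ℂ) (h : Fin n → ℝ) =>
    Complex.exp (-T.sigC e h Z) * ((T.chi e (fun j => s j - (1 + T.nDim j) / 2) h : ℝ) : ℂ)) ?_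
  refine Measurable.stronglyMeasurable ?_
  simp only [Function.uncurry_def]
  have h1 : Continuous fun p : (Fin n → ℂ) × (Fin n → ℝ) => T.sigC e p.2 p.1 := by
    have := T.continuous_sigC e
    fun_prop
  exact (Complex.measurable_exp.comp h1.measurable.neg).mul
    (Complex.measurable_ofReal.comp ((T.measurable_chi e _).comp measurable_snd))

theorem lap_ofReal (s : Fin r → ℝ) (y : Fin n → ℝ) :
    T.lap e s (fun k => (y k : ℂ)) = ((T.ell e s y).toReal : ℂ) := by
  have h1 : ∀ h, Complex.exp (-T.sigC e h (fun k => (y k : ℂ))) *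
      ((T.chi e (fun j => s j - (1 + T.nDim j) / 2) h : ℝ) : ℂ) =
      ((Real.exp (-T.sig e h y) * T.chi e (fun j => s j - (1 + T.nDim j) / 2) h : ℝ) : ℂ) := by
    intro h; rw [sigC_ofReal]; push_cast; rfl
  rw [lap]
  simp_rw [h1]
  rw [integral_complex_ofReal, integral_eq_lintegral_of_nonneg_ae]
  · rfl
  · exact Filter.Eventually.of_forall fun h => mul_nonneg (Real.exp_pos _).le (T.chi_nonneg e _ _)
  · exact ((Real.measurable_exp.comp (T.continuous_sig_left e y).measurable.neg).mul
      (T.measurable_chi e _)).aestronglyMeasurable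

theorem ell_xone_ne_zero (s : Fin r → ℝ) : T.ell e s (T.psi e (T.xone e)) ≠ 0 := by
  have hm : Measurable fun h => ENNReal.ofReal (Real.exp (-T.sig e h (T.psi e (T.xone e))) *
      T.chi e (fun j => s j - (1 + T.nDim j) / 2) h) :=
    ((Real.measurable_exp.comp (T.continuous_sig_left e _).measurable.neg).mul
      (T.measurable_chi e _)).ennreal_ofReal
  rw [ell, Ne, lintegral_eq_zero_iff hm]
  intro h0
  rw [Filter.EventuallyEq, ae_restrict_iff' (T.measurableSet_HX e)] at h0
  have h1 : volume (T.HX e) = 0 := by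
    refine measure_mono_null ?_ (ae_iff.1 h0)
    intro h hh hc
    have := hc hh
    rw [Pi.zero_apply, ENNReal.ofReal_eq_zero] at this
    exact absurd (mul_pos (Real.exp_pos _) (T.chi_pos e _ hh)) (not_lt.2 this)
  exact ((T.isOpen_HX e).measure_pos volume ⟨_, T.xone_mem_HX e⟩).ne' h1

theorem exists_sigv_le {y : Fin n → ℝ} (hy : y ∈ T.Omega e) :
    ∃ C : ℝ, 0 < C ∧ ∀ h k, |T.sigv e h k| ≤ C * T.sig e h y := by
  obtain ⟨ε, hε, hball⟩ := Metric.isOpen_iff.1 (T.isOpen_Omega e) y hy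
  refine ⟨(ε / 2)⁻¹, by positivity, fun h k => ?_⟩
  have hmem : ∀ t : ℝ, |t| = ε / 2 → 0 ≤ T.sig e h y + t * T.sigv e h k := by
    intro t ht
    have h1 : y + t • Pi.single k (1 : ℝ) ∈ T.Omega e := by
      apply hball
      rw [Metric.mem_ball, dist_eq_norm, add_sub_cancel_left, norm_smul, Real.norm_eq_abs, ht]
      have : ‖(Pi.single k (1 : ℝ) : Fin n → ℝ)‖ = 1 := by
        rw [Pi.norm_single, norm_one]
      rw [this]; linarith
    have h2 := T.sig_nonneg_of_mem_closure e (subset_closure h1) h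
    rwa [map_add, map_smul, smul_eq_mul] at h2
  have h1 := hmem (ε / 2) (abs_of_pos (by positivity))
  have h2 := hmem (-(ε / 2)) (by rw [abs_neg]; exact abs_of_pos (by positivity))
  rw [inv_mul_eq_div, le_div_iff₀ (by positivity), ← abs_of_pos (show 0 < ε / 2 by positivity),
    ← abs_mul, abs_le]
  constructor <;> linarith

theorem differentiableAt_lap {s : Fin r → ℝ} (hs : ∀ j, (T.nDim j : ℝ) / 2 < s j)
    {Z : Fin n → ℂ} (hZ : (fun k => (Z k).re) ∈ T.Omega e) :
    DifferentiableAt ℂ (T.lap e s) Z := by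
  set Y : Fin n → ℝ := fun k => (Z k).re with hY
  set a : Fin r → ℝ := fun j => s j - (1 + T.nDim j) / 2 with ha
  obtain ⟨C, hC, hCle⟩ := T.exists_sigv_le e hZ
  -- on the neighbourhood `Re W ∈ Y / 2 + Ω` of `Z`, half of the exponential decay controls the
  -- factor `sig h Y` that differentiation brings in
  set S : Set (Fin n → ℂ) := {W | (fun k => (W k).re) - (1 / 2 : ℝ) • Y ∈ T.Omega e} with hS
  have hSo : IsOpen S := (T.isOpen_Omega e).preimage (by fun_prop)
  have hZS : Z ∈ S := by
    have : Y - (1 / 2 : ℝ) • Y = (1 / 2 : ℝ) • Y := by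
      rw [← one_smul ℝ Y, smul_smul, ← sub_smul]; norm_num
    change Y - (1 / 2 : ℝ) • Y ∈ T.Omega e
    rw [this]
    exact T.smul_mem_Omega e hZ (by norm_num)
  have hY4 : (1 / 4 : ℝ) • Y ∈ T.Omega e := T.smul_mem_Omega e hZ (by norm_num)
  have hint := T.integrableOn_exp_sig e (T.ell_lt_top e hs hY4)
  refine (hasFDerivAt_integral_of_dominated_of_fderiv_le (𝕜 := ℂ) (μ := volume.restrict (T.HX e))
    (F := fun W h => Complex.exp (-T.sigC e h W) * ((T.chi e a h : ℝ) : ℂ))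
    (F' := fun W h => ((T.chi e a h : ℝ) : ℂ) • (Complex.exp (-T.sigC e h W) • (-T.sigC e h)))
    (bound := fun h => (4 * (n * C)) * (Real.exp (-T.sig e h ((1 / 4 : ℝ) • Y)) * T.chi e a h))
    (hSo.mem_nhds hZS) ?_ ?_ ?_ ?_ (hint.const_mul _) ?_).differentiableAt
  · exact Filter.Eventually.of_forall fun W =>
      (T.measurable_exp_sigC_mul e a W).aestronglyMeasurable
  · exact T.integrableOn_exp_sigC e (T.ell_lt_top e hs hZ)
  · refine Measurable.aestronglyMeasurable ?_
    have h1 := (T.continuous_sigC e)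
    have h2 : Continuous fun h => T.sigC e h Z := by fun_prop
    exact (Complex.measurable_ofReal.comp (T.measurable_chi e a)).smul
      ((Complex.measurable_exp.comp h2.measurable.neg).smul h1.measurable.neg)
  · refine Filter.Eventually.of_forall fun h W hW => ?_
    have hpos : 0 ≤ T.sig e h Y := T.sig_nonneg_of_mem_closure e (subset_closure hZ) h
    have h1 : ‖T.sigC e h‖ ≤ n * C * T.sig e h Y := by
      refine (T.norm_sigC_le e h).trans ((Finset.sum_le_sum fun k _ => hCle h k).trans ?_)
      simp [mul_assoc]
    have h2 : T.sig e h Y / 2 ≤ T.sig e h (fun k => (W k).re) := by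
      have := T.sig_nonneg_of_mem_closure e (subset_closure hW) h
      rw [map_sub, map_smul, smul_eq_mul] at this
      linarith
    rw [norm_smul, norm_smul, norm_neg, Complex.norm_real, Complex.norm_exp,
      Real.norm_of_nonneg (T.chi_nonneg e _ _), Complex.neg_re, sigC_re, map_smul, smul_eq_mul]
    have h3 : Real.exp (-T.sig e h (fun k => (W k).re)) ≤
        Real.exp (-(1 / 4 * T.sig e h Y)) * Real.exp (-(1 / 4 * T.sig e h Y)) := by
      rw [← Real.exp_add]
      exact Real.exp_le_exp.2 (by linarith)
    have h4 : T.sig e h Y * Real.exp (-(1 / 4 * T.sig e h Y)) ≤ 4 := by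
      have := Real.add_one_le_exp (1 / 4 * T.sig e h Y)
      rw [Real.exp_neg, ← div_eq_mul_inv, div_le_iff₀ (Real.exp_pos _)]
      linarith
    calc T.chi e a h * (Real.exp (-T.sig e h (fun k => (W k).re)) * ‖T.sigC e h‖)
        ≤ T.chi e a h * ((Real.exp (-(1 / 4 * T.sig e h Y)) *
            Real.exp (-(1 / 4 * T.sig e h Y))) * (n * C * T.sig e h Y)) := by
          have := T.chi_nonneg e a h
          gcongr
      _ = (T.sig e h Y * Real.exp (-(1 / 4 * T.sig e h Y))) *
            ((n * C) * (Real.exp (-(1 / 4 * T.sig e h Y)) * T.chi e a h)) := by ring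
      _ ≤ 4 * ((n * C) * (Real.exp (-(1 / 4 * T.sig e h Y)) * T.chi e a h)) := by
          have := T.chi_nonneg e a h
          have := Real.exp_pos (-(1 / 4 * T.sig e h Y))
          gcongr
      _ = _ := by ring
  · refine Filter.Eventually.of_forall fun h W _ => ?_
    exact ((T.sigC e h).hasFDerivAt.neg.cexp).mul_const ((T.chi e a h : ℝ) : ℂ)

theorem convex_tube_line (Y X : Fin n → ℝ) :
    Convex ℝ {ζ : ℂ | Y + ζ.re • X ∈ T.Omega e} := by
  intro ζ hζ η hη s t hs ht hst
  have := T.convex_Omega e hζ hη hs ht hst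
  rw [Set.mem_ofPred_eq]
  convert this using 1
  rw [Complex.add_re, Complex.real_smul, Complex.real_smul, Complex.re_ofReal_mul,
    Complex.re_ofReal_mul, add_smul, mul_smul, mul_smul, smul_add, smul_add]
  have : Y = s • Y + t • Y := by rw [← add_smul, hst, one_smul]
  conv_lhs => rw [this]
  abel

/-- The functions `lap s` and `lap (s / 2) ^ 2` are proportional at real points, where both are
multiples of `Q ^ (-s)`, hence everywhere by analytic continuation along complex lines. -/
theorem lap_eq_mul_sq {s : Fin r → ℝ} (hs : ∀ j, (T.nDim j : ℝ) / 2 < s j)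
    (hs2 : ∀ j, (T.nDim j : ℝ) / 2 < s j / 2) :
    ∃ κ : ℂ, ∀ Y X : Fin n → ℝ, Y ∈ T.Omega e →
      T.lap e s (fun k => (Y k : ℂ) + Complex.I * X k) =
        κ * T.lap e (fun j => s j / 2) (fun k => (Y k : ℂ) + Complex.I * X k) ^ 2 := by
  set c := (T.ell e s (T.psi e (T.xone e))).toReal with hc
  set d := (T.ell e (fun j => s j / 2) (T.psi e (T.xone e))).toReal with hd
  have hd0 : d ≠ 0 := (ENNReal.toReal_pos (T.ell_xone_ne_zero e _)
    (T.ell_xone_lt_top e hs2).ne).ne'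
  refine ⟨((c / d ^ 2 : ℝ) : ℂ), fun Y X hY => ?_⟩
  have hreal : ∀ y ∈ T.Omega e, T.lap e s (fun k => (y k : ℂ)) =
      ((c / d ^ 2 : ℝ) : ℂ) * T.lap e (fun j => s j / 2) (fun k => (y k : ℂ)) ^ 2 := by
    intro y hy
    obtain ⟨h, hh, rfl⟩ := (T.mem_Omega_iff e).1 hy
    rw [lap_ofReal, lap_ofReal, T.ell_psi e _ hh, T.ell_psi e _ hh, ENNReal.toReal_mul,
      ENNReal.toReal_mul, ENNReal.toReal_ofReal (T.chi_nonneg e _ _),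
      ENNReal.toReal_ofReal (T.chi_nonneg e _ _), ← hc, ← hd]
    have h1 : T.chi e (-s) h = T.chi e (-fun j => s j / 2) h ^ 2 := by
      rw [sq, ← T.chi_add e _ _ hh]; congr 1; funext j
      simp only [Pi.neg_apply, Pi.add_apply]; ring
    rw [h1]
    norm_cast
    field_simp
  set S : Set ℂ := {ζ : ℂ | Y + ζ.re • X ∈ T.Omega e} with hS
  set L : ℂ → (Fin n → ℂ) := fun ζ k => (Y k : ℂ) + ζ * X k with hL
  have hre : ∀ ζ : ℂ, (fun k => (L ζ k).re) = Y + ζ.re • X := by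
    intro ζ; funext k; simp [hL]
  have hLd : Differentiable ℂ L := by
    simp only [hL]; fun_prop
  set f : ℂ → ℂ := fun ζ => T.lap e s (L ζ) -
    ((c / d ^ 2 : ℝ) : ℂ) * T.lap e (fun j => s j / 2) (L ζ) ^ 2 with hf
  have hfd : DifferentiableOn ℂ f S := by
    intro ζ hζ
    have hζ' : (fun k => (L ζ k).re) ∈ T.Omega e := by rw [hre]; exact hζ
    have h1 := (T.differentiableAt_lap e hs hζ').comp ζ (hLd ζ)
    have h2 := (T.differentiableAt_lap e hs2 hζ').comp ζ (hLd ζ)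
    exact (h1.sub ((h2.pow 2).const_mul _)).differentiableWithinAt
  have key := eq_zero_of_forall_real_eq_zero (f := f) (S := S)
    ((T.isOpen_Omega e).preimage (by fun_prop)) (T.convex_tube_line e Y X)
    (by simpa [hS] using hY) hfd (fun x hx => ?_) (ζ := Complex.I) (by simpa [hS] using hY)
  · exact sub_eq_zero.1 key
  · have h1 : L x = fun k => (((Y + x • X) k : ℝ) : ℂ) := by
      funext k; simp [hL]
    simp only [hf]
    rw [h1, hreal _ (by simpa [hS] using hx), sub_self]

/-- The integral of `|lap s|` over the imaginary directions: `lap s` is a multiple of the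
square of `lap (s / 2)`, and the Plancherel inequality applies to the latter. -/
theorem lintegral_enorm_lap_le {s : Fin r → ℝ} (hs : ∀ j, (T.nDim j : ℝ) / 2 < s j)
    (hs2 : ∀ j, (T.nDim j : ℝ) / 2 < s j / 2) :
    ∃ C : ℝ≥0∞, C < ∞ ∧ ∀ Y ∈ T.Omega e,
      ∫⁻ X : Fin n → ℝ, ‖T.lap e s (fun k => (Y k : ℂ) + Complex.I * X k)‖ₑ ≤
        C * T.ell e (fun j => s j - T.tau j) ((2 : ℝ) • Y) := by
  obtain ⟨κ, hκ⟩ := T.lap_eq_mul_sq e hs hs2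
  set δ : ℝ := |LinearMap.det ((2 : ℝ) • T.sigv₂ e (T.xone e))| with hδ
  have hδ0 : 0 < δ := abs_pos.2 (T.det_dsigv_one_ne_zero e)
  set w : (Fin n → ℝ) → ℝ := fun h => δ * T.chi e (fun j => (1 + T.mDim j) / 2) h with hw
  have hwm : Measurable w := (T.measurable_chi e _).const_mul _
  have hw0 : ∀ᵐ h ∂(volume.restrict (T.HX e)), 0 < w h := by
    refine (ae_restrict_iff' (T.measurableSet_HX e)).2 (Filter.Eventually.of_forall fun h hh => ?_)
    exact mul_pos hδ0 (T.chi_pos e _ hh)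
  -- `w` is the Jacobian of the injective map `sigv` on `H`
  have hpush : ∀ g : (Fin n → ℝ) → ℝ≥0∞, Measurable g →
      ∫⁻ h in T.HX e, ENNReal.ofReal (w h) * g (T.sigv e h) ≤ ∫⁻ x, g x := by
    intro g _
    have h1 := lintegral_image_eq_lintegral_abs_det_fderiv_mul volume (T.measurableSet_HX e)
      (fun x _ => (T.hasStrictFDerivAt_sigv e x).hasFDerivAt.hasFDerivWithinAt)
      (T.sigv_injOn e) g
    refine le_trans (le_of_eq ?_) (setLIntegral_le_lintegral (T.sigv e '' T.HX e) g)
    rw [h1]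
    refine setLIntegral_congr_fun (T.measurableSet_HX e) fun h hh => ?_
    have hdet : (LinearMap.toContinuousLinearMap ((2 : ℝ) • T.sigv₂ e h)).det =
        LinearMap.det ((2 : ℝ) • T.sigv₂ e (T.xone e)) *
          T.chi e (fun j => (1 + T.mDim j) / 2) h := by
      rw [ContinuousLinearMap.det]
      change LinearMap.det ((2 : ℝ) • T.sigv₂ e h) = _
      rw [T.det_dsigv e hh, T.prod_dg_pow e _ hh]
      congr 2; funext j; push_cast; ring
    simp only [hdet, abs_mul, abs_of_pos (T.chi_pos e _ hh), hw, hδ]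
  refine ⟨‖κ‖ₑ * (ENNReal.ofReal ((2 * Real.pi) ^ n) * ENNReal.ofReal δ⁻¹),
    ENNReal.mul_lt_top (by simp) (ENNReal.mul_lt_top (by simp) (by simp)), fun Y hY => ?_⟩
  set b : Fin r → ℝ := fun j => s j / 2 - (1 + T.nDim j) / 2 with hb
  set φ : (Fin n → ℝ) → ℝ := fun h => Real.exp (-T.sig e h Y) * T.chi e b h with hφ
  have hφm : Measurable φ :=
    (Real.measurable_exp.comp (T.continuous_sig_left e Y).measurable.neg).mul
      (T.measurable_chi e _)
  have hP := lintegral_enorm_sq_fourier_le (μ := volume.restrict (T.HX e))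
    (T.continuous_sigv e).measurable hφm
    (fun h => mul_nonneg (Real.exp_pos _).le (T.chi_nonneg e _ _))
    (T.integrableOn_exp_sig e (T.ell_lt_top e hs2 hY)) hwm hw0 hpush
  have hlap : ∀ X : Fin n → ℝ,
      T.lap e (fun j => s j / 2) (fun k => (Y k : ℂ) + Complex.I * X k) =
      ∫ h in T.HX e, Complex.exp (-(Complex.I * ∑ k, (T.sigv e h k : ℂ) * X k)) * (φ h : ℂ) := by
    intro X
    rw [lap]
    congr 1; funext h
    have h1 : T.sigC e h (fun k => (Y k : ℂ) + Complex.I * X k) =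
        (T.sig e h Y : ℂ) + Complex.I * ∑ k, (T.sigv e h k : ℂ) * X k := by
      rw [← sigC_ofReal, sigC_apply, sigC_apply, Finset.mul_sum, ← Finset.sum_add_distrib]
      exact Finset.sum_congr rfl fun k _ => by ring
    rw [h1, neg_add, Complex.exp_add]
    simp only [hφ, hb]
    push_cast; ring
  have hell : ∫⁻ h in T.HX e, ENNReal.ofReal (φ h ^ 2 / w h) =
      ENNReal.ofReal δ⁻¹ * T.ell e (fun j => s j - T.tau j) ((2 : ℝ) • Y) := by
    rw [ell, ← lintegral_const_mul' _ _ ENNReal.ofReal_ne_top]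
    refine setLIntegral_congr_fun (T.measurableSet_HX e) fun h hh => ?_
    rw [← ENNReal.ofReal_mul (by positivity)]
    congr 1
    simp only [hφ, hw, map_smul, smul_eq_mul]
    have h1 : T.chi e (fun j => s j - T.tau j - (1 + T.nDim j) / 2) h =
        T.chi e b h * T.chi e b h / T.chi e (fun j => (1 + T.mDim j) / 2) h := by
      rw [← T.chi_add e _ _ hh, div_eq_mul_inv, ← T.chi_neg e _ hh, ← T.chi_add e _ _ hh]
      congr 1; funext j; simp only [hb, Pi.add_apply, Pi.neg_apply, tau]; ring
    rw [h1, show -(2 * T.sig e h Y) = -T.sig e h Y + -T.sig e h Y by ring, Real.exp_add]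
    have := (T.chi_pos e (fun j => (1 + T.mDim j) / 2) hh).ne'
    field_simp
  calc ∫⁻ X : Fin n → ℝ, ‖T.lap e s (fun k => (Y k : ℂ) + Complex.I * X k)‖ₑ
      = ∫⁻ X : Fin n → ℝ, ‖κ‖ₑ * ‖∫ h in T.HX e, Complex.exp
          (-(Complex.I * ∑ k, (T.sigv e h k : ℂ) * X k)) * (φ h : ℂ)‖ₑ ^ 2 := by
        refine lintegral_congr fun X => ?_
        rw [hκ Y X hY, hlap, enorm_mul, enorm_pow]
    _ = ‖κ‖ₑ * ∫⁻ X : Fin n → ℝ, ‖∫ h in T.HX e, Complex.exp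
          (-(Complex.I * ∑ k, (T.sigv e h k : ℂ) * X k)) * (φ h : ℂ)‖ₑ ^ 2 :=
        lintegral_const_mul' _ _ (by simp)
    _ ≤ ‖κ‖ₑ * (ENNReal.ofReal ((2 * Real.pi) ^ n) *
          (ENNReal.ofReal δ⁻¹ * T.ell e (fun j => s j - T.tau j) ((2 : ℝ) • Y))) := by
        rw [← hell]; gcongr
    _ = _ := by ring

end TAlgebra

end

noncomputable section

/-! ### Hermitian matrices -/

open scoped Matrix in
theorem Matrix.IsHermitian.det_one_add_smul {m : ℕ} {S : Matrix (Fin m) (Fin m) ℂ}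
    (hS : S.IsHermitian) (x : ℂ) : (1 + x • S).det = ∏ i, (1 + x * (hS.eigenvalues i : ℂ)) := by
  set W : Matrix (Fin m) (Fin m) ℂ := (hS.eigenvectorUnitary : Matrix (Fin m) (Fin m) ℂ) with hW
  have hWW : W * star W = 1 := Unitary.coe_mul_star_self hS.eigenvectorUnitary
  have h1 : S = W * Matrix.diagonal (fun i => (hS.eigenvalues i : ℂ)) * star W := by
    have := hS.spectral_theorem
    rw [Unitary.conjStarAlgAut_apply] at this
    exact this
  have h2 : 1 + x • S =
      W * Matrix.diagonal (fun i => 1 + x * (hS.eigenvalues i : ℂ)) * star W := by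
    have h3 : Matrix.diagonal (fun i => 1 + x * (hS.eigenvalues i : ℂ)) =
        1 + x • Matrix.diagonal (fun i => (hS.eigenvalues i : ℂ)) := by
      rw [← Matrix.diagonal_one, ← Matrix.diagonal_smul, Matrix.diagonal_add]
      rfl
    rw [h3, mul_add, add_mul, mul_one, hWW, Matrix.mul_smul, Matrix.smul_mul, ← h1]
  rw [h2, Matrix.det_mul, Matrix.det_mul, Matrix.det_diagonal, mul_right_comm, ← Matrix.det_mul,
    hWW, Matrix.det_one, one_mul]

open scoped Matrix ComplexOrder MatrixOrder in
/-- If `s ↦ det (M + (s - 1) N)` is multiplicative up to normalization, with `M` positive definite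
and `N` Hermitian, it is `s ^ rank N` up to normalization: the nonzero eigenvalues of `N` relative
to `M` have to be `1`. -/
theorem Matrix.PosDef.det_add_smul_of_mul {m : ℕ} {M N : Matrix (Fin m) (Fin m) ℂ}
    (hM : M.PosDef) (hN : N.IsHermitian)
    (hne : ∀ s : ℝ, 0 < s → (M + ((s - 1 : ℝ) : ℂ) • N).det ≠ 0)
    (hmul : ∀ s t : ℝ, 0 < s → 0 < t → (M + ((s * t - 1 : ℝ) : ℂ) • N).det * M.det =
      (M + ((s - 1 : ℝ) : ℂ) • N).det * (M + ((t - 1 : ℝ) : ℂ) • N).det)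
    {s : ℝ} (hs : 0 < s) :
    (M + ((s - 1 : ℝ) : ℂ) • N).det = (s : ℂ) ^ N.rank * M.det := by
  -- with `M = B⋆ B` the determinant is a polynomial `P` with roots given by the eigenvalues of `S`
  obtain ⟨B, hB⟩ := CStarAlgebra.nonneg_iff_eq_star_mul_self.1
    (Matrix.nonneg_iff_posSemidef.2 hM.posSemidef)
  have hMd : M.det ≠ 0 := hM.det_pos.ne'
  have hBd : IsUnit B.det := by
    refine isUnit_iff_ne_zero.2 fun h0 => hMd ?_
    rw [hB, Matrix.det_mul, h0, mul_zero]
  have hBd' : IsUnit (star B).det := by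
    rw [Matrix.star_eq_conjTranspose, Matrix.det_conjTranspose]; exact hBd.star
  set S : Matrix (Fin m) (Fin m) ℂ := (B⁻¹)ᴴ * N * B⁻¹ with hSdef
  have hS : S.IsHermitian := Matrix.isHermitian_conjTranspose_mul_mul _ hN
  have hNS : N = star B * S * B := by
    have h1 : star B * (B⁻¹)ᴴ = 1 := by
      rw [Matrix.star_eq_conjTranspose, ← Matrix.conjTranspose_mul, Matrix.nonsing_inv_mul _ hBd,
        Matrix.conjTranspose_one]
    have h2 : B⁻¹ * B = 1 := Matrix.nonsing_inv_mul _ hBd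
    rw [hSdef, show star B * ((B⁻¹)ᴴ * N * B⁻¹) * B = (star B * (B⁻¹)ᴴ) * N * (B⁻¹ * B) by
      simp only [mul_assoc], h1, h2, one_mul, mul_one]
  have hrank : N.rank = S.rank := by
    rw [hNS, Matrix.rank_mul_eq_left_of_isUnit_det _ _ hBd,
      Matrix.rank_mul_eq_right_of_isUnit_det _ _ hBd']
  set l := hS.eigenvalues with hl
  have hdet : ∀ x : ℝ, (M + ((x - 1 : ℝ) : ℂ) • N).det =
      M.det * ((∏ i, (1 + (x - 1) * l i) : ℝ) : ℂ) := by
    intro x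
    have h1 : M + ((x - 1 : ℝ) : ℂ) • N = star B * (1 + ((x - 1 : ℝ) : ℂ) • S) * B := by
      rw [mul_add, add_mul, mul_one, ← hB, Matrix.mul_smul, Matrix.smul_mul, ← hNS]
    rw [h1, Matrix.det_mul, Matrix.det_mul, hS.det_one_add_smul, hB, Matrix.det_mul]
    push_cast
    ring
  set P : ℝ → ℝ := fun x => ∏ i, (1 + (x - 1) * l i) with hP
  have hP0 : ∀ x, 0 < x → P x ≠ 0 := by
    intro x hx h0
    refine hne x hx ?_
    rw [hdet]; simp only [hP] at h0; rw [h0]; simp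
  have hPm : ∀ x y, 0 < x → 0 < y → P (x * y) = P x * P y := by
    intro x y hx hy
    have h1 := hmul x y hx hy
    rw [hdet, hdet, hdet] at h1
    have h2 : (M.det * M.det) * ((P (x * y) : ℝ) : ℂ) = (M.det * M.det) * ((P x * P y : ℝ) : ℂ) := by
      rw [Complex.ofReal_mul]
      linear_combination h1
    exact_mod_cast mul_left_cancel₀ (mul_ne_zero hMd hMd) h2
  -- the degree of the multiplicative function `P` is the number of nonzero eigenvalues
  have hlim : Filter.Tendsto (fun x : ℝ => P (s * x) / P x) Filter.atTop
      (nhds (∏ i, if l i ≠ 0 then s else 1)) := by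
    simp only [hP, ← Finset.prod_div_distrib]
    refine tendsto_finsetProd _ fun i _ => ?_
    split_ifs with hi
    · have h1 : Filter.Tendsto (fun x : ℝ => (1 - l i) / x) Filter.atTop (nhds 0) :=
        tendsto_const_nhds.div_atTop Filter.tendsto_id
      have h2 : Filter.Tendsto (fun x : ℝ => ((1 - l i) / x + s * l i) / ((1 - l i) / x + l i))
          Filter.atTop (nhds ((0 + s * l i) / (0 + l i))) :=
        (h1.add_const _).div (h1.add_const _) (by simpa using hi)
      rw [zero_add, zero_add, mul_div_cancel_right₀ _ hi] at h2
      refine h2.congr' ?_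
      filter_upwards [Filter.eventually_gt_atTop 0] with x hx
      have e1 : (1 + (s * x - 1) * l i) = ((1 - l i) / x + s * l i) * x := by field_simp; ring
      have e2 : (1 + (x - 1) * l i) = ((1 - l i) / x + l i) * x := by field_simp; ring
      rw [e1, e2, mul_div_mul_right _ _ hx.ne']
    · rw [not_not] at hi
      simp [hi]
  have hconst : Filter.Tendsto (fun x : ℝ => P (s * x) / P x) Filter.atTop (nhds (P s)) := by
    refine tendsto_const_nhds.congr' ?_
    filter_upwards [Filter.eventually_gt_atTop 0] with x hx
    rw [hPm s x hs hx, mul_div_cancel_right₀ _ (hP0 x hx)]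
  have hPs : P s = s ^ N.rank := by
    rw [tendsto_nhds_unique hconst hlim, hrank, hS.rank_eq_card_non_zero_eigs,
      Finset.prod_ite, Finset.prod_const, Finset.prod_const_one, mul_one, Fintype.card_subtype]
  rw [hdet]
  change M.det * ((P s : ℝ) : ℂ) = _
  rw [hPs]; push_cast; ring

/-- A sesquilinear form is determined by its values on the diagonal. -/
theorem Matrix.eq_of_dotProduct_mulVec_star {m : ℕ} {A B : Matrix (Fin m) (Fin m) ℂ}
    (h : ∀ u : Fin m → ℂ, u ⬝ᵥ A.mulVec (star u) = u ⬝ᵥ B.mulVec (star u)) : A = B := by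
  have h0 : ∀ u : Fin m → ℂ, u ⬝ᵥ (A - B).mulVec (star u) = 0 := fun u => by
    rw [Matrix.sub_mulVec, dotProduct_sub, h, sub_self]
  rw [← sub_eq_zero]
  set C := A - B
  have key : ∀ u v : Fin m → ℂ, u ⬝ᵥ C.mulVec (star v) = 0 := by
    intro u v
    have h1 := h0 (u + v)
    have h2 := h0 (u + Complex.I • v)
    rw [star_add, Matrix.mulVec_add, dotProduct_add, add_dotProduct, add_dotProduct, h0, h0] at h1
    rw [star_add, Matrix.mulVec_add, dotProduct_add, add_dotProduct, add_dotProduct, star_smul,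
      Matrix.mulVec_smul, dotProduct_smul, dotProduct_smul, smul_dotProduct, smul_dotProduct,
      h0, h0] at h2
    simp only [smul_eq_mul, RCLike.star_def, Complex.conj_I] at h2
    have h3 : Complex.I * (v ⬝ᵥ C.mulVec (star u) - u ⬝ᵥ C.mulVec (star v)) = 0 := by
      linear_combination h2
    have h4 := (mul_eq_zero.1 h3).resolve_left Complex.I_ne_zero
    linear_combination (1 / 2 : ℂ) * h1 - (1 / 2 : ℂ) * h4
  ext i j
  have := key (Pi.single i 1) (Pi.single j 1)
  have hst : star (Pi.single j (1 : ℂ) : Fin m → ℂ) = Pi.single j 1 := by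
    rw [← Pi.single_star, star_one]
  rw [hst] at this
  simpa using this

theorem det_mulVecLin_restrictScalars {m : ℕ} (g : Matrix (Fin m) (Fin m) ℂ) :
    LinearMap.det (g.toLin'.restrictScalars ℝ) = ‖g.det‖ ^ 2 := by
  have h := LinearMap.det_restrictScalars (R := ℝ) (f := g.toLin')
  rw [Algebra.norm_complex_apply, LinearMap.det_toLin', Complex.normSq_eq_norm_sq] at h
  exact h

end

noncomputable section

/-! ### Sesquilinear maps and homogeneous Hermitian forms -/

section Sesq

variable {n m : ℕ} (M : Fin n → Matrix (Fin m) (Fin m) ℂ)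

theorem sesq_add_left (u u' v : Fin m → ℂ) : sesq M (u + u') v = sesq M u v + sesq M u' v := by
  funext k; simp [sesq, add_dotProduct]

theorem sesq_add_right (u v v' : Fin m → ℂ) : sesq M u (v + v') = sesq M u v + sesq M u v' := by
  funext k; simp [sesq, Matrix.mulVec_add, dotProduct_add]

theorem sesq_smul_left (c : ℂ) (u v : Fin m → ℂ) : sesq M (c • u) v = c • sesq M u v := by
  funext k; simp [sesq]

theorem sesq_smul_right (c : ℂ) (u v : Fin m → ℂ) : sesq M u (c • v) = conj c • sesq M u v := by
  funext k; simp [sesq, Matrix.mulVec_smul]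

variable {M}

theorem sesq_conj (hM : ∀ k, (M k).IsHermitian) (u v : Fin m → ℂ) (k : Fin n) :
    conj (sesq M u v k) = sesq M v u k := by
  rw [sesq, sesq, ← RCLike.star_def, ← Matrix.star_dotProduct_star, Matrix.star_mulVec,
    star_star, (hM k).eq, Matrix.dotProduct_mulVec]

theorem sesq_self (hM : ∀ k, (M k).IsHermitian) (u : Fin m → ℂ) (k : Fin n) :
    sesq M u u k = (sesqDiag M u k : ℂ) :=
  (Complex.conj_eq_iff_re.1 (sesq_conj hM u u k)).symm

theorem sesqDiag_add (hM : ∀ k, (M k).IsHermitian) (u v : Fin m → ℂ) (k : Fin n) :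
    sesqDiag M (u + v) k = sesqDiag M u k + sesqDiag M v k + 2 * (sesq M u v k).re := by
  simp only [sesqDiag, sesq_add_left, sesq_add_right, Pi.add_apply, Complex.add_re,
    ← sesq_conj hM u v, Complex.conj_re]
  ring

theorem sesqDiag_neg (u : Fin m → ℂ) : sesqDiag M (-u) = sesqDiag M u := by
  funext k; simp [sesqDiag, sesq, Matrix.mulVec_neg]

theorem sesqDiag_sub (hM : ∀ k, (M k).IsHermitian) (u v : Fin m → ℂ) (k : Fin n) :
    sesqDiag M (u - v) k = sesqDiag M u k + sesqDiag M v k - 2 * (sesq M u v k).re := by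
  rw [sub_eq_add_neg, sesqDiag_add hM, sesqDiag_neg, ← neg_one_smul ℂ v, sesq_smul_right]
  simp
  ring

theorem sesqDiag_smul (t : ℝ) (u : Fin m → ℂ) : sesqDiag M (t • u) = t ^ 2 • sesqDiag M u := by
  have : (t • u) = (t : ℂ) • u := by funext i; simp
  funext k
  rw [this]
  simp only [sesqDiag, sesq_smul_left, sesq_smul_right, Complex.conj_ofReal, Pi.smul_apply,
    smul_eq_mul, Complex.re_ofReal_mul]
  ring

theorem sesqDiag_zero : sesqDiag M 0 = 0 := by
  funext k; simp [sesqDiag, sesq]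

theorem continuous_sesq : Continuous fun p : (Fin m → ℂ) × (Fin m → ℂ) => sesq M p.1 p.2 := by
  refine continuous_pi fun k => ?_
  simp only [sesq, dotProduct, Matrix.mulVec, Pi.star_apply]
  fun_prop

theorem continuous_sesqDiag : Continuous (sesqDiag M) := by
  refine continuous_pi fun k => ?_
  have h : Continuous fun u => sesq M u u := continuous_sesq.comp (continuous_id.prodMk continuous_id)
  exact Complex.continuous_re.comp ((continuous_apply k).comp h)

end Sesq

namespace TAlgebra

variable {r n : ℕ} {U : Type*} [NonUnitalNonAssocRing U] [Module ℝ U]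
  [IsScalarTower ℝ U U] [SMulCommClass ℝ U U] [StarRing U] [StarModule ℝ U]
  (T : TAlgebra r U) (e : Module.Basis (Fin n) ℝ (selfAdjoint.submodule ℝ U))
  [FiniteDimensional ℝ U]

theorem continuous_sig_uncurry {A : Type*} [TopologicalSpace A] {y : A → Fin n → ℝ}
    (hy : Continuous y) : Continuous fun p : A × (Fin n → ℝ) => T.sig e p.2 (y p.1) := by
  simp_rw [sig_eq_sum]
  have := T.continuous_sigv e
  fun_prop

theorem measurable_Qpow (a : Fin r → ℝ) : Measurable fun y => T.Qpow a (point e y) := by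
  classical
  have h := (T.continuousOn_Qpow e a).measurable_piecewise
    (continuousOn_const (c := ∏ j, (0 : ℝ) ^ a j)) (T.measurableSet_Omega e)
  convert h using 1
  funext y
  by_cases hy : y ∈ T.Omega e
  · rw [Set.piecewise_eq_of_mem _ _ _ hy]
  · rw [Set.piecewise_eq_of_notMem _ _ _ hy, Qpow]
    refine Finset.prod_congr rfl fun j _ => ?_
    rw [Q, dif_neg (show ¬ ∃ t ∈ T.H, t * star t = point e y from hy)]

theorem lintegral_ell_add {a : Fin r → ℝ} (ha : ∀ j, (T.mDim j : ℝ) / 2 < a j)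
    (s : Fin r → ℝ) (y : Fin n → ℝ) :
    ∫⁻ y' in T.Omega e, T.ell e s (y + y') *
        ENNReal.ofReal (T.Qpow (fun j => a j - T.tau j) (point e y')) =
      T.gam e a * T.ell e (fun j => s j - a j) y := by
  have hm : Measurable (Function.uncurry fun (y' : Fin n → ℝ) (h : Fin n → ℝ) => ENNReal.ofReal
      (Real.exp (-T.sig e h (y + y')) * T.chi e (fun j => s j - (1 + T.nDim j) / 2) h) *
        ENNReal.ofReal (T.Qpow (fun j => a j - T.tau j) (point e y'))) := by
    have h1 : Continuous fun p : (Fin n → ℝ) × (Fin n → ℝ) => T.sig e p.2 (y + p.1) :=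
      T.continuous_sig_uncurry e (y := fun x => y + x) (by fun_prop)
    exact (((Real.measurable_exp.comp h1.measurable.neg).mul
      ((T.measurable_chi e _).comp measurable_snd)).ennreal_ofReal).mul
      ((T.measurable_Qpow e _).comp measurable_fst).ennreal_ofReal
  simp only [ell]
  have h2 : ∀ y', (∫⁻ h in T.HX e, ENNReal.ofReal
      (Real.exp (-T.sig e h (y + y')) * T.chi e (fun j => s j - (1 + T.nDim j) / 2) h)) *
        ENNReal.ofReal (T.Qpow (fun j => a j - T.tau j) (point e y')) =
      ∫⁻ h in T.HX e, ENNReal.ofReal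
      (Real.exp (-T.sig e h (y + y')) * T.chi e (fun j => s j - (1 + T.nDim j) / 2) h) *
        ENNReal.ofReal (T.Qpow (fun j => a j - T.tau j) (point e y')) := fun y' =>
    (lintegral_mul_const' _ _ ENNReal.ofReal_ne_top).symm
  simp only [h2]
  rw [lintegral_lintegral_swap hm.aemeasurable, ← lintegral_const_mul' _ _ (T.gam_lt_top e ha).ne]
  refine setLIntegral_congr_fun (T.measurableSet_HX e) fun h hh => ?_
  have h3 : ∀ y', ENNReal.ofReal
      (Real.exp (-T.sig e h (y + y')) * T.chi e (fun j => s j - (1 + T.nDim j) / 2) h) *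
        ENNReal.ofReal (T.Qpow (fun j => a j - T.tau j) (point e y')) =
      ENNReal.ofReal (Real.exp (-T.sig e h y) * T.chi e (fun j => s j - (1 + T.nDim j) / 2) h) *
        ENNReal.ofReal (Real.exp (-T.sig e h y') *
          T.Qpow (fun j => a j - T.tau j) (point e y')) := by
    intro y'
    have h4 := mul_nonneg (Real.exp_pos (-T.sig e h y)).le
      (T.chi_nonneg e (fun j => s j - (1 + T.nDim j) / 2) h)
    rw [← ENNReal.ofReal_mul h4, map_add, neg_add, Real.exp_add, ← ENNReal.ofReal_mul (by
      have := T.chi_nonneg e (fun j => s j - (1 + T.nDim j) / 2) h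
      positivity)]
    ring_nf
  simp only [h3]
  rw [lintegral_const_mul' _ _ ENNReal.ofReal_ne_top, T.lintegral_Omega_exp_sig e a hh,
    ← mul_assoc, ← ENNReal.ofReal_mul (mul_nonneg (Real.exp_pos _).le (T.chi_nonneg e _ _)),
    mul_comm, mul_assoc, ← T.chi_add e _ _ hh]
  congr 4
  funext j; simp only [Pi.add_apply, Pi.neg_apply]; ring

end TAlgebra

namespace HermitianForm

variable {r n m : ℕ} {U : Type*} [NonUnitalNonAssocRing U] [Module ℝ U]
  [IsScalarTower ℝ U U] [SMulCommClass ℝ U U] [StarRing U] [StarModule ℝ U]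
  {T : TAlgebra r U} {e : Module.Basis (Fin n) ℝ (selfAdjoint.submodule ℝ U)}
variable (F : HermitianForm T e m)

theorem sesqDiag_ne_zero {u : Fin m → ℂ} (hu : u ≠ 0) : sesqDiag F.mat u ≠ 0 := by
  intro h
  refine hu ((F.definite u).1 ?_)
  funext k
  rw [sesq_self F.hermitian, h]; simp

/-- The matrix of the Hermitian form `⟨sig h, F(·,·)⟩`. -/
def pairing (h : Fin n → ℝ) : Matrix (Fin m) (Fin m) ℂ := ∑ k, (T.sigv e h k : ℂ) • F.mat k

theorem dotProduct_pairing (h : Fin n → ℝ) (u v : Fin m → ℂ) :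
    u ⬝ᵥ (F.pairing h).mulVec (star v) = T.sigC e h (sesq F.mat u v) := by
  rw [pairing, Matrix.sum_mulVec, dotProduct_sum, TAlgebra.sigC_apply]
  exact Finset.sum_congr rfl fun k _ => by rw [Matrix.smul_mulVec, dotProduct_smul, smul_eq_mul]; rfl

variable [FiniteDimensional ℝ U]

theorem exists_equivariant {h : Fin n → ℝ} (hh : h ∈ T.HX e) :
    ∃ g : Matrix (Fin m) (Fin m) ℂ, IsUnit g.det ∧
      ∀ u, T.pi e h (sesqDiag F.mat u) = sesqDiag F.mat (g.mulVec u) := by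
  obtain ⟨g, hg⟩ := F.homogeneous (T.tri e h) ((T.tri_mem_H e).2 hh)
  refine ⟨g, (Matrix.isUnit_iff_isUnit_det _).1 g.isUnit, fun u => ?_⟩
  refine TAlgebra.pointLin_injective e ?_
  rw [TAlgebra.pointLin_pi, TAlgebra.pointLin_apply]
  exact hg u

theorem trX_sesqDiag_pos {u : Fin m → ℂ} (hu : u ≠ 0) : 0 < T.trX e (sesqDiag F.mat u) :=
  (T.trX_nonneg_of_mem_closure e (F.mem_closure u)).lt_of_ne fun h =>
    F.sesqDiag_ne_zero hu (T.eq_zero_of_mem_closure e (F.mem_closure u) h.symm)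

theorem dotProduct_pairing_self (h : Fin n → ℝ) (u : Fin m → ℂ) :
    u ⬝ᵥ (F.pairing h).mulVec (star u) = (T.sig e h (sesqDiag F.mat u) : ℂ) := by
  rw [dotProduct_pairing, ← TAlgebra.sigC_ofReal]
  congr 1; funext k; exact sesq_self F.hermitian u k

theorem isHermitian_pairing (h : Fin n → ℝ) : (F.pairing h).IsHermitian := by
  rw [Matrix.IsHermitian, pairing, Matrix.conjTranspose_sum]
  refine Finset.sum_congr rfl fun k _ => ?_
  rw [Matrix.conjTranspose_smul, (F.hermitian k).eq]
  simp

open scoped ComplexOrder in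
theorem posDef_pairing_xone : (F.pairing (T.xone e)).PosDef := by
  refine Matrix.PosDef.of_dotProduct_mulVec_pos (F.isHermitian_pairing _) fun u hu => ?_
  have h1 := F.dotProduct_pairing_self (T.xone e) (star u)
  rw [star_star] at h1
  rw [h1, T.sig_xone]
  exact_mod_cast F.trX_sesqDiag_pos (star_ne_zero.2 hu)

theorem pairing_eq {h : Fin n → ℝ} {g : Matrix (Fin m) (Fin m) ℂ}
    (hg : ∀ u, T.pi e h (sesqDiag F.mat u) = sesqDiag F.mat (g.mulVec u)) :
    F.pairing h = g.transpose * F.pairing (T.xone e) * g.map conj := by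
  refine Matrix.eq_of_dotProduct_mulVec_star fun u => ?_
  have h1 : (g.map conj).mulVec (star u) = star (g.mulVec u) := by
    funext i; simp [Matrix.mulVec, dotProduct]
  rw [← Matrix.mulVec_mulVec, h1, ← Matrix.mulVec_mulVec, Matrix.dotProduct_mulVec u g.transpose,
    Matrix.vecMul_transpose, dotProduct_pairing_self, dotProduct_pairing_self, T.sig_xone,
    T.sig_apply, hg]

theorem det_pairing {h : Fin n → ℝ} {g : Matrix (Fin m) (Fin m) ℂ}
    (hg : ∀ u, T.pi e h (sesqDiag F.mat u) = sesqDiag F.mat (g.mulVec u)) :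
    (F.pairing h).det = ((‖g.det‖ ^ 2 : ℝ) : ℂ) * (F.pairing (T.xone e)).det := by
  rw [F.pairing_eq hg, Matrix.det_mul, Matrix.det_mul, Matrix.det_transpose]
  have h1 : (g.map conj).det = conj g.det := (RingHom.map_det (starRingEnd ℂ) g).symm
  have h2 : g.det * conj g.det = ((‖g.det‖ ^ 2 : ℝ) : ℂ) := by
    rw [Complex.mul_conj, Complex.normSq_eq_norm_sq]
  rw [h1, ← h2]; ring

open scoped ComplexOrder in
theorem det_pairing_xone_ne_zero : (F.pairing (T.xone e)).det ≠ 0 :=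
  F.posDef_pairing_xone.det_pos.ne'

/-- The normalized determinant of the form `⟨sig h, F⟩`; it is the square of `|det g|` for every
`g` that implements `h`. -/
def detChar (h : Fin n → ℝ) : ℝ := ((F.pairing h).det / (F.pairing (T.xone e)).det).re

theorem detChar_eq {h : Fin n → ℝ} {g : Matrix (Fin m) (Fin m) ℂ}
    (hg : ∀ u, T.pi e h (sesqDiag F.mat u) = sesqDiag F.mat (g.mulVec u)) :
    F.detChar h = ‖g.det‖ ^ 2 := by
  rw [detChar, F.det_pairing hg, mul_div_cancel_right₀ _ F.det_pairing_xone_ne_zero,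
    Complex.ofReal_re]

theorem det_pairing_eq_detChar {h : Fin n → ℝ} (hh : h ∈ T.HX e) :
    (F.pairing h).det = (F.detChar h : ℂ) * (F.pairing (T.xone e)).det := by
  obtain ⟨g, -, hg⟩ := F.exists_equivariant hh
  rw [F.det_pairing hg, F.detChar_eq hg]

theorem detChar_pos {h : Fin n → ℝ} (hh : h ∈ T.HX e) : 0 < F.detChar h := by
  obtain ⟨g, hu, hg⟩ := F.exists_equivariant hh
  rw [F.detChar_eq hg]
  exact pow_pos (norm_pos_iff.2 hu.ne_zero) 2

theorem detChar_xmul {h k : Fin n → ℝ} (hh : h ∈ T.HX e) (hk : k ∈ T.HX e) :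
    F.detChar (T.xmul e h k) = F.detChar h * F.detChar k := by
  obtain ⟨g, -, hg⟩ := F.exists_equivariant hh
  obtain ⟨g', -, hg'⟩ := F.exists_equivariant hk
  have h1 : ∀ u, T.pi e (T.xmul e h k) (sesqDiag F.mat u) =
      sesqDiag F.mat ((g * g').mulVec u) := by
    intro u
    rw [T.pi_xmul, LinearMap.comp_apply, hg', hg, Matrix.mulVec_mulVec]
  rw [F.detChar_eq h1, F.detChar_eq hg, F.detChar_eq hg', Matrix.det_mul, norm_mul, mul_pow]

theorem continuous_detChar : Continuous F.detChar := by
  have h1 : Continuous F.pairing := by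
    unfold pairing
    have := T.continuous_sigv e
    fun_prop
  unfold detChar
  exact Complex.continuous_re.comp ((h1.matrix_det).div_const _)

/-- The matrix of the form `F_jj`. -/
def diagMat (j : Fin r) : Matrix (Fin m) (Fin m) ℂ :=
  ∑ k, ((T.rho j (e k : U) : ℝ) : ℂ) • F.mat k

theorem isHermitian_diagMat (j : Fin r) : (F.diagMat j).IsHermitian := by
  rw [Matrix.IsHermitian, diagMat, Matrix.conjTranspose_sum]
  refine Finset.sum_congr rfl fun k _ => ?_
  rw [Matrix.conjTranspose_smul, (F.hermitian k).eq]
  simp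

theorem _root_.TAlgebra.sig_diagX (d : Fin r → ℝ) (y : Fin n → ℝ) :
    T.sig e (T.diagX e d) y = ∑ j, d j ^ 2 * T.rho j (TAlgebra.pointLin e y) := by
  have h3 : T.tri e (T.diagX e d) * T.tri e (T.diagX e d) = ∑ i, (d * d) i • T.c i := by
    rw [← T.tri_xmul, T.diagX_xmul_diagX, T.tri_diagX]
  have h4 : star (T.tri e (T.diagX e d)) = T.tri e (T.diagX e d) := by
    rw [T.tri_diagX]; simp [star_sum, star_smul, T.star_c]
  have h5 : T.tr ∘ₗ LinearMap.mulLeft ℝ (∑ i, (d * d) i • T.c i) =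
      ∑ j, (d j ^ 2) • T.rho j := by
    refine T.linearMap_ext fun i j x hx => ?_
    rw [LinearMap.comp_apply, LinearMap.mulLeft_apply, T.diag_mul_of_mem _ hx, map_smul,
      T.tr_apply, smul_eq_mul, Finset.mul_sum, LinearMap.sum_apply]
    refine Finset.sum_congr rfl fun k _ => ?_
    rw [LinearMap.smul_apply, smul_eq_mul, Pi.mul_apply, sq]
    rcases eq_or_ne k i with rfl | hk
    · rfl
    · rw [T.rho_comp k i j x (fun h => hk (Prod.mk.inj h).1.symm) hx, mul_zero, mul_zero]
  have h6 := LinearMap.congr_fun h5 (TAlgebra.pointLin e y)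
  rw [LinearMap.comp_apply, LinearMap.mulLeft_apply, LinearMap.sum_apply] at h6
  rw [T.sig_eq_sig₂, T.sig₂_apply, h4, h3, h6]
  rfl

theorem pairing_diagX (d : Fin r → ℝ) :
    F.pairing (T.diagX e d) = ∑ j, ((d j ^ 2 : ℝ) : ℂ) • F.diagMat j := by
  have h1 : ∀ k, T.sigv e (T.diagX e d) k = ∑ j, d j ^ 2 * T.rho j (e k : U) := by
    intro k
    have : T.sigv e (T.diagX e d) k = T.sig e (T.diagX e d) (Pi.single k 1) := rfl
    rw [this, TAlgebra.sig_diagX]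
    refine Finset.sum_congr rfl fun j _ => ?_
    congr 2
    rw [TAlgebra.pointLin_apply, TAlgebra.point, Finset.sum_eq_single k]
    · simp
    · intro l _ hl; simp [hl]
    · simp
  simp only [pairing, diagMat, Finset.smul_sum]
  rw [Finset.sum_comm]
  refine Finset.sum_congr rfl fun k _ => ?_
  rw [h1, Complex.ofReal_sum, Finset.sum_smul]
  refine Finset.sum_congr rfl fun j _ => ?_
  rw [smul_smul, Complex.ofReal_mul]

/-- Scaling the `j`-th diagonal entry by `t` replaces the form `⟨sig 1, F⟩` by
`⟨sig 1, F⟩ + (t² - 1) F_jj`, so that the rank of `F_jj` appears as the exponent. -/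
theorem detChar_diagX_update {j : Fin r} {t : ℝ} (ht : 0 < t) :
    F.detChar (T.diagX e (Function.update 1 j t)) = (t ^ 2) ^ F.b j := by
  classical
  have hpos : ∀ t : ℝ, 0 < t → T.diagX e (Function.update 1 j t) ∈ T.HX e := by
    intro t ht
    refine T.diagX_mem_HX e fun i => ?_
    rcases eq_or_ne i j with rfl | h
    · simpa using ht
    · simp [Function.update_of_ne h]
  have hpair : ∀ t : ℝ, F.pairing (T.diagX e (Function.update 1 j t)) =
      F.pairing (T.xone e) + ((t ^ 2 - 1 : ℝ) : ℂ) • F.diagMat j := by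
    intro t
    rw [← T.diagX_one, pairing_diagX, pairing_diagX, ← Finset.add_sum_erase _ _ (Finset.mem_univ j),
      ← Finset.add_sum_erase Finset.univ _ (Finset.mem_univ j)]
    have : ∑ x ∈ Finset.univ.erase j,
        ((Function.update (1 : Fin r → ℝ) j t x ^ 2 : ℝ) : ℂ) • F.diagMat x =
        ∑ x ∈ Finset.univ.erase j, (((1 : Fin r → ℝ) x ^ 2 : ℝ) : ℂ) • F.diagMat x := by
      refine Finset.sum_congr rfl fun x hx => ?_
      rw [Function.update_of_ne (Finset.ne_of_mem_erase hx)]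
    rw [this, Function.update_self, add_right_comm, ← add_smul]
    congr 2
    simp
  have hsq : ∀ s : ℝ, 0 < s → F.pairing (T.xone e) + ((s - 1 : ℝ) : ℂ) • F.diagMat j =
      F.pairing (T.diagX e (Function.update 1 j √s)) := by
    intro s hs
    rw [hpair, Real.sq_sqrt hs.le]
  have hdet : ∀ s : ℝ, 0 < s → (F.pairing (T.xone e) + ((s - 1 : ℝ) : ℂ) • F.diagMat j).det =
      (F.detChar (T.diagX e (Function.update 1 j √s)) : ℂ) * (F.pairing (T.xone e)).det := by
    intro s hs
    rw [hsq s hs, F.det_pairing_eq_detChar (hpos _ (Real.sqrt_pos.2 hs))]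
  have hmain := F.posDef_pairing_xone.det_add_smul_of_mul (F.isHermitian_diagMat j)
    (fun s hs => ?_) (fun s t hs ht => ?_) (s := t ^ 2) (by positivity)
  · rw [hdet _ (by positivity), Real.sqrt_sq ht.le] at hmain
    have h1 := mul_right_cancel₀ F.det_pairing_xone_ne_zero hmain
    exact_mod_cast h1
  · rw [hdet s hs]
    exact mul_ne_zero (by exact_mod_cast (F.detChar_pos (hpos _ (Real.sqrt_pos.2 hs))).ne')
      F.det_pairing_xone_ne_zero
  · have hup : Function.update (1 : Fin r → ℝ) j √(s * t) =
        (Function.update 1 j √s : Fin r → ℝ) * (Function.update 1 j √t : Fin r → ℝ) := by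
      funext i
      rcases eq_or_ne i j with rfl | h
      · simp [Real.sqrt_mul hs.le]
      · simp [Function.update_of_ne h]
    rw [hdet _ (mul_pos hs ht), hdet s hs, hdet t ht, hup, ← T.diagX_xmul_diagX,
      F.detChar_xmul (hpos _ (Real.sqrt_pos.2 hs)) (hpos _ (Real.sqrt_pos.2 ht))]
    push_cast; ring

/-- The determinant of the form `⟨sig h, F⟩` is the character with exponent `b`: it is multiplicative,
so it depends on the diagonal entries of `h` only, one at a time. -/
theorem detChar_eq_chi {h : Fin n → ℝ} (hh : h ∈ T.HX e) :
    F.detChar h = T.chi e (fun j => F.b j) h := by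
  classical
  rw [T.char_eq_diagX e F.continuous_detChar (fun a ha b hb => F.detChar_xmul ha hb) hh]
  set d : Fin r → ℝ := fun j => T.dg e j h with hd
  have hd0 : ∀ j, 0 < d j := fun j => hh j
  have key : ∀ s : Finset (Fin r), F.detChar (T.diagX e (fun j => if j ∈ s then d j else 1)) =
      ∏ j ∈ s, (d j ^ 2) ^ F.b j := by
    intro s
    induction s using Finset.induction_on with
    | empty =>
      have h1 : (fun j : Fin r => if j ∈ (∅ : Finset (Fin r)) then d j else 1) = 1 := by
        funext j; simp
      rw [h1, T.diagX_one, Finset.prod_empty, detChar,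
        div_self F.det_pairing_xone_ne_zero, Complex.one_re]
    | insert j s hj ih =>
      have h1 : (fun i : Fin r => if i ∈ insert j s then d i else 1) =
          (Function.update 1 j (d j) : Fin r → ℝ) * fun i => if i ∈ s then d i else 1 := by
        funext i
        rcases eq_or_ne i j with rfl | h
        · simp [hj]
        · simp [h]
      have hm1 : T.diagX e (Function.update 1 j (d j)) ∈ T.HX e := by
        refine T.diagX_mem_HX e fun i => ?_
        rcases eq_or_ne i j with rfl | h
        · simpa using hd0 i
        · simp [Function.update_of_ne h]
      have hm2 : T.diagX e (fun i => if i ∈ s then d i else 1) ∈ T.HX e := by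
        refine T.diagX_mem_HX e fun i => ?_
        split_ifs
        · exact hd0 i
        · exact one_pos
      rw [h1, ← T.diagX_xmul_diagX, F.detChar_xmul hm1 hm2, ih, F.detChar_diagX_update (hd0 j),
        Finset.prod_insert hj]
  have := key Finset.univ
  simp only [Finset.mem_univ, if_true] at this
  rw [this, TAlgebra.chi]
  exact Finset.prod_congr rfl fun j _ => (Real.rpow_natCast _ _).symm

/-- The Gaussian integral of the form. -/
def gauss : ℝ≥0∞ := ∫⁻ u : Fin m → ℂ, ENNReal.ofReal (Real.exp (-T.trX e (sesqDiag F.mat u)))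

theorem gauss_lt_top : F.gauss < ∞ := by
  obtain ⟨c, hc, hcle⟩ := exists_pos_mul_norm_sq_le (q := fun u => T.trX e (sesqDiag F.mat u))
    ((T.continuous_trX e).comp continuous_sesqDiag)
    (fun t u => by rw [sesqDiag_smul, map_smul, smul_eq_mul]) (fun u hu => F.trX_sesqDiag_pos hu)
  set p : ℕ := Module.finrank ℝ (Fin m → ℂ) + 1 with hp
  have hi : Integrable (fun u : Fin m → ℂ => (1 + ‖u‖) ^ (-(p : ℝ))) :=
    integrable_one_add_norm (by rw [hp]; push_cast; linarith)
  obtain ⟨C, hC⟩ : ∃ C : ℝ, ∀ x : ℝ, 0 ≤ x → Real.exp (-(c * x ^ 2)) ≤ C * (1 + x) ^ (-(p : ℝ)) := by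
    refine ⟨p.factorial * Real.exp (1 + 1 / (4 * c)), fun x hx => ?_⟩
    rw [Real.rpow_neg (by positivity), Real.rpow_natCast, ← div_eq_mul_inv,
      le_div_iff₀ (by positivity)]
    have h1 := Real.pow_div_factorial_le_exp (1 + x) (by positivity) p
    rw [div_le_iff₀ (by positivity)] at h1
    have h2 : x - c * x ^ 2 ≤ 1 / (4 * c) := by
      rw [le_div_iff₀ (by positivity)]
      nlinarith [sq_nonneg (2 * c * x - 1)]
    calc Real.exp (-(c * x ^ 2)) * (1 + x) ^ p
        ≤ Real.exp (-(c * x ^ 2)) * (Real.exp (1 + x) * p.factorial) := by gcongr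
      _ = p.factorial * Real.exp (1 + (x - c * x ^ 2)) := by
        rw [mul_comm (Real.exp (1 + x)), mul_left_comm, ← Real.exp_add]
        congr 2; ring
      _ ≤ _ := by gcongr
  refine lt_of_le_of_lt (lintegral_mono fun u => ?_) (hi.const_mul C).lintegral_lt_top
  apply ENNReal.ofReal_le_ofReal
  refine le_trans (Real.exp_le_exp.2 ?_) (hC ‖u‖ (norm_nonneg _))
  linarith [hcle u]

theorem lintegral_exp_sig_sesqDiag {h : Fin n → ℝ} (hh : h ∈ T.HX e) :
    ∫⁻ u : Fin m → ℂ, ENNReal.ofReal (Real.exp (-T.sig e h (sesqDiag F.mat u))) =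
      ENNReal.ofReal (T.chi e (fun j => -(F.b j : ℝ)) h) * F.gauss := by
  obtain ⟨g, hu, hg⟩ := F.exists_equivariant hh
  have h1 := F.detChar_eq hg
  rw [F.detChar_eq_chi hh] at h1
  have h2 := lintegral_comp_linearMap (volume : Measure (Fin m → ℂ)) (g.toLin'.restrictScalars ℝ)
    (by rw [det_mulVecLin_restrictScalars, ← h1]; exact (T.chi_pos e _ hh).ne')
    (fun u => ENNReal.ofReal (Real.exp (-T.trX e (sesqDiag F.mat u))))
  rw [det_mulVecLin_restrictScalars, ← h1, ← T.chi_neg e _ hh,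
    abs_of_pos (T.chi_pos e _ hh)] at h2
  rw [gauss]
  refine Eq.trans ?_ h2
  refine lintegral_congr fun u => ?_
  rw [T.sig_apply, hg]
  rfl

theorem lintegral_ell_add_sesqDiag (s : Fin r → ℝ) (y : Fin n → ℝ) :
    ∫⁻ u : Fin m → ℂ, T.ell e s (y + sesqDiag F.mat u) =
      F.gauss * T.ell e (fun j => s j - F.b j) y := by
  simp only [TAlgebra.ell]
  have hm : Measurable (Function.uncurry fun (u : Fin m → ℂ) (h : Fin n → ℝ) => ENNReal.ofReal
      (Real.exp (-T.sig e h (y + sesqDiag F.mat u)) *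
        T.chi e (fun j => s j - (1 + T.nDim j) / 2) h)) := by
    have h1 : Continuous fun p : (Fin m → ℂ) × (Fin n → ℝ) =>
        T.sig e p.2 (y + sesqDiag F.mat p.1) :=
      T.continuous_sig_uncurry e (y := fun u => y + sesqDiag F.mat u) (by have := continuous_sesqDiag (M := F.mat); fun_prop)
    exact ((Real.measurable_exp.comp h1.measurable.neg).mul
      ((T.measurable_chi e _).comp measurable_snd)).ennreal_ofReal
  rw [lintegral_lintegral_swap hm.aemeasurable, ← lintegral_const_mul' _ _ F.gauss_lt_top.ne]
  refine setLIntegral_congr_fun (T.measurableSet_HX e) fun h hh => ?_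
  have h3 : ∀ u : Fin m → ℂ, ENNReal.ofReal (Real.exp (-T.sig e h (y + sesqDiag F.mat u)) *
        T.chi e (fun j => s j - (1 + T.nDim j) / 2) h) =
      ENNReal.ofReal (Real.exp (-T.sig e h y) * T.chi e (fun j => s j - (1 + T.nDim j) / 2) h) *
        ENNReal.ofReal (Real.exp (-T.sig e h (sesqDiag F.mat u))) := by
    intro u
    rw [← ENNReal.ofReal_mul (mul_nonneg (Real.exp_pos _).le (T.chi_nonneg e _ _)), map_add,
      neg_add, Real.exp_add]
    ring_nf
  simp only [h3]
  rw [lintegral_const_mul' _ _ ENNReal.ofReal_ne_top, F.lintegral_exp_sig_sesqDiag hh, ← mul_assoc,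
    ← ENNReal.ofReal_mul (mul_nonneg (Real.exp_pos _).le (T.chi_nonneg e _ _)), mul_comm,
    mul_assoc, ← T.chi_add e _ _ hh]
  congr 4
  funext j; simp only [Pi.add_apply]; ring

end HermitianForm

end

noncomputable section

/-! ### Separately holomorphic functions -/

/-- A bounded separately holomorphic function of two variables is holomorphic on the diagonal. -/
theorem differentiableAt_diag_of_separately {b : ℂ → ℂ → ℂ} {a₀ : ℂ} {R M : ℝ} (hR : 0 < R)
    (h1 : ∀ η ∈ Metric.ball a₀ R, DifferentiableOn ℂ (fun ζ => b ζ η) (Metric.ball a₀ R))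
    (h2 : ∀ ζ ∈ Metric.ball a₀ R, DifferentiableOn ℂ (b ζ) (Metric.ball a₀ R))
    (hb : ∀ ζ ∈ Metric.ball a₀ R, ∀ η ∈ Metric.ball a₀ R, ‖b ζ η‖ ≤ M) :
    DifferentiableAt ℂ (fun a => b a a) a₀ := by
  have ha₀ : a₀ ∈ Metric.ball a₀ R := Metric.mem_ball_self hR
  have hM : 0 ≤ M := (norm_nonneg _).trans (hb a₀ ha₀ a₀ ha₀)
  set K : ℂ → ℂ → ℂ := fun ζ η => dslope (fun ζ => b ζ η) a₀ ζ with hK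
  -- by the Schwarz lemma, `K` is Lipschitz at `a₀` in its first variable, uniformly in the second
  obtain ⟨C, hC, hKC⟩ : ∃ C : ℝ, 0 ≤ C ∧ ∀ ζ ∈ Metric.ball a₀ R, ∀ η ∈ Metric.ball a₀ R,
      dist (K ζ η) (K a₀ η) ≤ C * dist ζ a₀ := by
    refine ⟨(2 * (2 * M / R)) / R, by positivity, fun ζ hζ η hη => ?_⟩
    have hbd : ∀ ζ ∈ Metric.ball a₀ R, ‖K ζ η‖ ≤ 2 * M / R := by
      intro ζ hζ
      refine Complex.norm_dslope_le_div_of_mapsTo_ball (h1 η hη) (fun ξ hξ => ?_) hζ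
      rw [Metric.mem_closedBall, dist_eq_norm]
      exact (norm_sub_le _ _).trans (by linarith [hb ξ hξ η hη, hb a₀ ha₀ η hη])
    have hKd : DifferentiableOn ℂ (fun ζ => K ζ η) (Metric.ball a₀ R) :=
      (Complex.differentiableOn_dslope (Metric.isOpen_ball.mem_nhds ha₀)).2 (h1 η hη)
    refine Complex.dist_le_div_mul_dist_of_mapsTo_ball hKd (fun ξ hξ => ?_) hζ
    rw [Metric.mem_closedBall, dist_eq_norm]
    exact (norm_sub_le _ _).trans (by linarith [hbd ξ hξ, hbd a₀ ha₀])
  have hKc : Filter.Tendsto (fun a => K a a) (nhds a₀) (nhds (K a₀ a₀)) := by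
    rw [Metric.tendsto_nhds]
    intro ε hε
    -- a point `ξ ≠ a₀` so close to `a₀` that `C * |ξ - a₀|` is small
    obtain ⟨δ, hδ, hδR, hδε⟩ : ∃ δ : ℝ, 0 < δ ∧ δ < R ∧ C * δ < ε / 8 := by
      refine ⟨min (R / 2) (ε / (8 * (C + 1)) / 2), by positivity, ?_, ?_⟩
      · exact (min_le_left _ _).trans_lt (by linarith)
      · have h3 : C * min (R / 2) (ε / (8 * (C + 1)) / 2) ≤ C * (ε / (8 * (C + 1)) / 2) := by
          gcongr; exact min_le_right _ _
        refine h3.trans_lt ?_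
        rw [show C * (ε / (8 * (C + 1)) / 2) = (ε / 8) * (C / (2 * (C + 1))) by field_simp]
        have : C / (2 * (C + 1)) < 1 := by rw [div_lt_one (by positivity)]; linarith
        nlinarith
    set ξ : ℂ := a₀ + δ with hξ
    have hdξ : dist ξ a₀ = δ := by simp [hξ, abs_of_pos hδ]
    have hξR : ξ ∈ Metric.ball a₀ R := by rw [Metric.mem_ball, hdξ]; exact hδR
    have hξne : ξ ≠ a₀ := by
      intro h; rw [h, dist_self] at hdξ; exact hδ.ne hdξ
    have hKξ : ContinuousAt (fun η => K ξ η) a₀ := by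
      have h3 : (fun η => K ξ η) = fun η => (ξ - a₀)⁻¹ * (b ξ η - b a₀ η) := by
        funext η
        simp only [hK]
        rw [dslope_of_ne _ hξne, slope_def_module, smul_eq_mul]
      rw [h3]
      have hn := Metric.isOpen_ball.mem_nhds ha₀
      exact continuousAt_const.mul ((((h2 ξ hξR).differentiableAt hn).continuousAt).sub
        ((h2 a₀ ha₀).differentiableAt hn).continuousAt)
    filter_upwards [Metric.tendsto_nhds.1 hKξ.tendsto (ε / 4) (by positivity),
      Metric.ball_mem_nhds a₀ hδ] with a ha1 ha2
    have haR : a ∈ Metric.ball a₀ R := Metric.ball_subset_ball hδR.le ha2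
    have i1 := hKC a haR a haR
    have i2 := hKC ξ hξR a haR
    have i3 := hKC ξ hξR a₀ ha₀
    rw [hdξ] at i2 i3
    have i4 : C * dist a a₀ ≤ C * δ := by gcongr; exact (Metric.mem_ball.1 ha2).le
    have t1 := dist_triangle (K a a) (K a₀ a) (K a₀ a₀)
    have t2 := dist_triangle (K a₀ a) (K ξ a) (K a₀ a₀)
    have t3 := dist_triangle (K ξ a) (K ξ a₀) (K a₀ a₀)
    rw [dist_comm (K a₀ a) (K ξ a)] at t2
    linarith
  have hd2 : DifferentiableAt ℂ (fun a => b a₀ a) a₀ :=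
    (h2 a₀ ha₀).differentiableAt (Metric.isOpen_ball.mem_nhds ha₀)
  have hd1 : HasDerivAt (fun a => (a - a₀) * K a a) (K a₀ a₀) a₀ := by
    rw [hasDerivAt_iff_tendsto_slope]
    refine (hKc.mono_left nhdsWithin_le_nhds).congr' ?_
    filter_upwards [self_mem_nhdsWithin] with a ha
    rw [slope_def_field, sub_self, zero_mul, sub_zero, mul_div_cancel_left₀]
    exact sub_ne_zero.2 ha
  refine (hd1.differentiableAt.add hd2).congr_of_eventuallyEq (Filter.Eventually.of_forall fun a => ?_)
  have := sub_smul_dslope (fun ζ => b ζ a) a₀ a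
  rw [smul_eq_mul] at this
  simp only [hK, Pi.add_apply, this]
  ring

end

noncomputable section

/-! ### Reproducing elements of the weighted Bergman spaces -/

namespace HermitianForm

variable {r n m : ℕ} {U : Type*} [NonUnitalNonAssocRing U] [Module ℝ U]
  [IsScalarTower ℝ U U] [SMulCommClass ℝ U U] [StarRing U] [StarModule ℝ U]
  {T : TAlgebra r U} {e : Module.Basis (Fin n) ℝ (selfAdjoint.submodule ℝ U)}
variable (F : HermitianForm T e m)

theorem continuous_height : Continuous fun p : (Fin n → ℝ) × (Fin m → ℂ) => F.height p.1 p.2 := by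
  refine continuous_pi fun k => ?_
  simp only [height]
  have := continuous_sesqDiag (M := F.mat)
  fun_prop

theorem continuous_heightC :
    Continuous fun z : (Fin n → ℂ) × (Fin m → ℂ) => F.height (fun k => (z.1 k).im) z.2 :=
  F.continuous_height.comp (f := fun z : (Fin n → ℂ) × (Fin m → ℂ) =>
    ((fun k => (z.1 k).im : Fin n → ℝ), z.2)) (by fun_prop)

theorem mem_domain {z : (Fin n → ℂ) × (Fin m → ℂ)} :
    z ∈ F.domain ↔ F.height (fun k => (z.1 k).im) z.2 ∈ T.Omega e := Iff.rfl

/-- `g` represents the evaluation at `w` on the weighted Bergman space. -/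
def IsReproducing (ν : Fin r → ℝ) (w : (Fin n → ℂ) × (Fin m → ℂ))
    (g : (Fin n → ℂ) × (Fin m → ℂ) → ℂ) : Prop :=
  g ∈ F.bergmanSpace ν ∧ ∀ f ∈ F.bergmanSpace ν, f w = ∫ ζ, f ζ * conj (g ζ) ∂(F.V ν)

theorem isReproducing_bergmanKernel {ν : Fin r → ℝ} {w : (Fin n → ℂ) × (Fin m → ℂ)}
    (h : ∃ g, F.IsReproducing ν w g) :
    F.IsReproducing ν w (fun z => F.bergmanKernel ν z w) := by
  have h' : ∃ g ∈ F.bergmanSpace ν, ∀ f ∈ F.bergmanSpace ν,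
      f w = ∫ ζ, f ζ * conj (g ζ) ∂(F.V ν) := h
  have : (fun z => F.bergmanKernel ν z w) = h'.choose := by
    funext z; rw [bergmanKernel, dif_pos h']
  rw [this]
  exact h'.choose_spec

theorem bergmanKernel_eq_zero {ν : Fin r → ℝ} {w : (Fin n → ℂ) × (Fin m → ℂ)}
    (h : ¬ ∃ g, F.IsReproducing ν w g) (z : (Fin n → ℂ) × (Fin m → ℂ)) :
    F.bergmanKernel ν z w = 0 := by
  have h' : ¬ ∃ g ∈ F.bergmanSpace ν, ∀ f ∈ F.bergmanSpace ν,
      f w = ∫ ζ, f ζ * conj (g ζ) ∂(F.V ν) := h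
  rw [bergmanKernel, dif_neg h']

theorem sub_mem_bergmanSpace {ν : Fin r → ℝ} {f g : (Fin n → ℂ) × (Fin m → ℂ) → ℂ}
    (hf : f ∈ F.bergmanSpace ν) (hg : g ∈ F.bergmanSpace ν) : f - g ∈ F.bergmanSpace ν :=
  ⟨hf.1.sub hg.1, hf.2.sub hg.2⟩

theorem integrable_mul_conj {ν : Fin r → ℝ} {f g : (Fin n → ℂ) × (Fin m → ℂ) → ℂ}
    (hf : f ∈ F.bergmanSpace ν) (hg : g ∈ F.bergmanSpace ν) :
    Integrable (fun ζ => f ζ * conj (g ζ)) (F.V ν) :=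
  MemLp.integrable_mul hf.2 hg.2.star

variable [FiniteDimensional ℝ U]

theorem isOpen_domain : IsOpen F.domain := (T.isOpen_Omega e).preimage F.continuous_heightC

theorem measurable_weightC (a : Fin r → ℝ) :
    Measurable fun z : (Fin n → ℂ) × (Fin m → ℂ) => F.weight a (fun k => (z.1 k).im) z.2 :=
  (T.measurable_Qpow e a).comp F.continuous_heightC.measurable

theorem restrict_domain_absolutelyContinuous (ν : Fin r → ℝ) :
    volume.restrict F.domain ≪ F.V ν := by
  refine withDensity_absolutelyContinuous' (F.measurable_weightC _).ennreal_ofReal.aemeasurable ?_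
  refine (ae_restrict_iff' F.isOpen_domain.measurableSet).2
    (Filter.Eventually.of_forall fun z hz => ?_)
  exact (ENNReal.ofReal_pos.2 (T.Qpow_pos e _ hz)).ne'

theorem isReproducing_unique {ν : Fin r → ℝ} {w : (Fin n → ℂ) × (Fin m → ℂ)}
    {g g' : (Fin n → ℂ) × (Fin m → ℂ) → ℂ} (hg : F.IsReproducing ν w g)
    (hg' : F.IsReproducing ν w g') : Set.EqOn g g' F.domain := by
  have hd := F.sub_mem_bergmanSpace hg.1 hg'.1
  set d := g - g' with hdd
  have h1 : ∫ ζ, ‖d ζ‖ ^ 2 ∂(F.V ν) = 0 := by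
    have h2 : ∀ ζ, d ζ * conj (g ζ) - d ζ * conj (g' ζ) = ((‖d ζ‖ ^ 2 : ℝ) : ℂ) := by
      intro ζ
      rw [← mul_sub, ← map_sub, ← Pi.sub_apply g g', ← hdd, Complex.mul_conj,
        Complex.normSq_eq_norm_sq]
    have h3 := integral_sub (F.integrable_mul_conj hd hg.1) (F.integrable_mul_conj hd hg'.1)
    rw [← hg.2 d hd, ← hg'.2 d hd, sub_self] at h3
    simp only [h2] at h3
    rw [integral_complex_ofReal] at h3
    exact_mod_cast h3
  have hi : Integrable (fun ζ => ‖d ζ‖ ^ 2) (F.V ν) := hd.2.integrable_norm_pow (by norm_num)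
  have h4 := (integral_eq_zero_iff_of_nonneg (fun ζ => by positivity) hi).1 h1
  have h5 : g =ᵐ[volume.restrict F.domain] g' := by
    refine (F.restrict_domain_absolutelyContinuous ν).ae_eq ?_
    filter_upwards [h4] with ζ hζ
    have : ‖d ζ‖ = 0 := by simpa using hζ
    exact sub_eq_zero.1 (norm_eq_zero.1 this)
  exact Measure.eqOn_open_of_ae_eq h5 F.isOpen_domain hg.1.1.continuousOn hg'.1.1.continuousOn

theorem bergmanKernel_conj {ν : Fin r → ℝ} {z w : (Fin n → ℂ) × (Fin m → ℂ)}
    (hz : ∃ g, F.IsReproducing ν z g) (hw : ∃ g, F.IsReproducing ν w g) :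
    conj (F.bergmanKernel ν z w) = F.bergmanKernel ν w z := by
  have h1 := F.isReproducing_bergmanKernel hz
  have h2 := F.isReproducing_bergmanKernel hw
  have h3 := h1.2 _ h2.1
  have h4 := h2.2 _ h1.1
  simp only at h3 h4
  rw [h3, h4, ← integral_conj]
  congr 1; funext ζ
  rw [map_mul, Complex.conj_conj, mul_comm]

theorem norm_bergmanKernel_le {ν : Fin r → ℝ} {z w : (Fin n → ℂ) × (Fin m → ℂ)}
    (hz : ∃ g, F.IsReproducing ν z g) (hw : ∃ g, F.IsReproducing ν w g) :
    ‖F.bergmanKernel ν z w‖ ≤ (‖F.bergmanKernel ν z z‖ + ‖F.bergmanKernel ν w w‖) / 2 := by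
  have h1 := F.isReproducing_bergmanKernel hz
  have h2 := F.isReproducing_bergmanKernel hw
  have hself : ∀ {w : (Fin n → ℂ) × (Fin m → ℂ)},
      F.IsReproducing ν w (fun z => F.bergmanKernel ν z w) →
      ‖F.bergmanKernel ν w w‖ = ∫ ζ, ‖F.bergmanKernel ν ζ w‖ ^ 2 ∂(F.V ν) := by
    intro w h
    have h3 := h.2 _ h.1
    simp only [Complex.mul_conj, Complex.normSq_eq_norm_sq] at h3
    rw [h3, integral_complex_ofReal, Complex.norm_real, Real.norm_of_nonneg]
    exact integral_nonneg fun ζ => by positivity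
  have hi1 : Integrable (fun ζ => ‖F.bergmanKernel ν ζ z‖ ^ 2) (F.V ν) :=
    h1.1.2.integrable_norm_pow (by norm_num)
  have hi2 : Integrable (fun ζ => ‖F.bergmanKernel ν ζ w‖ ^ 2) (F.V ν) :=
    h2.1.2.integrable_norm_pow (by norm_num)
  rw [hself h1, hself h2, ← integral_add hi1 hi2, ← integral_div]
  have h4 := h1.2 _ h2.1
  simp only at h4
  rw [h4]
  refine (norm_integral_le_integral_norm _).trans (integral_mono
    (F.integrable_mul_conj h2.1 h1.1).norm ((hi1.add hi2).div_const 2) fun ζ => ?_)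
  simp only [norm_mul, RCLike.norm_conj]
  nlinarith [sq_nonneg (‖F.bergmanKernel ν ζ w‖ - ‖F.bergmanKernel ν ζ z‖)]

/-! ### Automorphisms of the Siegel domain -/

/-- Reproducing elements are transported by biholomorphic maps that multiply the weighted measure
by a constant. -/
theorem IsReproducing.transport {ν : Fin r → ℝ} {w : (Fin n → ℂ) × (Fin m → ℂ)}
    {g : (Fin n → ℂ) × (Fin m → ℂ) → ℂ} (hg : F.IsReproducing ν w g)
    (Φ : ((Fin n → ℂ) × (Fin m → ℂ)) ≃ₜ ((Fin n → ℂ) × (Fin m → ℂ)))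
    (hΦ : Differentiable ℂ Φ) (hΨ : Differentiable ℂ Φ.symm)
    (hD : ∀ z, Φ z ∈ F.domain ↔ z ∈ F.domain) {κ : ℝ} (hκ : 0 < κ)
    (hmap : Measure.map Φ (F.V ν) = ENNReal.ofReal κ • F.V ν) :
    F.IsReproducing ν (Φ w) (fun z => κ * g (Φ.symm z)) := by
  have hemb := Φ.measurableEmbedding
  have hD' : ∀ z, Φ.symm z ∈ F.domain ↔ z ∈ F.domain := fun z => by
    rw [← hD, Φ.apply_symm_apply]
  refine ⟨⟨?_, ?_⟩, fun f hf => ?_⟩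
  · exact (hg.1.1.comp hΨ.differentiableOn fun z hz => (hD' z).2 hz).const_mul _
  · refine MemLp.const_mul ?_ _
    have h1 : MemLp (g ∘ Φ.symm) 2 (Measure.map Φ (F.V ν)) := by
      rw [hemb.memLp_map_measure_iff]
      have : (g ∘ Φ.symm) ∘ Φ = g := by funext z; simp
      rw [this]; exact hg.1.2
    rw [hmap] at h1
    have h2 := h1.smul_measure (c := ENNReal.ofReal κ⁻¹) ENNReal.ofReal_ne_top
    rw [smul_smul, ← ENNReal.ofReal_mul (by positivity), inv_mul_cancel₀ hκ.ne',
      ENNReal.ofReal_one, one_smul] at h2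
    exact h2
  · have hfΦ : f ∘ Φ ∈ F.bergmanSpace ν := by
      refine ⟨hf.1.comp hΦ.differentiableOn fun z hz => (hD z).2 hz, ?_⟩
      rw [← hemb.memLp_map_measure_iff, hmap]
      exact hf.2.smul_measure ENNReal.ofReal_ne_top
    have h1 := hg.2 _ hfΦ
    have h2 := hemb.integral_map (μ := F.V ν) (fun ζ => f ζ * conj (g (Φ.symm ζ)))
    rw [hmap, integral_smul_measure, ENNReal.toReal_ofReal hκ.le] at h2
    simp only [Φ.symm_apply_apply] at h2
    rw [Function.comp_apply] at h1
    rw [h1]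
    simp only [Function.comp_apply]
    rw [← h2, Complex.real_smul, ← integral_const_mul]
    congr 1; funext ζ
    rw [map_mul, Complex.conj_ofReal]; ring

/-- A change of variables that multiplies the weight and the Lebesgue measure by constants. -/
theorem map_V_eq {ν : Fin r → ℝ}
    (Φ : ((Fin n → ℂ) × (Fin m → ℂ)) ≃ₜ ((Fin n → ℂ) × (Fin m → ℂ)))
    (hD : ∀ z, Φ z ∈ F.domain ↔ z ∈ F.domain) {a δ : ℝ} (ha : 0 < a)
    (hw : ∀ z ∈ F.domain,
      F.weight (fun j => ν j - F.b j / 2 - T.tau j) (fun k => (z.1 k).im) z.2 =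
      a * F.weight (fun j => ν j - F.b j / 2 - T.tau j) (fun k => ((Φ z).1 k).im) (Φ z).2)
    (hvol : ∀ G : (Fin n → ℂ) × (Fin m → ℂ) → ℝ≥0∞, Measurable G →
      ∫⁻ z, G (Φ z) = ENNReal.ofReal δ * ∫⁻ z, G z) :
    Measure.map Φ (F.V ν) = ENNReal.ofReal (a * δ) • F.V ν := by
  have hDm := F.isOpen_domain.measurableSet
  set W : (Fin n → ℂ) × (Fin m → ℂ) → ℝ≥0∞ := fun z => ENNReal.ofReal
    (F.weight (fun j => ν j - F.b j / 2 - T.tau j) (fun k => (z.1 k).im) z.2) with hW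
  have hWm : Measurable W := (F.measurable_weightC _).ennreal_ofReal
  have hV : ∀ A, MeasurableSet A → F.V ν A = ∫⁻ z, (A ∩ F.domain).indicator W z := by
    intro A hA
    rw [V, withDensity_apply _ hA, Measure.restrict_restrict hA,
      lintegral_indicator (hA.inter hDm)]
  ext A hA
  rw [Measure.map_apply Φ.continuous.measurable hA, hV _ (Φ.continuous.measurable hA),
    Measure.smul_apply, smul_eq_mul, hV A hA, ENNReal.ofReal_mul ha.le, mul_assoc,
    ← hvol _ (hWm.indicator (hA.inter hDm)), ← lintegral_const_mul' _ _ ENNReal.ofReal_ne_top]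
  refine lintegral_congr fun z => ?_
  by_cases hz : z ∈ Φ ⁻¹' A ∩ F.domain
  · have hz' : Φ z ∈ A ∩ F.domain := ⟨hz.1, (hD z).2 hz.2⟩
    rw [Set.indicator_of_mem hz, Set.indicator_of_mem hz', hW]
    simp only
    rw [hw z hz.2, ENNReal.ofReal_mul ha.le]
  · have hz' : Φ z ∉ A ∩ F.domain := fun h => hz ⟨h.1, (hD z).1 h.2⟩
    rw [Set.indicator_of_notMem hz, Set.indicator_of_notMem hz', mul_zero]

/-- The translation `(z, u) ↦ (z + x + 2 i F(u, a) + i F(a, a), u + a)`. -/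
def shearFun (x : Fin n → ℝ) (a : Fin m → ℂ) (z : (Fin n → ℂ) × (Fin m → ℂ)) :
    (Fin n → ℂ) × (Fin m → ℂ) :=
  (fun k => z.1 k + (x k + 2 * Complex.I * sesq F.mat z.2 a k + Complex.I * sesqDiag F.mat a k),
    z.2 + a)

theorem shearFun_shearFun (x : Fin n → ℝ) (a : Fin m → ℂ) (z : (Fin n → ℂ) × (Fin m → ℂ)) :
    F.shearFun (-x) (-a) (F.shearFun x a z) = z := by
  refine Prod.ext (funext fun k => ?_) (by simp [shearFun])
  have h1 : ∀ u : Fin m → ℂ, sesq F.mat u (-a) = -sesq F.mat u a := fun u => by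
    rw [← neg_one_smul ℂ a, sesq_smul_right]; simp
  simp only [shearFun, sesqDiag_neg, h1, sesq_add_left, Pi.neg_apply, Pi.add_apply,
    sesq_self F.hermitian]
  push_cast; ring

theorem differentiable_shearFun (x : Fin n → ℝ) (a : Fin m → ℂ) :
    Differentiable ℂ (F.shearFun x a) := by
  unfold shearFun
  simp only [sesq, dotProduct]
  fun_prop

/-- `shearFun` as a homeomorphism. -/
def shear (x : Fin n → ℝ) (a : Fin m → ℂ) :
    ((Fin n → ℂ) × (Fin m → ℂ)) ≃ₜ ((Fin n → ℂ) × (Fin m → ℂ)) where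
  toFun := F.shearFun x a
  invFun := F.shearFun (-x) (-a)
  left_inv := F.shearFun_shearFun x a
  right_inv := fun z => by simpa using F.shearFun_shearFun (-x) (-a) z
  continuous_toFun := (F.differentiable_shearFun x a).continuous
  continuous_invFun := (F.differentiable_shearFun (-x) (-a)).continuous

theorem height_shear (x : Fin n → ℝ) (a : Fin m → ℂ) (z : (Fin n → ℂ) × (Fin m → ℂ)) :
    F.height (fun k => ((F.shear x a z).1 k).im) (F.shear x a z).2 =
      F.height (fun k => (z.1 k).im) z.2 := by
  funext k
  change ((F.shearFun x a z).1 k).im - sesqDiag F.mat (F.shearFun x a z).2 k = _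
  simp only [shearFun, height, sesqDiag_add F.hermitian]
  simp
  ring

theorem map_shear (ν : Fin r → ℝ) (x : Fin n → ℝ) (a : Fin m → ℂ) :
    Measure.map (F.shear x a) (F.V ν) = ENNReal.ofReal 1 • F.V ν := by
  have h := F.map_V_eq (ν := ν) (F.shear x a) (a := 1) (δ := 1)
    (fun z => by rw [mem_domain, mem_domain, height_shear]) one_pos
    (fun z _ => by rw [one_mul, weight, weight, height_shear]) (fun G hG => ?_)
  · rwa [mul_one] at h
  · have hm : Measurable fun z => G (F.shear x a z) :=
      hG.comp (F.shear x a).continuous.measurable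
    rw [ENNReal.ofReal_one, one_mul, Measure.volume_eq_prod, lintegral_prod_symm _ hm.aemeasurable,
      lintegral_prod_symm _ hG.aemeasurable,
      ← lintegral_add_right_eq_self (fun u : Fin m → ℂ => ∫⁻ z : Fin n → ℂ, G (z, u)) a]
    refine lintegral_congr fun u => ?_
    exact lintegral_add_right_eq_self (fun z : Fin n → ℂ => G (z, u + a))
      (fun k => x k + 2 * Complex.I * sesq F.mat u a k + Complex.I * sesqDiag F.mat a k)

end HermitianForm

end

noncomputable section

/-! ### The weighted Bergman kernel -/

namespace TAlgebra

variable {r n : ℕ} {U : Type*} [NonUnitalNonAssocRing U] [Module ℝ U]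
  [IsScalarTower ℝ U U] [SMulCommClass ℝ U U] [StarRing U] [StarModule ℝ U]
  (T : TAlgebra r U) (e : Module.Basis (Fin n) ℝ (selfAdjoint.submodule ℝ U))
  [FiniteDimensional ℝ U]

/-- The matrix of the complex linear extension of `π(h)` to `ℂ^n`. -/
def piC (h : Fin n → ℝ) : Matrix (Fin n) (Fin n) ℂ :=
  (LinearMap.toMatrix' (T.pi e h)).map Complex.ofRealHom

theorem piC_xmul (a b : Fin n → ℝ) : T.piC e (T.xmul e a b) = T.piC e a * T.piC e b := by
  rw [piC, pi_xmul, LinearMap.toMatrix'_comp, Matrix.map_mul]; rfl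

theorem piC_xone : T.piC e (T.xone e) = 1 := by
  rw [piC, pi_xone, LinearMap.toMatrix'_id, Matrix.map_one _ (map_zero _) (map_one _)]

theorem det_piC {h : Fin n → ℝ} (hh : h ∈ T.HX e) :
    (T.piC e h).det = ((T.chi e T.tau h : ℝ) : ℂ) := by
  rw [piC, ← T.det_pi_eq_chi e hh, ← LinearMap.det_toMatrix']
  exact (RingHom.map_det Complex.ofRealHom _).symm

theorem piC_mulVec (h x y : Fin n → ℝ) :
    (T.piC e h).mulVec (fun k => (x k : ℂ) + Complex.I * y k) =
      fun k => (T.pi e h x k : ℂ) + Complex.I * (T.pi e h y k : ℂ) := by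
  funext k
  rw [← LinearMap.toMatrix'_mulVec (T.pi e h) x, ← LinearMap.toMatrix'_mulVec (T.pi e h) y]
  simp only [piC, Matrix.mulVec, dotProduct, Matrix.map_apply, Complex.ofRealHom_eq_coe,
    Complex.ofReal_sum, Complex.ofReal_mul, Finset.mul_sum, ← Finset.sum_add_distrib]
  exact Finset.sum_congr rfl fun l _ => by ring

theorem piC_mulVec_im (h : Fin n → ℝ) (Z : Fin n → ℂ) (k : Fin n) :
    ((T.piC e h).mulVec Z k).im = T.pi e h (fun k => (Z k).im) k := by
  have hZ : Z = fun k => ((Z k).re : ℂ) + Complex.I * ((Z k).im : ℂ) := by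
    funext k; rw [mul_comm, Complex.re_add_im]
  conv_lhs => rw [hZ, piC_mulVec]
  simp

end TAlgebra

namespace HermitianForm

variable {r n m : ℕ} {U : Type*} [NonUnitalNonAssocRing U] [Module ℝ U]
  [IsScalarTower ℝ U U] [SMulCommClass ℝ U U] [StarRing U] [StarModule ℝ U]
  {T : TAlgebra r U} {e : Module.Basis (Fin n) ℝ (selfAdjoint.submodule ℝ U)}
variable (F : HermitianForm T e m)

variable [FiniteDimensional ℝ U]

theorem differentiable_mulVec_prod (A : Matrix (Fin n) (Fin n) ℂ) (g : Matrix (Fin m) (Fin m) ℂ) :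
    Differentiable ℂ fun z : (Fin n → ℂ) × (Fin m → ℂ) => (A.mulVec z.1, g.mulVec z.2) :=
  ((LinearMap.toContinuousLinearMap A.mulVecLin).differentiable.comp differentiable_fst).prodMk
    ((LinearMap.toContinuousLinearMap g.mulVecLin).differentiable.comp differentiable_snd)

/-- A pair of invertible matrices as a homeomorphism of `ℂ^n × ℂ^m`. -/
def linHomeo (A A' : Matrix (Fin n) (Fin n) ℂ) (g g' : Matrix (Fin m) (Fin m) ℂ)
    (hA : A * A' = 1) (hA' : A' * A = 1) (hg : g * g' = 1) (hg' : g' * g = 1) :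
    ((Fin n → ℂ) × (Fin m → ℂ)) ≃ₜ ((Fin n → ℂ) × (Fin m → ℂ)) where
  toFun z := (A.mulVec z.1, g.mulVec z.2)
  invFun z := (A'.mulVec z.1, g'.mulVec z.2)
  left_inv z := by simp [Matrix.mulVec_mulVec, hA', hg']
  right_inv z := by simp [Matrix.mulVec_mulVec, hA, hg]
  continuous_toFun := (differentiable_mulVec_prod A g).continuous
  continuous_invFun := (differentiable_mulVec_prod A' g').continuous

theorem lintegral_mulVec_prod (A : Matrix (Fin n) (Fin n) ℂ) (g : Matrix (Fin m) (Fin m) ℂ)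
    (hA : A.det ≠ 0) (hg : g.det ≠ 0) (G : (Fin n → ℂ) × (Fin m → ℂ) → ℝ≥0∞) (hG : Measurable G) :
    ∫⁻ z : (Fin n → ℂ) × (Fin m → ℂ), G (A.mulVec z.1, g.mulVec z.2) =
      ENNReal.ofReal ((‖A.det‖ ^ 2)⁻¹ * (‖g.det‖ ^ 2)⁻¹) * ∫⁻ z, G z := by
  have hm : Measurable fun z : (Fin n → ℂ) × (Fin m → ℂ) => G (A.mulVec z.1, g.mulVec z.2) :=
    hG.comp (differentiable_mulVec_prod A g).continuous.measurable
  have hdet : ∀ {k : ℕ} {B : Matrix (Fin k) (Fin k) ℂ}, B.det ≠ 0 →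
      ∀ f : (Fin k → ℂ) → ℝ≥0∞, ∫⁻ x, f (B.mulVec x) =
        ENNReal.ofReal ((‖B.det‖ ^ 2)⁻¹) * ∫⁻ x, f x := by
    intro k B hB f
    have h := lintegral_comp_linearMap (volume : Measure (Fin k → ℂ)) (B.toLin'.restrictScalars ℝ)
      (by rw [det_mulVecLin_restrictScalars]; positivity) f
    rw [det_mulVecLin_restrictScalars, abs_of_nonneg (by positivity)] at h
    exact h
  rw [Measure.volume_eq_prod, lintegral_prod_symm _ hm.aemeasurable,
    lintegral_prod_symm _ hG.aemeasurable, ENNReal.ofReal_mul (by positivity), mul_assoc,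
    ← hdet hg (fun u => ∫⁻ z, G (z, u)), ← lintegral_const_mul' _ _ ENNReal.ofReal_ne_top]
  exact lintegral_congr fun u => hdet hA (fun z => G (z, g.mulVec u))

theorem IsReproducing.transport_symm {ν : Fin r → ℝ} {w : (Fin n → ℂ) × (Fin m → ℂ)}
    {g : (Fin n → ℂ) × (Fin m → ℂ) → ℂ}
    (Φ : ((Fin n → ℂ) × (Fin m → ℂ)) ≃ₜ ((Fin n → ℂ) × (Fin m → ℂ)))
    (hg : F.IsReproducing ν (Φ w) g)
    (hΦ : Differentiable ℂ Φ) (hΨ : Differentiable ℂ Φ.symm)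
    (hD : ∀ z, Φ z ∈ F.domain ↔ z ∈ F.domain) {κ : ℝ} (hκ : 0 < κ)
    (hmap : Measure.map Φ (F.V ν) = ENNReal.ofReal κ • F.V ν) :
    ∃ g', F.IsReproducing ν w g' := by
  have hmap' : Measure.map Φ.symm (F.V ν) = ENNReal.ofReal κ⁻¹ • F.V ν := by
    have h1 : F.V ν = ENNReal.ofReal κ⁻¹ • Measure.map Φ (F.V ν) := by
      rw [hmap, smul_smul, ← ENNReal.ofReal_mul (by positivity), inv_mul_cancel₀ hκ.ne',
        ENNReal.ofReal_one, one_smul]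
    conv_lhs => rw [h1]
    rw [Measure.map_smul, Measure.map_map Φ.symm.continuous.measurable Φ.continuous.measurable]
    simp
  have h2 := hg.transport F Φ.symm hΨ hΦ (fun z => by rw [← hD, Φ.apply_symm_apply])
    (inv_pos.2 hκ) hmap'
  rw [Φ.symm_apply_apply] at h2
  exact ⟨_, h2⟩

/-- The exponent `ν + b/2 + τ` of the Bergman kernel. -/
def kerExp (ν : Fin r → ℝ) (j : Fin r) : ℝ := ν j + F.b j / 2 + T.tau j

/-- The base point of the Siegel domain. -/
def basePoint (_F : HermitianForm T e m) : (Fin n → ℂ) × (Fin m → ℂ) :=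
  (fun k => Complex.I * (T.psi e (T.xone e) k : ℂ), 0)

/-- The affine automorphisms of the domain act transitively: a linear map over `π(h)` brings the base
point to height `psi h`, and a shear moves it to `z`. -/
theorem exists_automorphism (ν : Fin r → ℝ) {z : (Fin n → ℂ) × (Fin m → ℂ)} {h : Fin n → ℝ}
    (hh : h ∈ T.HX e) (hz : T.psi e h = F.height (fun k => (z.1 k).im) z.2) :
    ∃ Φ : ((Fin n → ℂ) × (Fin m → ℂ)) ≃ₜ ((Fin n → ℂ) × (Fin m → ℂ)),
      Differentiable ℂ Φ ∧ Differentiable ℂ Φ.symm ∧ (∀ z, Φ z ∈ F.domain ↔ z ∈ F.domain) ∧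
      Measure.map Φ (F.V ν) = ENNReal.ofReal (T.chi e (-F.kerExp ν) h) • F.V ν ∧
      Φ F.basePoint = z := by
  obtain ⟨h', hh', h1, h2⟩ := T.exists_inv e hh
  obtain ⟨g, hgu, hg⟩ := F.exists_equivariant hh
  set L := linHomeo (T.piC e h) (T.piC e h') g g⁻¹
    (by rw [← T.piC_xmul, h1, T.piC_xone]) (by rw [← T.piC_xmul, h2, T.piC_xone])
    (Matrix.mul_nonsing_inv g hgu) (Matrix.nonsing_inv_mul g hgu) with hL
  have hLdef : ∀ z, L z = ((T.piC e h).mulVec z.1, g.mulVec z.2) := fun _ => rfl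
  set S := F.shear (fun k => (z.1 k).re) z.2 with hS
  have hLh : ∀ z, F.height (fun k => ((L z).1 k).im) (L z).2 =
      T.pi e h (F.height (fun k => (z.1 k).im) z.2) := by
    intro z
    have : F.height (fun k => (z.1 k).im) z.2 = (fun k => (z.1 k).im) - sesqDiag F.mat z.2 := rfl
    rw [this, map_sub, hg]
    funext k
    simp only [hLdef, height, T.piC_mulVec_im, Pi.sub_apply]
  have hLD : ∀ z, L z ∈ F.domain ↔ z ∈ F.domain := fun z => by
    rw [mem_domain, mem_domain, hLh, T.pi_mem_Omega e hh]
  have hSD : ∀ z, S z ∈ F.domain ↔ z ∈ F.domain := fun w => by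
    rw [mem_domain, mem_domain, hS, height_shear]
  have hdet : ‖(T.piC e h).det‖ = T.chi e T.tau h := by
    rw [T.det_piC e hh, Complex.norm_real, Real.norm_of_nonneg (T.chi_nonneg e _ _)]
  have hdet' : ‖g.det‖ ^ 2 = T.chi e (fun j => F.b j) h := by
    rw [← F.detChar_eq hg, F.detChar_eq_chi hh]
  set c : Fin r → ℝ := fun j => ν j - F.b j / 2 - T.tau j with hc
  have hLmap := F.map_V_eq (ν := ν) L hLD (T.chi_pos e (-c) hh)
    (δ := (‖(T.piC e h).det‖ ^ 2)⁻¹ * (‖g.det‖ ^ 2)⁻¹) (fun w hw => ?_) (fun G hG => ?_)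
  rotate_left
  · rw [weight, weight, hLh, T.Qpow_pi e _ hh hw, ← mul_assoc, ← T.chi_add e _ _ hh,
      neg_add_cancel, T.chi_zero, one_mul]
  · exact lintegral_mulVec_prod _ _ (by
      rw [← norm_ne_zero_iff, hdet]; exact (T.chi_pos e _ hh).ne') hgu.ne_zero G hG
  have hκ : T.chi e (-c) h * ((‖(T.piC e h).det‖ ^ 2)⁻¹ * (‖g.det‖ ^ 2)⁻¹) =
      T.chi e (-F.kerExp ν) h := by
    rw [hdet, hdet', sq, mul_inv, ← T.chi_neg e _ hh, ← T.chi_neg e _ hh, ← T.chi_add e _ _ hh,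
      ← T.chi_add e _ _ hh, ← T.chi_add e _ _ hh]
    congr 1; funext j
    simp only [hc, Pi.add_apply, Pi.neg_apply, kerExp]; ring
  rw [hκ] at hLmap
  refine ⟨L.trans S, ?_, ?_, fun w => ?_, ?_, ?_⟩
  · exact (F.differentiable_shearFun _ _).comp (differentiable_mulVec_prod _ _)
  · exact (differentiable_mulVec_prod _ _).comp (F.differentiable_shearFun _ _)
  · rw [Homeomorph.trans_apply, hSD, hLD]
  · have : ⇑(L.trans S) = S ∘ L := rfl
    rw [this, ← Measure.map_map S.continuous.measurable L.continuous.measurable, hLmap,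
      Measure.map_smul, hS, map_shear, ENNReal.ofReal_one, one_smul]
  · have hLo : L F.basePoint = (fun k => Complex.I * (T.psi e h k : ℂ), 0) := by
      rw [hLdef]
      refine Prod.ext ?_ (by simp [basePoint])
      have := T.piC_mulVec e h 0 (T.psi e (T.xone e))
      rw [map_zero, T.pi_psi, T.xmul_xone] at this
      simpa [basePoint] using this
    rw [Homeomorph.trans_apply, hLo]
    change F.shearFun _ _ _ = z
    refine Prod.ext (funext fun k => ?_) (by simp [shearFun])
    have h0 : sesq F.mat 0 z.2 k = 0 := by simp [sesq]
    simp only [shearFun, h0, hz, height]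
    push_cast
    conv_rhs => rw [← Complex.re_add_im (z.1 k)]
    ring

/-- The argument `(z - w̄) / 2i - F(u, t)` of the Bergman kernel at `((z, u), (w, t))`. -/
def kerArg (z w : (Fin n → ℂ) × (Fin m → ℂ)) : Fin n → ℂ :=
  fun k => (z.1 k - conj (w.1 k)) / (2 * Complex.I) - sesq F.mat z.2 w.2 k

theorem kerArg_re (z w : (Fin n → ℂ) × (Fin m → ℂ)) :
    (fun k => (F.kerArg z w k).re) = (1 / 2 : ℝ) • (F.height (fun k => (z.1 k).im) z.2 +
      F.height (fun k => (w.1 k).im) w.2 + sesqDiag F.mat (z.2 - w.2)) := by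
  funext k
  have h1 : (z.1 k - conj (w.1 k)) / (2 * Complex.I) =
      -(Complex.I / 2) * (z.1 k - conj (w.1 k)) := by
    field_simp
    rw [Complex.I_sq]; ring
  simp only [kerArg, h1, Pi.smul_apply, Pi.add_apply, height, sesqDiag_sub F.hermitian, smul_eq_mul,
    Complex.sub_re, Complex.mul_re, Complex.neg_re, Complex.neg_im, Complex.sub_im,
    Complex.conj_re, Complex.conj_im, Complex.div_ofNat_re, Complex.div_ofNat_im, Complex.I_re,
    Complex.I_im]
  ring

theorem kerArg_re_mem {z w : (Fin n → ℂ) × (Fin m → ℂ)} (hz : z ∈ F.domain) (hw : w ∈ F.domain) :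
    (fun k => (F.kerArg z w k).re) ∈ T.Omega e := by
  rw [kerArg_re]
  refine T.smul_mem_Omega e (T.add_mem_Omega e ?_ (F.mem_closure _)) (by norm_num)
  exact T.add_mem_Omega e hz (subset_closure hw)

theorem kerArg_self (z : (Fin n → ℂ) × (Fin m → ℂ)) :
    F.kerArg z z = fun k => (F.height (fun k => (z.1 k).im) z.2 k : ℂ) := by
  funext k
  rw [kerArg, sesq_self F.hermitian, height, Complex.sub_conj]
  push_cast
  field_simp

theorem kerArg_line (p d : (Fin n → ℂ) × (Fin m → ℂ)) :
    Differentiable ℂ fun a : ℂ => F.kerArg (p + a • d) (p + conj a • d) := by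
  have : (fun a : ℂ => F.kerArg (p + a • d) (p + conj a • d)) = fun a k =>
      ((p.1 k + a * d.1 k) - (conj (p.1 k) + a * conj (d.1 k))) / (2 * Complex.I) -
      ((sesq F.mat p.2 p.2 k + a * sesq F.mat d.2 p.2 k) +
        a * (sesq F.mat p.2 d.2 k + a * sesq F.mat d.2 d.2 k)) := by
    funext a k
    simp only [kerArg, Prod.fst_add, Prod.snd_add, Prod.smul_fst, Prod.smul_snd, Pi.add_apply,
      Pi.smul_apply, smul_eq_mul, map_add, map_mul, Complex.conj_conj, sesq_add_left,
      sesq_add_right, sesq_smul_left, sesq_smul_right]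
  rw [this]
  fun_prop

theorem convex_domain : Convex ℝ F.domain := by
  intro z hz w hw s t hs ht hst
  have hkey : F.height (fun k => ((s • z + t • w).1 k).im) (s • z + t • w).2 =
      (s • F.height (fun k => (z.1 k).im) z.2 + t • F.height (fun k => (w.1 k).im) w.2) +
        (s * t) • sesqDiag F.mat (z.2 - w.2) := by
    funext k
    have h1 : (s • z + t • w).2 = s • z.2 + t • w.2 := rfl
    have h2 : ∀ (t : ℝ) (u : Fin m → ℂ), t • u = (t : ℂ) • u := fun t u => by funext i; simp
    simp only [height, h1, sesqDiag_add F.hermitian, sesqDiag_smul, sesqDiag_sub F.hermitian,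
      Pi.add_apply, Pi.smul_apply, smul_eq_mul]
    rw [h2 s, h2 t, sesq_smul_left, sesq_smul_right]
    simp only [Prod.fst_add, Prod.smul_fst, Pi.add_apply, Pi.smul_apply, smul_eq_mul,
      Complex.conj_ofReal, Complex.add_im, Complex.real_smul, Complex.im_ofReal_mul,
      Complex.re_ofReal_mul]
    obtain rfl : t = 1 - s := by linarith
    ring
  rw [mem_domain, hkey]
  refine T.add_mem_Omega e (T.convex_Omega e hz hw hs ht hst) ?_
  rw [← Real.sq_sqrt (mul_nonneg hs ht), ← sesqDiag_smul]
  exact F.mem_closure _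

/-- The weighted Bergman kernel is a constant multiple of the function
`lap (ν + b/2 + τ)` of `(z - w̄) / 2i - F(u, t)`: the two agree up to a constant on the diagonal by
the action of the automorphisms, and hence everywhere by polarization. -/
theorem exists_bergmanKernel_eq {ν : Fin r → ℝ} (hν : ∀ j, (T.nDim j : ℝ) / 2 < F.kerExp ν j) :
    ∃ c : ℂ, ∀ z ∈ F.domain, ∀ w ∈ F.domain,
      F.bergmanKernel ν z w = c * T.lap e (F.kerExp ν) (F.kerArg z w) := by
  by_cases hex : ∃ g, F.IsReproducing ν F.basePoint g
  swap
  · -- without a reproducing element at one point there is none at any point, by transitivity of the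
    -- automorphisms, and the kernel is `0` by convention
    refine ⟨0, fun z _ w hw => ?_⟩
    rw [zero_mul]
    refine F.bergmanKernel_eq_zero (fun ⟨g, hg⟩ => hex ?_) z
    obtain ⟨h, hh, hz⟩ := (T.mem_Omega_iff e).1 (F.mem_domain.1 hw)
    obtain ⟨Φ, h1, h2, h3, h4, h5⟩ := F.exists_automorphism ν hh hz
    rw [← h5] at hg
    exact hg.transport_symm F Φ h1 h2 h3 (T.chi_pos e _ hh) h4
  have hbase : F.basePoint ∈ F.domain := by
    rw [mem_domain]
    have : F.height (fun k => (F.basePoint.1 k).im) F.basePoint.2 = T.psi e (T.xone e) := by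
      funext k; simp [basePoint, height, sesqDiag_zero]
    rw [this]
    exact T.psi_mem_Omega e (T.xone_mem_HX e)
  set l := (T.ell e (F.kerExp ν) (T.psi e (T.xone e))).toReal with hl
  have hl0 : (l : ℂ) ≠ 0 := by
    exact_mod_cast (ENNReal.toReal_pos (T.ell_xone_ne_zero e _) (T.ell_xone_lt_top e hν).ne).ne'
  set c : ℂ := F.bergmanKernel ν F.basePoint F.basePoint / l with hc
  have hrep : ∀ z ∈ F.domain, (∃ g, F.IsReproducing ν z g) ∧
      F.bergmanKernel ν z z = c * T.lap e (F.kerExp ν) (F.kerArg z z) := by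
    intro z hz
    obtain ⟨h, hh, hz'⟩ := (T.mem_Omega_iff e).1 (F.mem_domain.1 hz)
    obtain ⟨Φ, h1, h2, h3, h4, h5⟩ := F.exists_automorphism ν hh hz'
    have h6 := (F.isReproducing_bergmanKernel hex).transport F Φ h1 h2 h3 (T.chi_pos e _ hh) h4
    have h7 := F.isReproducing_unique (F.isReproducing_bergmanKernel ⟨_, h6⟩) h6 ((h3 _).2 hbase)
    have h8 : Φ.symm z = F.basePoint := by rw [← h5, Φ.symm_apply_apply]
    simp only [h5, h8] at h7
    rw [h5] at h6
    refine ⟨⟨_, h6⟩, ?_⟩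
    rw [h7, kerArg_self, T.lap_ofReal, ← hz', T.ell_psi e _ hh, ENNReal.toReal_mul,
      ENNReal.toReal_ofReal (T.chi_nonneg e _ _), ← hl, hc]
    push_cast
    field_simp
  refine ⟨c, fun z hz w hw => ?_⟩
  -- the complex line through `z` (at `i`) and `w` (at `-i`)
  set p : (Fin n → ℂ) × (Fin m → ℂ) := (1 / 2 : ℂ) • (z + w) with hp
  set d : (Fin n → ℂ) × (Fin m → ℂ) := (-Complex.I / 2) • (z - w) with hd
  have hpz : p + Complex.I • d = z := by
    rw [hp, hd, smul_smul, show Complex.I * (-Complex.I / 2) = 1 / 2 by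
      rw [mul_div_assoc', mul_neg, Complex.I_mul_I]; norm_num]
    module
  have hpw : p + conj Complex.I • d = w := by
    rw [hp, hd, smul_smul, Complex.conj_I, show -Complex.I * (-Complex.I / 2) = -(1 / 2) by
      rw [mul_div_assoc', neg_mul_neg, Complex.I_mul_I]; norm_num]
    module
  set S : Set ℂ := {a | p + a • d ∈ F.domain} with hS
  have hSo : IsOpen S := F.isOpen_domain.preimage (by fun_prop)
  have hSc : Convex ℝ S := by
    intro a ha a' ha' s t hs ht hst
    have := F.convex_domain ha ha' hs ht hst
    rw [hS, Set.mem_ofPred_eq]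
    convert this using 1
    have hone : p = s • p + t • p := by rw [← add_smul, hst, one_smul]
    conv_lhs => rw [hone]
    rw [add_smul, smul_add, smul_add, smul_assoc, smul_assoc]
    abel
  set S' : Set ℂ := S ∩ conj ⁻¹' S with hS'
  have hS'o : IsOpen S' := hSo.inter (hSo.preimage Complex.continuous_conj)
  have hS'c : Convex ℝ S' := by
    refine hSc.inter ?_
    exact hSc.linear_preimage (Complex.conjAe.toLinearMap)
  have hIS : Complex.I ∈ S' := by
    refine ⟨?_, ?_⟩
    · rw [hS, Set.mem_ofPred_eq, hpz]; exact hz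
    · rw [Set.mem_preimage, hS, Set.mem_ofPred_eq, hpw]; exact hw
  have hIS' : conj Complex.I ∈ S' := ⟨hIS.2, by
    rw [Set.mem_preimage, Complex.conj_conj]; exact hIS.1⟩
  have h0S : (0 : ℂ) ∈ S' := by
    have := hS'c hIS hIS' (a := 1 / 2) (b := 1 / 2) (by norm_num) (by norm_num) (by norm_num)
    simpa using this
  set f : ℂ → ℂ := fun a => F.bergmanKernel ν (p + a • d) (p + conj a • d) -
    c * T.lap e (F.kerExp ν) (F.kerArg (p + a • d) (p + conj a • d)) with hf
  have hfd : DifferentiableOn ℂ f S' := by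
    intro a₀ ha₀
    refine DifferentiableAt.differentiableWithinAt (DifferentiableAt.sub ?_ ?_)
    · -- the norm of the kernel on the diagonal is continuous along the line
      have hN : ContinuousOn (fun a : ℂ => ‖F.bergmanKernel ν (p + a • d) (p + a • d)‖) S := by
        have h1 : ContinuousOn (fun a : ℂ => ‖c * T.lap e (F.kerExp ν)
            (F.kerArg (p + a • d) (p + a • d))‖) S := by
          intro a ha
          refine ContinuousAt.continuousWithinAt ?_
          refine (continuousAt_const.mul ?_).norm
          have h2 : Continuous fun a : ℂ => F.kerArg (p + a • d) (p + a • d) := by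
            have h3 : (fun a : ℂ => F.kerArg (p + a • d) (p + a • d)) = fun a k =>
                (F.height (fun k => ((p + a • d).1 k).im) (p + a • d).2 k : ℂ) := by
              funext a; rw [kerArg_self]
            rw [h3]
            have h4 : Continuous fun a : ℂ =>
                F.height (fun k => ((p + a • d).1 k).im) (p + a • d).2 :=
              F.continuous_heightC.comp (f := fun a : ℂ => p + a • d) (by fun_prop)
            fun_prop
          exact ContinuousAt.comp (f := fun a : ℂ => F.kerArg (p + a • d) (p + a • d))
            (T.differentiableAt_lap e hν (F.kerArg_re_mem ha ha)).continuousAt h2.continuousAt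
        exact h1.congr fun a ha => by rw [(hrep _ ha).2]
      obtain ⟨R₁, hR₁, hball₁⟩ := Metric.isOpen_iff.1 hS'o a₀ ha₀
      have hc1 := (hN.continuousAt (hSo.mem_nhds ha₀.1)).eventually (gt_mem_nhds (lt_add_one _))
      have hc2 := ((hN.continuousAt (hSo.mem_nhds ha₀.2)).comp (f := fun a : ℂ => conj a)
        Complex.continuous_conj.continuousAt).eventually (gt_mem_nhds (lt_add_one _))
      obtain ⟨R₂, hR₂, hball₂⟩ := Metric.eventually_nhds_iff_ball.1 (hc1.and hc2)
      have hsub : ∀ {a : ℂ}, a ∈ Metric.ball a₀ (min R₁ R₂) → a ∈ S' := fun ha =>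
        hball₁ (Metric.ball_subset_ball (min_le_left _ _) ha)
      have hsub2 : ∀ {a : ℂ}, a ∈ Metric.ball a₀ (min R₁ R₂) → a ∈ Metric.ball a₀ R₂ := fun ha =>
        Metric.ball_subset_ball (min_le_right _ _) ha
      refine differentiableAt_diag_of_separately
        (b := fun ζ η => F.bergmanKernel ν (p + ζ • d) (p + conj η • d)) (lt_min hR₁ hR₂)
        (fun η hη => ?_) (fun ζ hζ => ?_) (fun ζ hζ η hη => ?_)
        (M := ((‖F.bergmanKernel ν (p + a₀ • d) (p + a₀ • d)‖ + 1) +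
          (‖F.bergmanKernel ν (p + conj a₀ • d) (p + conj a₀ • d)‖ + 1)) / 2)
      · have h1 := (F.isReproducing_bergmanKernel (hrep _ (hsub hη).2).1).1.1
        exact h1.comp (f := fun ζ : ℂ => p + ζ • d) (by fun_prop) fun ζ hζ => (hsub hζ).1
      · intro η hη
        refine DifferentiableAt.differentiableWithinAt ?_
        have h1 := (F.isReproducing_bergmanKernel (hrep _ (hsub hζ).1).1).1.1
        have h2 : DifferentiableAt ℂ (fun ξ : ℂ => F.bergmanKernel ν (p + ξ • d) (p + ζ • d))
            (conj η) :=
          DifferentiableAt.comp (f := fun ξ : ℂ => p + ξ • d) (conj η)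
            (h1.differentiableAt (F.isOpen_domain.mem_nhds (hsub hη).2)) (by fun_prop)
        have h3 := h2.conj_conj
        rw [Complex.conj_conj] at h3
        refine h3.congr_of_eventuallyEq ?_
        filter_upwards [Metric.isOpen_ball.mem_nhds hη] with ξ hξ
        simp only [Function.comp_apply]
        rw [F.bergmanKernel_conj (hrep _ (hsub hξ).2).1 (hrep _ (hsub hζ).1).1]
      · refine (F.norm_bergmanKernel_le (hrep _ (hsub hζ).1).1 (hrep _ (hsub hη).2).1).trans ?_
        have i1 := (hball₂ ζ (hsub2 hζ)).1
        have i2 := (hball₂ η (hsub2 hη)).2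
        simp only [Function.comp_apply] at i2
        linarith
    · refine DifferentiableAt.const_mul ?_ _
      exact DifferentiableAt.comp (f := fun a : ℂ => F.kerArg (p + a • d) (p + conj a • d)) a₀
        (T.differentiableAt_lap e hν (F.kerArg_re_mem ha₀.1 ha₀.2)) (F.kerArg_line p d a₀)
  have key := eq_zero_of_forall_real_eq_zero hS'o hS'c h0S hfd (fun x hx => ?_) hIS
  · simp only [hf, hpz, hpw] at key
    exact sub_eq_zero.1 key
  · simp only [hf, Complex.conj_ofReal]
    rw [(hrep _ hx.1).2, sub_self]

end HermitianForm

end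

/-! ### Minkowski's integral inequality -/

noncomputable section

variable {X A : Type*} [MeasurableSpace X] [MeasurableSpace A]

theorem measurable_eLpNorm_left (κ : Measure X) [SFinite κ] (p : ℝ≥0∞) {f : X → A → ℝ≥0∞}
    (hf : Measurable (Function.uncurry f)) : Measurable fun a => eLpNorm (fun x => f x a) p κ := by
  rcases eq_or_ne p 0 with rfl | hp0
  · simp
  rcases eq_or_ne p ∞ with rfl | hp
  · simp only [eLpNorm_exponent_top]
    refine measurable_of_Ioi fun c => ?_
    have h1 : (fun a => eLpNormEssSup (fun x => f x a) κ) ⁻¹' Set.Ioi c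
        = {a | κ (Prod.mk a ⁻¹' {w : A × X | c < f w.2 w.1}) ≠ 0} := by
      ext a
      simp only [Set.mem_preimage, Set.mem_Ioi, Set.mem_ofPred_eq]
      rw [← not_le, ← not_iff_not, not_not, not_not]
      constructor
      · intro h
        have h2 : ∀ᵐ x ∂κ, f x a ≤ c := by
          filter_upwards [enorm_ae_le_eLpNormEssSup (fun x => f x a) κ] with x hx
          exact (enorm_eq_self (f x a) ▸ hx).trans h
        rw [ae_iff] at h2
        simpa using h2
      · intro h
        refine eLpNormEssSup_le_of_ae_enorm_bound ?_
        rw [ae_iff]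
        simpa using h
    rw [h1]
    have h2 : MeasurableSet {w : A × X | c < f w.2 w.1} :=
      measurableSet_lt measurable_const (hf.comp measurable_swap)
    exact (measurable_measure_prodMk_left h2) (measurableSet_singleton 0).compl
  · simp only [eLpNorm_eq_lintegral_rpow_enorm_toReal hp0 hp, enorm_eq_self]
    exact (Measurable.lintegral_prod_left (hf.pow_const _)).pow_const _

/-- Minkowski's integral inequality for nonnegative functions. -/
theorem eLpNorm_lintegral_le (κ : Measure X) [SFinite κ] (lam : Measure A) [SFinite lam] {p : ℝ≥0∞}
    (hp1 : 1 ≤ p) {f : X → A → ℝ≥0∞} (hf : Measurable (Function.uncurry f)) :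
    eLpNorm (fun x => ∫⁻ a, f x a ∂lam) p κ ≤ ∫⁻ a, eLpNorm (fun x => f x a) p κ ∂lam := by
  have hN := measurable_eLpNorm_left κ p hf
  have hfx : ∀ x, Measurable (f x) := fun x => hf.comp measurable_prodMk_left
  have hfa : ∀ a, Measurable fun x => f x a := fun a => hf.comp measurable_prodMk_right
  rcases eq_or_ne p ∞ with rfl | hp
  · simp only [eLpNorm_exponent_top] at hN ⊢
    refine eLpNormEssSup_le_of_ae_enorm_bound ?_
    have h1 : ∀ᵐ x ∂κ, ∀ᵐ a ∂lam, f x a ≤ eLpNormEssSup (fun x => f x a) κ := by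
      have hm : MeasurableSet
          {w : X × A | f w.1 w.2 ≤ eLpNormEssSup (fun x => f x w.2) κ} :=
        measurableSet_le hf (hN.comp measurable_snd)
      rw [Measure.ae_ae_comm hm]
      refine Filter.Eventually.of_forall fun a => ?_
      filter_upwards [enorm_ae_le_eLpNormEssSup (fun x => f x a) κ] with x hx
      exact enorm_eq_self (f x a) ▸ hx
    filter_upwards [h1] with x hx
    exact lintegral_mono_ae hx
  have hp0 : p ≠ 0 := (zero_lt_one.trans_le hp1).ne'
  set P := p.toReal with hP
  have hP1 : 1 ≤ P := by
    rw [hP, ← ENNReal.toReal_one]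
    exact ENNReal.toReal_mono hp hp1
  have hP0 : 0 < P := by linarith
  -- Hölder's inequality is applied to `f = (f ^ P * N ^ (1 - P)) ^ (1 / P) * N ^ (1 - 1 / P)`
  set N : A → ℝ≥0∞ := fun a => eLpNorm (fun x => f x a) p κ with hNdef
  have hNP : ∀ a, N a ^ P = ∫⁻ x, f x a ^ P ∂κ := by
    intro a
    simp only [hNdef, eLpNorm_eq_lintegral_rpow_enorm_toReal hp0 hp, enorm_eq_self]
    rw [← ENNReal.rpow_mul, ← hP, one_div, inv_mul_cancel₀ hP0.ne', ENNReal.rpow_one]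
  set R := ∫⁻ a, N a ∂lam with hR
  rcases eq_or_ne R ∞ with hRt | hRt
  · rw [hRt]; exact le_top
  have hNfin : ∀ᵐ a ∂lam, N a < ∞ := ae_lt_top hN hRt
  have hzero : ∀ᵐ x ∂κ, ∀ᵐ a ∂lam, N a = 0 → f x a = 0 := by
    have hm : MeasurableSet {w : X × A | N w.2 = 0 → f w.1 w.2 = 0} := by
      have h1 : {w : X × A | N w.2 = 0 → f w.1 w.2 = 0}
          = {w : X × A | N w.2 = 0}ᶜ ∪ {w : X × A | f w.1 w.2 = 0} := by
        ext w; simp [imp_iff_not_or]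
      rw [h1]
      exact ((hN.comp measurable_snd) (measurableSet_singleton 0)).compl.union
        (hf (measurableSet_singleton 0))
    rw [Measure.ae_ae_comm hm]
    refine Filter.Eventually.of_forall fun a => ?_
    by_cases ha : N a = 0
    · have h2 := (eLpNorm_eq_zero_iff (hfa a).aestronglyMeasurable hp0).1 ha
      filter_upwards [h2] with x hx _
      simpa using hx
    · exact Filter.Eventually.of_forall fun x h => absurd h ha
  have hpt : ∀ᵐ x ∂κ, (∫⁻ a, f x a ∂lam) ^ P ≤ (∫⁻ a, f x a ^ P * N a ^ (1 - P) ∂lam) * R ^ (P - 1) := by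
    filter_upwards [hzero] with x hx
    have h1 : ∫⁻ a, f x a ∂lam
        ≤ ∫⁻ a, (f x a ^ P * N a ^ (1 - P)) ^ (1 / P) * N a ^ (1 - 1 / P) ∂lam := by
      refine lintegral_mono_ae ?_
      filter_upwards [hx, hNfin] with a ha ha2
      by_cases h0 : N a = 0
      · rw [ha h0]; exact zero_le
      · rw [ENNReal.mul_rpow_of_nonneg _ _ (by positivity), ← ENNReal.rpow_mul, mul_one_div_cancel
          hP0.ne', ENNReal.rpow_one, mul_assoc, ← ENNReal.rpow_mul, ← ENNReal.rpow_add _ _ h0 ha2.ne]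
        have : (1 - P) * (1 / P) + (1 - 1 / P) = 0 := by field_simp; ring
        rw [this, ENNReal.rpow_zero, mul_one]
    have h2 := ENNReal.lintegral_mul_norm_pow_le (μ := lam) (f := fun a => f x a ^ P * N a ^ (1 - P)) (g := N)
      (((hfx x).pow_const _).mul (hN.pow_const _)).aemeasurable hN.aemeasurable
      (p := 1 / P) (q := 1 - 1 / P) (by positivity)
      (by rw [sub_nonneg, div_le_one hP0]; exact hP1) (by ring)
    calc (∫⁻ a, f x a ∂lam) ^ P
        ≤ ((∫⁻ a, f x a ^ P * N a ^ (1 - P) ∂lam) ^ (1 / P) * R ^ (1 - 1 / P)) ^ P :=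
          ENNReal.rpow_le_rpow (h1.trans h2) hP0.le
      _ = _ := by
          rw [ENNReal.mul_rpow_of_nonneg _ _ hP0.le, ← ENNReal.rpow_mul, ← ENNReal.rpow_mul,
            one_div_mul_cancel hP0.ne', ENNReal.rpow_one]
          congr 2
          field_simp
  rw [eLpNorm_eq_lintegral_rpow_enorm_toReal hp0 hp, ← hP]
  simp only [enorm_eq_self]
  rw [one_div, ENNReal.rpow_inv_le_iff hP0]
  have hRP : R ^ (P - 1) ≠ ∞ := ENNReal.rpow_ne_top_of_nonneg (by linarith) hRt
  have hm2 : Measurable (Function.uncurry fun x a => f x a ^ P * N a ^ (1 - P)) :=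
    (hf.pow_const _).mul ((hN.comp measurable_snd).pow_const _)
  calc ∫⁻ x, (∫⁻ a, f x a ∂lam) ^ P ∂κ
      ≤ ∫⁻ x, (∫⁻ a, f x a ^ P * N a ^ (1 - P) ∂lam) * R ^ (P - 1) ∂κ := lintegral_mono_ae hpt
    _ = (∫⁻ a, (∫⁻ x, f x a ^ P * N a ^ (1 - P) ∂κ) ∂lam) * R ^ (P - 1) := by
        rw [lintegral_mul_const' _ _ hRP, lintegral_lintegral_swap hm2.aemeasurable]
    _ = (∫⁻ a, N a ^ P * N a ^ (1 - P) ∂lam) * R ^ (P - 1) := by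
        congr 1
        refine lintegral_congr fun a => ?_
        rw [lintegral_mul_const _ ((hfa a).pow_const _), hNP]
    _ ≤ R * R ^ (P - 1) := by
        gcongr
        refine lintegral_mono_ae ?_
        filter_upwards [hNfin] with a ha
        by_cases h0 : N a = 0
        · rw [h0, ENNReal.zero_rpow_of_pos hP0, zero_mul]
        · rw [← ENNReal.rpow_add _ _ h0 ha.ne]
          simp
    _ = R ^ P := by
        conv_lhs => rw [← ENNReal.rpow_one R, ← ENNReal.rpow_mul, one_mul]
        rw [← ENNReal.rpow_add_of_nonneg _ _ zero_le_one (by linarith)]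
        congr 1
        ring

theorem eLpNorm_const_mul_ennreal (κ : Measure X) (p : ℝ≥0∞) {c : ℝ≥0∞} (hc : c ≠ ∞)
    (f : X → ℝ≥0∞) : eLpNorm (fun x => c * f x) p κ ≤ c * eLpNorm f p κ := by
  lift c to ℝ≥0 using hc
  exact eLpNorm_le_mul_eLpNorm_of_ae_le_mul' (Filter.Eventually.of_forall fun x => by simp) p

/-! ### Fibering the Siegel domain over its base -/

/-- The point `(x + iy', u)` of `ℂ^n × ℂ^m`, for `y = (y', u)`. -/
def joinPt {n m : ℕ} (x : Fin n → ℝ) (y : (Fin n → ℝ) × (Fin m → ℂ)) :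
    (Fin n → ℂ) × (Fin m → ℂ) := (fun k => (x k : ℂ) + (y.1 k : ℂ) * Complex.I, y.2)

theorem measurePreserving_joinPt {n m : ℕ} :
    MeasurePreserving (fun w : (Fin n → ℝ) × ((Fin n → ℝ) × (Fin m → ℂ)) => joinPt w.1 w.2)
      volume volume := by
  have h1 : MeasurePreserving (MeasurableEquiv.prodAssoc (α := Fin n → ℝ) (β := Fin n → ℝ)
      (γ := Fin m → ℂ)).symm volume volume := by
    refine MeasurePreserving.symm _ ?_
    exact volume_preserving_prodAssoc
  have h2 : MeasurePreserving (MeasurableEquiv.arrowProdEquivProdArrow ℝ ℝ (Fin n)).symm :=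
    (volume_measurePreserving_arrowProdEquivProdArrow ℝ ℝ (Fin n)).symm _
  have h3 : MeasurePreserving (fun (g : Fin n → ℝ × ℝ) k => Complex.measurableEquivRealProd.symm (g k)) :=
    volume_preserving_pi fun _ => Complex.volume_preserving_equiv_real_prod.symm _
  have h4 := ((h3.comp h2).prod (MeasurePreserving.id (volume : Measure (Fin m → ℂ)))).comp h1
  have h5 : (fun w : (Fin n → ℝ) × ((Fin n → ℝ) × (Fin m → ℂ)) => joinPt w.1 w.2)
      = Prod.map ((fun (g : Fin n → ℝ × ℝ) k => Complex.measurableEquivRealProd.symm (g k)) ∘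
          (MeasurableEquiv.arrowProdEquivProdArrow ℝ ℝ (Fin n)).symm) id ∘
        (MeasurableEquiv.prodAssoc (α := Fin n → ℝ) (β := Fin n → ℝ) (γ := Fin m → ℂ)).symm := by
    funext w
    refine Prod.ext (funext fun k => ?_) rfl
    change (w.1 k : ℂ) + (w.2.1 k : ℂ) * Complex.I = (⟨w.1 k, w.2.1 k⟩ : ℂ)
    rw [Complex.ext_iff]
    simp
  rw [h5]
  exact h4

theorem measurable_joinPt {n m : ℕ} :
    Measurable fun w : (Fin n → ℝ) × ((Fin n → ℝ) × (Fin m → ℂ)) => joinPt w.1 w.2 :=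
  measurePreserving_joinPt.measurable

theorem joinPt_im {n m : ℕ} (x : Fin n → ℝ) (y : (Fin n → ℝ) × (Fin m → ℂ)) :
    (fun k => ((joinPt x y).1 k).im) = y.1 := by
  ext k; simp [joinPt]

theorem lintegral_eq_joinPt {n m : ℕ} {G : (Fin n → ℂ) × (Fin m → ℂ) → ℝ≥0∞} (hG : Measurable G) :
    ∫⁻ z, G z = ∫⁻ y : (Fin n → ℝ) × (Fin m → ℂ), ∫⁻ x : Fin n → ℝ, G (joinPt x y) := by
  rw [← measurePreserving_joinPt.lintegral_comp hG, Measure.volume_eq_prod,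
    lintegral_prod_symm' (fun w : (Fin n → ℝ) × ((Fin n → ℝ) × (Fin m → ℂ)) => G (joinPt w.1 w.2))
      (hG.comp measurable_joinPt)]

end

/-! ### Schur's test on the base of the domain -/

noncomputable section

/-- Schur's test for the kernel `W(y) A(y, y')` with the test function `φ`; the density `D` is
that of the measure `κ₁` of the target with respect to `κ₂`. -/
theorem lintegral_rpow_le_of_schur {Y : Type*} [MeasurableSpace Y] {κ₁ κ₂ : Measure Y}
    [SFinite κ₁] [SFinite κ₂] {q : ℝ} (hq : 1 ≤ q) {A : Y → Y → ℝ≥0∞}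
    (hA : Measurable (Function.uncurry A)) {W φ D N : Y → ℝ≥0∞} (hW : Measurable W)
    (hφ : Measurable φ) (hN : Measurable N) (hφ0 : ∀ᵐ y ∂κ₂, φ y ≠ 0 ∧ φ y ≠ ∞) {C₁ C₂ : ℝ≥0∞}
    (hC₂ : C₂ ≠ ∞)
    (h1 : ∀ᵐ y ∂κ₁, W y * ∫⁻ y', A y y' * φ y' ∂κ₂ ≤ C₁ * φ y)
    (h2 : ∀ᵐ y' ∂κ₂, ∫⁻ y, A y y' * (W y * φ y ^ (q - 1)) ∂κ₁ ≤ C₂ * (φ y' ^ (q - 1) * D y'))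
    (hD : ∀ G : Y → ℝ≥0∞, Measurable G → ∫⁻ y, G y * D y ∂κ₂ = ∫⁻ y, G y ∂κ₁) :
    ∫⁻ y, (W y * ∫⁻ y', A y y' * N y' ∂κ₂) ^ q ∂κ₁ ≤ C₁ ^ (q - 1) * C₂ * ∫⁻ y, N y ^ q ∂κ₁ := by
  have hq0 : 0 < q := by linarith
  have hAy : ∀ y, Measurable (A y) := fun y => hA.comp measurable_prodMk_left
  have hAy' : ∀ y', Measurable fun y => A y y' := fun y => hA.comp measurable_prodMk_right
  set P : Y → ℝ≥0∞ := fun y' => φ y' ^ (1 - q) * N y' ^ q with hP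
  have hPm : Measurable P := (hφ.pow_const _).mul (hN.pow_const _)
  -- Hölder's inequality for `A N = (A φ^{1-q} N^q)^{1/q} (A φ)^{1-1/q}`
  have hpt : ∀ᵐ y ∂κ₁, (W y * ∫⁻ y', A y y' * N y' ∂κ₂) ^ q ≤
      C₁ ^ (q - 1) * ((W y * φ y ^ (q - 1)) * ∫⁻ y', A y y' * P y' ∂κ₂) := by
    filter_upwards [h1] with y hy
    have e1 : ∫⁻ y', A y y' * N y' ∂κ₂ ≤
        ∫⁻ y', (A y y' * P y') ^ (1 / q) * (A y y' * φ y') ^ (1 - 1 / q) ∂κ₂ := by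
      refine lintegral_mono_ae ?_
      filter_upwards [hφ0] with y' hy'
      have hq1 : (0 : ℝ) ≤ 1 - 1 / q := by rw [sub_nonneg, div_le_one hq0]; exact hq
      have hq2 : (0 : ℝ) ≤ 1 / q := by positivity
      refine le_of_eq ?_
      rw [ENNReal.mul_rpow_of_nonneg _ _ hq2, ENNReal.mul_rpow_of_nonneg _ _ hq1, hP]
      simp only
      rw [ENNReal.mul_rpow_of_nonneg _ _ hq2, ← ENNReal.rpow_mul, ← ENNReal.rpow_mul,
        mul_one_div_cancel hq0.ne', ENNReal.rpow_one]
      calc A y y' * N y'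
          = (A y y' ^ (1 / q) * A y y' ^ (1 - 1 / q)) *
              (φ y' ^ ((1 - q) * (1 / q)) * φ y' ^ (1 - 1 / q)) * N y' := by
            rw [← ENNReal.rpow_add_of_nonneg _ _ hq2 hq1, ← ENNReal.rpow_add _ _ hy'.1 hy'.2]
            have e2 : (1 - q) * (1 / q) + (1 - 1 / q) = 0 := by field_simp; ring
            rw [e2, ENNReal.rpow_zero, mul_one, add_sub_cancel, ENNReal.rpow_one]
        _ = _ := by ring
    have e3 := ENNReal.lintegral_mul_norm_pow_le (μ := κ₂) (f := fun y' => A y y' * P y')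
      (g := fun y' => A y y' * φ y') ((hAy y).mul hPm).aemeasurable
      ((hAy y).mul hφ).aemeasurable (p := 1 / q) (q := 1 - 1 / q) (by positivity)
      (by rw [sub_nonneg, div_le_one hq0]; exact hq) (by ring)
    have hWq : W y ^ q = W y * W y ^ (q - 1) := by
      conv_rhs => rw [← ENNReal.rpow_one (W y), ← ENNReal.rpow_mul, one_mul]
      rw [← ENNReal.rpow_add_of_nonneg _ _ zero_le_one (by linarith)]
      congr 1; ring
    calc (W y * ∫⁻ y', A y y' * N y' ∂κ₂) ^ q
        ≤ (W y * ((∫⁻ y', A y y' * P y' ∂κ₂) ^ (1 / q) *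
            (∫⁻ y', A y y' * φ y' ∂κ₂) ^ (1 - 1 / q))) ^ q := by
          gcongr
          exact e1.trans e3
      _ = (W y * ∫⁻ y', A y y' * P y' ∂κ₂) * (W y * ∫⁻ y', A y y' * φ y' ∂κ₂) ^ (q - 1) := by
          rw [ENNReal.mul_rpow_of_nonneg _ _ hq0.le, ENNReal.mul_rpow_of_nonneg _ _ hq0.le,
            ← ENNReal.rpow_mul, ← ENNReal.rpow_mul, one_div_mul_cancel hq0.ne', ENNReal.rpow_one,
            ENNReal.mul_rpow_of_nonneg _ _ (by linarith : (0 : ℝ) ≤ q - 1), hWq]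
          have : (1 - 1 / q) * q = q - 1 := by field_simp
          rw [this]
          ring
      _ ≤ (W y * ∫⁻ y', A y y' * P y' ∂κ₂) * (C₁ * φ y) ^ (q - 1) := by
          gcongr
      _ = _ := by
          rw [ENNReal.mul_rpow_of_nonneg _ _ (by linarith : (0 : ℝ) ≤ q - 1)]
          ring
  have hm : Measurable (Function.uncurry fun y y' => (W y * φ y ^ (q - 1)) * (A y y' * P y')) :=
    ((hW.comp measurable_fst).mul ((hφ.comp measurable_fst).pow_const _)).mul
      (hA.mul (hPm.comp measurable_snd))
  calc ∫⁻ y, (W y * ∫⁻ y', A y y' * N y' ∂κ₂) ^ q ∂κ₁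
      ≤ ∫⁻ y, C₁ ^ (q - 1) * ((W y * φ y ^ (q - 1)) * ∫⁻ y', A y y' * P y' ∂κ₂) ∂κ₁ :=
        lintegral_mono_ae hpt
    _ = C₁ ^ (q - 1) * ∫⁻ y, (∫⁻ y', (W y * φ y ^ (q - 1)) * (A y y' * P y') ∂κ₂) ∂κ₁ := by
        have e5 : ∀ y, (W y * φ y ^ (q - 1)) * ∫⁻ y', A y y' * P y' ∂κ₂ =
            ∫⁻ y', (W y * φ y ^ (q - 1)) * (A y y' * P y') ∂κ₂ := fun y =>
          (lintegral_const_mul _ ((hAy y).mul hPm)).symm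
        simp only [e5]
        exact lintegral_const_mul _ hm.lintegral_prod_right
    _ = C₁ ^ (q - 1) * ∫⁻ y', P y' * (∫⁻ y, A y y' * (W y * φ y ^ (q - 1)) ∂κ₁) ∂κ₂ := by
        rw [lintegral_lintegral_swap hm.aemeasurable]
        congr 1
        refine lintegral_congr fun y' => ?_
        have e6 : Measurable fun y => A y y' * (W y * φ y ^ (q - 1)) :=
          (hAy' y').mul (hW.mul (hφ.pow_const _))
        rw [← lintegral_const_mul _ e6]
        refine lintegral_congr fun y => ?_
        ring
    _ ≤ C₁ ^ (q - 1) * ∫⁻ y', C₂ * (N y' ^ q * D y') ∂κ₂ := by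
        gcongr 1
        refine lintegral_mono_ae ?_
        filter_upwards [h2, hφ0] with y' hy' h0
        calc P y' * (∫⁻ y, A y y' * (W y * φ y ^ (q - 1)) ∂κ₁)
            ≤ P y' * (C₂ * (φ y' ^ (q - 1) * D y')) := by gcongr
          _ = C₂ * (N y' ^ q * D y') * (φ y' ^ (1 - q) * φ y' ^ (q - 1)) := by
              simp only [hP]; ring
          _ = _ := by
              rw [← ENNReal.rpow_add _ _ h0.1 h0.2]; simp
    _ = C₁ ^ (q - 1) * C₂ * ∫⁻ y, N y ^ q ∂κ₁ := by
        rw [mul_assoc, lintegral_const_mul' _ _ hC₂, hD _ (hN.pow_const _)]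

namespace TAlgebra
variable {r n : ℕ} {U : Type*} [NonUnitalNonAssocRing U] [Module ℝ U]
  [IsScalarTower ℝ U U] [SMulCommClass ℝ U U] [StarRing U] [StarModule ℝ U]
  (T : TAlgebra r U) (e : Module.Basis (Fin n) ℝ (selfAdjoint.submodule ℝ U))
  [FiniteDimensional ℝ U]

theorem measurable_ell (a : Fin r → ℝ) : Measurable (T.ell e a) := by
  have hm : Measurable (Function.uncurry fun (y : Fin n → ℝ) (h : Fin n → ℝ) => ENNReal.ofReal
      (Real.exp (-T.sig e h y) * T.chi e (fun j => a j - (1 + T.nDim j) / 2) h)) := by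
    refine Measurable.ennreal_ofReal ?_
    exact ((T.continuous_sig_uncurry e (A := Fin n → ℝ) (y := fun y => y) continuous_id).measurable.neg.exp).mul
      ((T.measurable_chi e _).comp measurable_snd)
  exact hm.lintegral_prod_right

/-- `ell a` is a constant multiple of `Q^{-a}` on the cone. -/
theorem ell_eq_Qpow (a : Fin r → ℝ) {y : Fin n → ℝ} (hy : y ∈ T.Omega e) :
    T.ell e a y = ENNReal.ofReal (T.Qpow (-a) (point e y)) * T.ell e a (T.psi e (T.xone e)) := by
  obtain ⟨h, hh, rfl⟩ := (T.mem_Omega_iff e).1 hy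
  rw [T.ell_psi e a hh, T.Qpow_psi e _ hh]

end TAlgebra

namespace HermitianForm
variable {r n m : ℕ} {U : Type*} [NonUnitalNonAssocRing U] [Module ℝ U]
  [IsScalarTower ℝ U U] [SMulCommClass ℝ U U] [StarRing U] [StarModule ℝ U]
  {T : TAlgebra r U} {e : Module.Basis (Fin n) ℝ (selfAdjoint.submodule ℝ U)}
variable (F : HermitianForm T e m)
variable [FiniteDimensional ℝ U]

/-- `Q^a (y - F(u, u))` as a nonnegative function on the base. -/
def wt (a : Fin r → ℝ) (y : (Fin n → ℝ) × (Fin m → ℂ)) : ℝ≥0∞ := ENNReal.ofReal (F.weight a y.1 y.2)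

/-- The kernel `ell s (y + y' - F(u, u) - F(u', u') + F(u - u', u - u'))` on the base, which
dominates the integral of the Bergman kernel over the real directions. -/
def baseKer (s : Fin r → ℝ) (y y' : (Fin n → ℝ) × (Fin m → ℂ)) : ℝ≥0∞ :=
  T.ell e s (F.height y.1 y.2 + F.height y'.1 y'.2 + sesqDiag F.mat (y.2 - y'.2))

theorem measurable_wt (a : Fin r → ℝ) : Measurable (F.wt a) :=
  ((T.measurable_Qpow e a).comp F.continuous_height.measurable).ennreal_ofReal

theorem measurable_baseKer (s : Fin r → ℝ) : Measurable (Function.uncurry (F.baseKer s)) := by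
  refine (T.measurable_ell e s).comp (Continuous.measurable ?_)
  have h1 := F.continuous_height
  have h2 := continuous_sesqDiag (M := F.mat)
  exact ((h1.comp continuous_fst).add (h1.comp continuous_snd)).add
    (h2.comp (continuous_fst.snd.sub continuous_snd.snd))

theorem baseKer_comm (s : Fin r → ℝ) (y y' : (Fin n → ℝ) × (Fin m → ℂ)) :
    F.baseKer s y y' = F.baseKer s y' y := by
  rw [baseKer, baseKer, add_comm (F.height y.1 y.2), ← sesqDiag_neg (y.2 - y'.2), neg_sub]

theorem measurableSet_base : MeasurableSet F.base :=
  ((T.isOpen_Omega e).preimage F.continuous_height).measurableSet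

theorem wt_ne_zero (a : Fin r → ℝ) {y : (Fin n → ℝ) × (Fin m → ℂ)} (hy : y ∈ F.base) :
    F.wt a y ≠ 0 := (ENNReal.ofReal_pos.2 (T.Qpow_pos e a hy)).ne'

theorem wt_ne_top (a : Fin r → ℝ) (y : (Fin n → ℝ) × (Fin m → ℂ)) : F.wt a y ≠ ∞ :=
  ENNReal.ofReal_ne_top

theorem wt_add (a b : Fin r → ℝ) {y : (Fin n → ℝ) × (Fin m → ℂ)} (hy : y ∈ F.base) :
    F.wt (a + b) y = F.wt a y * F.wt b y := by
  rw [wt, weight, T.Qpow_add e a b hy, ENNReal.ofReal_mul (T.Qpow_pos e a hy).le]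
  rfl

theorem wt_smul (t : ℝ) (a : Fin r → ℝ) {y : (Fin n → ℝ) × (Fin m → ℂ)} (hy : y ∈ F.base) :
    F.wt (t • a) y = F.wt a y ^ t := by
  rw [wt, weight, wt, weight, ENNReal.ofReal_rpow_of_pos (T.Qpow_pos e a hy)]
  congr 1
  obtain ⟨h, hh, hz⟩ := (T.mem_Omega_iff e).1 hy
  rw [← hz, T.Qpow_psi e _ hh, T.Qpow_psi e _ hh]
  rw [TAlgebra.chi, TAlgebra.chi, ← Real.finsetProd_rpow _ _ (fun j _ => by positivity)]
  refine Finset.prod_congr rfl fun j _ => ?_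
  rw [← Real.rpow_mul (by positivity)]
  congr 1
  simp [mul_comm]

theorem ae_baseV_mem (ν : Fin r → ℝ) : ∀ᵐ y ∂F.baseV ν, y ∈ F.base :=
  (withDensity_absolutelyContinuous _ _).ae_le (ae_restrict_mem F.measurableSet_base)

theorem lintegral_baseV (ν : Fin r → ℝ) {G : (Fin n → ℝ) × (Fin m → ℂ) → ℝ≥0∞}
    (hG : Measurable G) :
    ∫⁻ y, G y ∂F.baseV ν = ∫⁻ y in F.base, F.wt (fun j => ν j - F.b j / 2 - T.tau j) y * G y := by
  rw [baseV]
  exact lintegral_withDensity_eq_lintegral_mul _ (F.measurable_wt _) hG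

theorem lintegral_mul_wt_baseV (ν μ : Fin r → ℝ) {G : (Fin n → ℝ) × (Fin m → ℂ) → ℝ≥0∞}
    (hG : Measurable G) :
    ∫⁻ y, G y * F.wt (ν - μ) y ∂F.baseV μ = ∫⁻ y, G y ∂F.baseV ν := by
  rw [lintegral_baseV _ _ (G := fun y => G y * F.wt (ν - μ) y) (hG.mul (F.measurable_wt _)), lintegral_baseV _ _ hG]
  refine setLIntegral_congr_fun F.measurableSet_base fun y hy => ?_
  rw [mul_comm (G y), ← mul_assoc, ← F.wt_add _ _ hy]
  congr 2
  funext j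
  simp only [Pi.add_apply, Pi.sub_apply]
  ring

/-- Translation by `F(u', u')` turns the inner integral into an integral over the cone; the integral
over `u'` is then that of `ell` over the values of the form. -/
theorem lintegral_baseKer_base {a : Fin r → ℝ} (ha : ∀ j, (T.mDim j : ℝ) / 2 < a j)
    (s : Fin r → ℝ) (y : (Fin n → ℝ) × (Fin m → ℂ)) :
    ∫⁻ y' in F.base, F.baseKer s y y' * F.wt (fun j => a j - T.tau j) y' =
      T.gam e a * (F.gauss * T.ell e (fun j => s j - a j - F.b j) (F.height y.1 y.2)) := by
  have hm : Measurable (F.base.indicator fun y' =>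
      F.baseKer s y y' * F.wt (fun j => a j - T.tau j) y') :=
    (((F.measurable_baseKer s).comp measurable_prodMk_left).mul
      (F.measurable_wt _)).indicator F.measurableSet_base
  rw [← lintegral_indicator F.measurableSet_base, Measure.volume_eq_prod,
    lintegral_prod_symm' _ hm]
  have h1 : ∀ u' : Fin m → ℂ, ∫⁻ x : Fin n → ℝ, F.base.indicator (fun y' =>
      F.baseKer s y y' * F.wt (fun j => a j - T.tau j) y') (x, u') =
      T.gam e a * T.ell e (fun j => s j - a j)
        (F.height y.1 y.2 + sesqDiag F.mat (y.2 - u')) := by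
    intro u'
    rw [← T.lintegral_ell_add e ha, ← lintegral_indicator (T.measurableSet_Omega e)]
    refine Eq.trans (lintegral_congr fun x => ?_)
      (lintegral_sub_right_eq_self _ (sesqDiag F.mat u'))
    have h2 : x - sesqDiag F.mat u' = F.height x u' := rfl
    rw [h2]
    by_cases hx : F.height x u' ∈ T.Omega e
    · rw [Set.indicator_of_mem (show (x, u') ∈ F.base from hx), Set.indicator_of_mem hx, baseKer,
        add_right_comm]
      rfl
    · rw [Set.indicator_of_notMem (show (x, u') ∉ F.base from hx), Set.indicator_of_notMem hx]
  simp only [h1]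
  have h3 : Measurable fun u : Fin m → ℂ => T.ell e (fun j => s j - a j)
      (F.height y.1 y.2 + sesqDiag F.mat u) :=
    (T.measurable_ell e _).comp
      (measurable_const.add (continuous_sesqDiag (M := F.mat)).measurable)
  have h4 : Measurable fun u : Fin m → ℂ => T.ell e (fun j => s j - a j)
      (F.height y.1 y.2 + sesqDiag F.mat (y.2 - u)) :=
    h3.comp (measurable_const.sub measurable_id)
  rw [lintegral_const_mul _ h4,
    lintegral_sub_left_eq_self (fun u => T.ell e (fun j => s j - a j)
      (F.height y.1 y.2 + sesqDiag F.mat u)) y.2, F.lintegral_ell_add_sesqDiag]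

/-- The operator with kernel `baseKer s` maps a power of `Q` to a multiple of a power of `Q`. The two
conditions are those for the convergence of the Gamma integral and of the resulting `ell`. -/
theorem exists_lintegral_baseKer_mul_wt {s σ μ : Fin r → ℝ}
    (h1 : ∀ j, ((T.mDim j : ℝ) + F.b j) / 2 < σ j + μ j)
    (h2 : ∀ j, (T.nDim j : ℝ) / 2 + σ j + μ j + F.b j / 2 < s j) :
    ∃ C : ℝ≥0∞, C ≠ ∞ ∧ ∀ y ∈ F.base, ∫⁻ y', F.baseKer s y y' * F.wt σ y' ∂F.baseV μ =
      C * F.wt (fun j => σ j + μ j + F.b j / 2 - s j) y := by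
  set a : Fin r → ℝ := fun j => σ j + μ j - F.b j / 2 with hadef
  have ha : ∀ j, (T.mDim j : ℝ) / 2 < a j := fun j => by
    have := h1 j
    simp only [hadef]; linarith
  have hs : ∀ j, (T.nDim j : ℝ) / 2 < s j - a j - F.b j := fun j => by
    have := h2 j
    simp only [hadef]; linarith
  refine ⟨T.gam e a * (F.gauss * T.ell e (fun j => s j - a j - F.b j) (T.psi e (T.xone e))), ?_,
    fun y hy => ?_⟩
  · exact (ENNReal.mul_lt_top (T.gam_lt_top e ha) (ENNReal.mul_lt_top F.gauss_lt_top
      (T.ell_xone_lt_top e hs))).ne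
  · have e0 : Measurable fun y' => F.baseKer s y y' * F.wt σ y' :=
      ((F.measurable_baseKer s).comp measurable_prodMk_left).mul (F.measurable_wt _)
    rw [F.lintegral_baseV _ e0]
    have e1 : ∫⁻ y' in F.base, F.wt (fun j => μ j - F.b j / 2 - T.tau j) y' *
        (F.baseKer s y y' * F.wt σ y') =
        ∫⁻ y' in F.base, F.baseKer s y y' * F.wt (fun j => a j - T.tau j) y' := by
      refine setLIntegral_congr_fun F.measurableSet_base fun y' hy' => ?_
      rw [mul_left_comm, ← F.wt_add _ _ hy']
      congr 2
      funext j
      simp only [Pi.add_apply, hadef]; ring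
    refine e1.trans ?_
    rw [F.lintegral_baseKer_base ha, T.ell_eq_Qpow e _ hy]
    have e2 : -(fun j => s j - a j - (F.b j : ℝ)) = fun j => σ j + μ j + F.b j / 2 - s j := by
      funext j
      simp only [Pi.neg_apply, hadef]; ring
    rw [e2]
    simp only [wt, weight]
    ring

end HermitianForm

end

/-! ### Mixed norm estimates for the positive operator -/

noncomputable section

theorem exists_between_mul {t L₁ U₁ L₂ U₂ : ℝ} (ht : 0 ≤ t) (h1 : L₁ < U₁) (h2 : L₂ < U₂)
    (h3 : L₁ * t < U₂) (h4 : L₂ < U₁ * t) :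
    ∃ x, L₁ < x ∧ x < U₁ ∧ L₂ < x * t ∧ x * t < U₂ := by
  rcases ht.eq_or_lt with rfl | ht
  · obtain ⟨x, hx1, hx2⟩ := exists_between h1
    exact ⟨x, hx1, hx2, by simpa using h4, by simpa using h3⟩
  · have h5 : max L₁ (L₂ / t) < min U₁ (U₂ / t) := by
      rw [max_lt_iff, lt_min_iff, lt_min_iff]
      exact ⟨⟨h1, by rwa [lt_div_iff₀ ht]⟩, by rwa [div_lt_iff₀ ht],
        div_lt_div_of_pos_right h2 ht⟩
    obtain ⟨x, hx1, hx2⟩ := exists_between h5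
    rw [max_lt_iff, div_lt_iff₀ ht] at hx1
    rw [lt_min_iff, lt_div_iff₀ ht] at hx2
    exact ⟨x, hx1.1, hx2.1, hx1.2, hx2.2⟩

namespace HermitianForm
variable {r n m : ℕ} {U : Type*} [NonUnitalNonAssocRing U] [Module ℝ U]
  [IsScalarTower ℝ U U] [SMulCommClass ℝ U U] [StarRing U] [StarModule ℝ U]
  {T : TAlgebra r U} {e : Module.Basis (Fin n) ℝ (selfAdjoint.submodule ℝ U)}
variable (F : HermitianForm T e m)
variable [FiniteDimensional ℝ U]

instance (ν : Fin r → ℝ) : SFinite (F.baseV ν) := by unfold baseV; infer_instance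

instance (ν : Fin r → ℝ) : SFinite (F.V ν) := by unfold V; infer_instance

theorem wt_zero {y : (Fin n → ℝ) × (Fin m → ℂ)} (hy : y ∈ F.base) : F.wt 0 y = 1 := by
  have := F.wt_smul 0 0 hy
  simpa using this

theorem ae_baseV_iff (ν : Fin r → ℝ) {P : (Fin n → ℝ) × (Fin m → ℂ) → Prop} :
    (∀ᵐ y ∂F.baseV ν, P y) ↔ ∀ᵐ y, y ∈ F.base → P y := by
  have h : Measurable fun y : (Fin n → ℝ) × (Fin m → ℂ) =>
      ENNReal.ofReal (F.weight (fun j => ν j - F.b j / 2 - T.tau j) y.1 y.2) := F.measurable_wt _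
  rw [baseV, ae_withDensity_iff h, ae_restrict_iff' F.measurableSet_base]
  refine Filter.eventually_congr (Filter.Eventually.of_forall fun y => ?_)
  exact ⟨fun h hy => h hy (F.wt_ne_zero _ hy), fun h hy _ => h hy⟩

/-- The operator on the base with the kernel `baseKer` is bounded on the weighted `L^q`. For `q < ∞`
this is Schur's test with a power `Q^κ` as test function; the hypotheses say that `κ` exists. -/
theorem exists_eLpNorm_baseKer_le {α ν μ : Fin r → ℝ} {q : ℝ≥0∞} (hq : 1 ≤ q)
    (h₁ : ∀ j, μ j + α j > ((T.mDim j : ℝ) + T.nDim j + F.b j) / 2)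
    (h₂ : q ≠ ∞ → ∀ j,
      μ j * q.toReal - ν j
          > (q.toReal - 1) * ((T.mDim j : ℝ) / 2 + (F.b j : ℝ) / 2) + (T.nDim j : ℝ) / 2 ∧
      α j * q.toReal + ν j
          > (T.mDim j : ℝ) / 2 + (F.b j : ℝ) / 2 + (q.toReal - 1) * ((T.nDim j : ℝ) / 2))
    (h₃ : q = ∞ → ∀ j,
      μ j > (T.mDim j : ℝ) / 2 + (F.b j : ℝ) / 2 ∧ α j > (T.nDim j : ℝ) / 2) :
    ∃ C : ℝ≥0∞, C ≠ ∞ ∧ ∀ N : (Fin n → ℝ) × (Fin m → ℂ) → ℝ≥0∞, Measurable N →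
      eLpNorm (fun y => F.wt α y *
        ∫⁻ y', F.baseKer (fun j => μ j + α j + F.b j / 2) y y' * N y' ∂F.baseV μ) q (F.baseV ν) ≤
        C * eLpNorm N q (F.baseV ν) := by
  rcases eq_or_ne q ∞ with rfl | hqt
  · obtain ⟨C, hC, hCy⟩ := F.exists_lintegral_baseKer_mul_wt (σ := 0) (μ := μ)
      (s := fun j => μ j + α j + F.b j / 2)
      (fun j => by have := (h₃ rfl j).1; simp only [Pi.zero_apply]; linarith)
      (fun j => by have := (h₃ rfl j).2; simp only [Pi.zero_apply]; linarith)
    refine ⟨C, hC, fun N hN => ?_⟩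
    rw [eLpNorm_exponent_top, eLpNorm_exponent_top]
    refine eLpNormEssSup_le_of_ae_enorm_bound ?_
    -- the measures `baseV μ` and `baseV ν` have the same null sets
    have hNb : ∀ᵐ y ∂F.baseV μ, N y ≤ eLpNormEssSup N (F.baseV ν) := by
      have h1 : ∀ᵐ y ∂F.baseV ν, N y ≤ eLpNormEssSup N (F.baseV ν) := by
        filter_upwards [enorm_ae_le_eLpNormEssSup N (F.baseV ν)] with y hy
        exact enorm_eq_self (N y) ▸ hy
      exact (F.ae_baseV_iff μ).2 ((F.ae_baseV_iff ν).1 h1)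
    filter_upwards [F.ae_baseV_mem ν] with y hy
    rw [enorm_eq_self]
    have hk : Measurable (F.baseKer (fun j => μ j + α j + F.b j / 2) y) :=
      (F.measurable_baseKer (fun j => μ j + α j + F.b j / 2)).of_uncurry_left
    have hk0 : Measurable fun y' =>
        F.baseKer (fun j => μ j + α j + F.b j / 2) y y' * F.wt 0 y' := hk.mul (F.measurable_wt 0)
    calc F.wt α y * ∫⁻ y', F.baseKer (fun j => μ j + α j + F.b j / 2) y y' * N y' ∂F.baseV μ
        ≤ F.wt α y * ∫⁻ y', F.baseKer (fun j => μ j + α j + F.b j / 2) y y' * F.wt 0 y' *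
            eLpNormEssSup N (F.baseV ν) ∂F.baseV μ := by
          gcongr 1
          refine lintegral_mono_ae ?_
          filter_upwards [hNb, F.ae_baseV_mem μ] with y' h1 h2
          rw [F.wt_zero h2, mul_one]
          gcongr
      _ = C * eLpNormEssSup N (F.baseV ν) * (F.wt α y * F.wt (-α) y) := by
          rw [lintegral_mul_const _ hk0, hCy y hy]
          have : (fun j => (0 : Fin r → ℝ) j + μ j + (F.b j : ℝ) / 2 -
              (μ j + α j + (F.b j : ℝ) / 2)) = -α := by
            funext j; simp only [Pi.zero_apply, Pi.neg_apply]; ring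
          rw [this]
          ring
      _ = _ := by
          rw [← F.wt_add _ _ hy, add_neg_cancel, F.wt_zero hy, mul_one]
  set Q := q.toReal with hQ
  have hQ1 : 1 ≤ Q := by
    rw [hQ, ← ENNReal.toReal_one]
    exact ENNReal.toReal_mono hqt hq
  have hQ0 : 0 < Q := by linarith
  have hq0 : q ≠ 0 := (zero_lt_one.trans_le hq).ne'
  -- the first two bounds make the image of `Q^κ` finite, the other two that of `Q^(α + (q - 1) κ)`
  -- under the transposed operator
  have hκ : ∀ j, ∃ x, ((T.mDim j : ℝ) + F.b j) / 2 - μ j < x ∧ x < α j - T.nDim j / 2 ∧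
      ((T.mDim j : ℝ) + F.b j) / 2 - α j - ν j < x * (Q - 1) ∧
      x * (Q - 1) < μ j - ν j - T.nDim j / 2 := by
    intro j
    have := h₁ j
    obtain ⟨h5, h6⟩ := h₂ hqt j
    exact exists_between_mul (by linarith) (by linarith) (by linarith) (by linarith)
      (by linarith)
  choose κ k1 k2 k3 k4 using hκ
  obtain ⟨C₁, hC₁, hCy₁⟩ := F.exists_lintegral_baseKer_mul_wt (σ := κ) (μ := μ)
    (s := fun j => μ j + α j + F.b j / 2)
    (fun j => by have := k1 j; linarith) (fun j => by have := k2 j; linarith)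
  obtain ⟨C₂, hC₂, hCy₂⟩ := F.exists_lintegral_baseKer_mul_wt (σ := α + (Q - 1) • κ) (μ := ν)
    (s := fun j => μ j + α j + F.b j / 2)
    (fun j => by
      have := k3 j
      simp only [Pi.add_apply, Pi.smul_apply, smul_eq_mul]; linarith)
    (fun j => by
      have := k4 j
      simp only [Pi.add_apply, Pi.smul_apply, smul_eq_mul]; linarith)
  refine ⟨(C₁ ^ (Q - 1) * C₂) ^ (1 / Q), ?_, fun N hN => ?_⟩
  · exact ENNReal.rpow_ne_top_of_nonneg (by positivity)
      (ENNReal.mul_ne_top (ENNReal.rpow_ne_top_of_nonneg (by linarith) hC₁) hC₂)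
  have key := lintegral_rpow_le_of_schur (κ₁ := F.baseV ν) (κ₂ := F.baseV μ) hQ1
    (F.measurable_baseKer (fun j => μ j + α j + F.b j / 2)) (W := F.wt α) (φ := F.wt κ)
    (D := F.wt (ν - μ)) (N := N) (F.measurable_wt _) (F.measurable_wt _) hN
    ((F.ae_baseV_mem μ).mono fun y hy => ⟨F.wt_ne_zero _ hy, F.wt_ne_top _ _⟩)
    (C₁ := C₁) (C₂ := C₂) hC₂ ?_ ?_ (fun G hG => F.lintegral_mul_wt_baseV ν μ hG)
  · rw [eLpNorm_eq_lintegral_rpow_enorm_toReal hq0 hqt,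
      eLpNorm_eq_lintegral_rpow_enorm_toReal hq0 hqt, ← hQ]
    simp only [enorm_eq_self]
    rw [← ENNReal.mul_rpow_of_nonneg _ _ (by positivity)]
    exact ENNReal.rpow_le_rpow key (by positivity)
  · filter_upwards [F.ae_baseV_mem ν] with y hy
    rw [hCy₁ y hy, mul_left_comm, ← F.wt_add _ _ hy]
    refine le_of_eq ?_
    congr 2
    funext j; simp only [Pi.add_apply]; ring
  · filter_upwards [F.ae_baseV_mem μ] with y' hy'
    have e1 : ∫⁻ y, F.baseKer (fun j => μ j + α j + F.b j / 2) y y' *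
        (F.wt α y * F.wt κ y ^ (Q - 1)) ∂F.baseV ν =
        ∫⁻ y, F.baseKer (fun j => μ j + α j + F.b j / 2) y' y *
          F.wt (α + (Q - 1) • κ) y ∂F.baseV ν := by
      refine lintegral_congr_ae ?_
      filter_upwards [F.ae_baseV_mem ν] with y hy
      rw [F.baseKer_comm, F.wt_add _ _ hy, F.wt_smul _ _ hy]
    rw [e1, hCy₂ y' hy', ← F.wt_smul _ _ hy', ← F.wt_add _ _ hy']
    refine le_of_eq ?_
    congr 2
    funext j; simp only [Pi.add_apply, Pi.sub_apply, Pi.smul_apply, smul_eq_mul]; ring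

theorem joinPt_mem_domain {x : Fin n → ℝ} {y : (Fin n → ℝ) × (Fin m → ℂ)} :
    joinPt x y ∈ F.domain ↔ y ∈ F.base := by
  rw [mem_domain, joinPt_im]; rfl

theorem lintegral_V_eq_joinPt (μ : Fin r → ℝ) {G : (Fin n → ℂ) × (Fin m → ℂ) → ℝ≥0∞}
    (hG : Measurable G) :
    ∫⁻ z, G z ∂F.V μ = ∫⁻ y, (∫⁻ x : Fin n → ℝ, G (joinPt x y)) ∂F.baseV μ := by
  have hDm := F.isOpen_domain.measurableSet
  set w : (Fin n → ℂ) × (Fin m → ℂ) → ℝ≥0∞ := fun z => ENNReal.ofReal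
    (F.weight (fun j => μ j - F.b j / 2 - T.tau j) (fun k => (z.1 k).im) z.2) with hw
  have hwm : Measurable w := (F.measurable_weightC _).ennreal_ofReal
  have hGj : Measurable fun p : (Fin n → ℝ) × ((Fin n → ℝ) × (Fin m → ℂ)) => G (joinPt p.1 p.2) :=
    hG.comp measurable_joinPt
  have h1 : ∫⁻ z, G z ∂F.V μ = ∫⁻ z, F.domain.indicator (fun z => w z * G z) z := by
    rw [lintegral_indicator hDm, V]
    exact lintegral_withDensity_eq_lintegral_mul _ hwm hG
  have hwG : Measurable (F.domain.indicator fun z => w z * G z) := (hwm.mul hG).indicator hDm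
  rw [h1, lintegral_eq_joinPt hwG,
    F.lintegral_baseV μ hGj.lintegral_prod_left', ← lintegral_indicator F.measurableSet_base]
  refine lintegral_congr fun y => ?_
  by_cases hy : y ∈ F.base
  · rw [Set.indicator_of_mem hy, ← lintegral_const_mul' _ _ (F.wt_ne_top _ _)]
    refine lintegral_congr fun x => ?_
    rw [Set.indicator_of_mem (F.joinPt_mem_domain.2 hy), hw]
    simp only [joinPt_im]
    rfl
  · rw [Set.indicator_of_notMem hy]
    simp only [Set.indicator_of_notMem (fun h => hy (F.joinPt_mem_domain.1 h)), lintegral_zero]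

theorem kerArg_joinPt (x x' : Fin n → ℝ) (y y' : (Fin n → ℝ) × (Fin m → ℂ)) :
    F.kerArg (joinPt x y) (joinPt x' y') = F.kerArg (joinPt (x - x') y) (joinPt 0 y') := by
  funext k
  simp only [kerArg, joinPt, map_add, map_mul, Complex.conj_ofReal, Complex.conj_I, Pi.sub_apply,
    Pi.zero_apply, Complex.ofReal_sub, Complex.ofReal_zero, map_zero]
  ring

/-- The argument of the kernel, with the scaled and translated `x` as imaginary part. -/
theorem kerArg_joinPt_zero (x : Fin n → ℝ) (y y' : (Fin n → ℝ) × (Fin m → ℂ)) :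
    F.kerArg (joinPt x y) (joinPt 0 y') = fun k =>
      ((((1 / 2 : ℝ) • (F.height y.1 y.2 + F.height y'.1 y'.2 + sesqDiag F.mat (y.2 - y'.2)))
        k : ℝ) : ℂ) + Complex.I * ((((-1 / 2 : ℝ) • LinearMap.id (R := ℝ) (M := Fin n → ℝ)) x +
        fun k => (F.kerArg (joinPt 0 y) (joinPt 0 y') k).im) k : ℝ) := by
  funext k
  have h1 := congrFun (F.kerArg_re (joinPt x y) (joinPt 0 y')) k
  simp only [joinPt_im] at h1
  refine Complex.ext ?_ ?_
  · simp only [Complex.add_re, Complex.mul_re, Complex.I_re, Complex.I_im, Complex.ofReal_re,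
      Complex.ofReal_im]
    rw [h1]
    simp [joinPt]
  · have h2 : F.kerArg (joinPt x y) (joinPt 0 y') k =
        F.kerArg (joinPt 0 y) (joinPt 0 y') k + ((-1 / 2 * x k : ℝ) : ℂ) * Complex.I := by
      simp only [kerArg, joinPt, Pi.zero_apply, Complex.ofReal_zero, zero_add]
      push_cast
      field_simp
      rw [Complex.I_sq]
      ring
    rw [h2]
    simp
    ring

/-- The integral of the kernel over the real directions. -/
theorem exists_lintegral_lap_kerArg_le {s : Fin r → ℝ} (hs : ∀ j, (T.nDim j : ℝ) / 2 < s j)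
    (hs2 : ∀ j, (T.nDim j : ℝ) / 2 < s j / 2) :
    ∃ C : ℝ≥0∞, C ≠ ∞ ∧ ∀ y ∈ F.base, ∀ y' ∈ F.base,
      ∫⁻ x : Fin n → ℝ, ‖T.lap e s (F.kerArg (joinPt x y) (joinPt 0 y'))‖ₑ ≤
        C * F.baseKer (fun j => s j - T.tau j) y y' := by
  obtain ⟨C, hC, hCY⟩ := T.lintegral_enorm_lap_le e hs hs2
  set f : (Fin n → ℝ) →ₗ[ℝ] (Fin n → ℝ) := (-1 / 2 : ℝ) • LinearMap.id with hf
  have hdet : LinearMap.det f ≠ 0 := by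
    rw [hf, LinearMap.det_smul]
    simp
  refine ⟨ENNReal.ofReal |(LinearMap.det f)⁻¹| * C,
    ENNReal.mul_ne_top ENNReal.ofReal_ne_top hC.ne, fun y hy y' hy' => ?_⟩
  set Y : Fin n → ℝ :=
    (1 / 2 : ℝ) • (F.height y.1 y.2 + F.height y'.1 y'.2 + sesqDiag F.mat (y.2 - y'.2)) with hY
  have hYm : Y ∈ T.Omega e :=
    T.smul_mem_Omega e (T.add_mem_Omega e (T.add_mem_Omega e hy (subset_closure hy'))
      (F.mem_closure _)) (by norm_num)
  set d : Fin n → ℝ := fun k => (F.kerArg (joinPt 0 y) (joinPt 0 y') k).im with hd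
  have h1 : ∀ x, F.kerArg (joinPt x y) (joinPt 0 y') =
      fun k => (Y k : ℂ) + Complex.I * ((f x + d) k : ℝ) := fun x => F.kerArg_joinPt_zero x y y'
  simp only [h1]
  rw [lintegral_comp_linearMap volume f hdet
    (fun X => ‖T.lap e s (fun k => (Y k : ℂ) + Complex.I * ((X + d) k : ℝ))‖ₑ),
    lintegral_add_right_eq_self
      (fun X : Fin n → ℝ => ‖T.lap e s (fun k => (Y k : ℂ) + Complex.I * (X k : ℝ))‖ₑ) d, mul_assoc]
  gcongr
  refine (hCY Y hYm).trans (le_of_eq ?_)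
  rw [baseKer, hY, smul_smul]
  norm_num

end HermitianForm

end

noncomputable section

theorem measurable_joinPt_left {n m : ℕ} (y : (Fin n → ℝ) × (Fin m → ℂ)) :
    Measurable fun x : Fin n → ℝ => joinPt x y :=
  (measurable_joinPt (n := n) (m := m)).comp (measurable_id.prodMk measurable_const)

theorem enorm_complex_ofReal (x : ℝ) : ‖(x : ℂ)‖ₑ = ‖x‖ₑ := by
  rw [← ofReal_norm, Complex.norm_real, ofReal_norm]

namespace HermitianForm
variable {r n m : ℕ} {U : Type*} [NonUnitalNonAssocRing U] [Module ℝ U]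
  [IsScalarTower ℝ U U] [SMulCommClass ℝ U U] [StarRing U] [StarModule ℝ U]
  {T : TAlgebra r U} {e : Module.Basis (Fin n) ℝ (selfAdjoint.submodule ℝ U)}
variable (F : HermitianForm T e m)
variable [FiniteDimensional ℝ U]

/-- The explicit form `c * lap s ((z - w̄) / 2i - F(u, t))` of the Bergman kernel. -/
def modelKer (c : ℂ) (s : Fin r → ℝ) (z w : (Fin n → ℂ) × (Fin m → ℂ)) : ℂ :=
  c * T.lap e s (F.kerArg z w)

theorem measurable_modelKer (c : ℂ) (s : Fin r → ℝ) :
    Measurable (Function.uncurry (F.modelKer c s)) := by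
  refine measurable_const.mul ((T.measurable_lap e s).comp (Continuous.measurable ?_))
  refine continuous_pi fun k => ?_
  have h1 : Continuous fun p : ((Fin n → ℂ) × (Fin m → ℂ)) × ((Fin n → ℂ) × (Fin m → ℂ)) =>
      sesq F.mat p.1.2 p.2.2 k :=
    (continuous_apply k).comp ((continuous_sesq (M := F.mat)).comp
      (continuous_fst.snd.prodMk continuous_snd.snd))
  have h2 : Continuous fun p : ((Fin n → ℂ) × (Fin m → ℂ)) × ((Fin n → ℂ) × (Fin m → ℂ)) =>
      conj (p.2.1 k) := Complex.continuous_conj.comp (by fun_prop)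
  exact ((by fun_prop : Continuous fun p : ((Fin n → ℂ) × (Fin m → ℂ)) ×
    ((Fin n → ℂ) × (Fin m → ℂ)) => p.1.1 k).sub h2).div_const _ |>.sub h1

/-- The positive operator with kernel `|modelKer c s|`, on nonnegative functions. -/
def posOp (c : ℂ) (s α μ : Fin r → ℝ) (g : (Fin n → ℂ) × (Fin m → ℂ) → ℝ≥0∞)
    (z : (Fin n → ℂ) × (Fin m → ℂ)) : ℝ≥0∞ :=
  ENNReal.ofReal (F.weight α (fun k => (z.1 k).im) z.2) *
    ∫⁻ w, ‖F.modelKer c s z w‖ₑ * g w ∂F.V μ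

theorem measurable_posOp (c : ℂ) (s α μ : Fin r → ℝ) {g : (Fin n → ℂ) × (Fin m → ℂ) → ℝ≥0∞}
    (hg : Measurable g) : Measurable (F.posOp c s α μ g) := by
  refine (F.measurable_weightC _).ennreal_ofReal.mul ?_
  have h : Measurable (Function.uncurry fun z w => ‖F.modelKer c s z w‖ₑ * g w) :=
    (F.measurable_modelKer c s).enorm.mul (hg.comp measurable_snd)
  exact h.lintegral_prod_right

theorem measurable_modelKer_joinPt (c : ℂ) (s : Fin r → ℝ) (y : (Fin n → ℝ) × (Fin m → ℂ)) :
    Measurable fun w : ((Fin n → ℝ) × (Fin m → ℂ)) × (Fin n → ℝ) =>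
      ‖F.modelKer c s (joinPt w.2 y) (joinPt 0 w.1)‖ₑ := by
  have h2 : Measurable fun y' : (Fin n → ℝ) × (Fin m → ℂ) => joinPt (0 : Fin n → ℝ) y' :=
    measurable_joinPt.comp measurable_prodMk_left
  exact ((F.measurable_modelKer c s).comp (((measurable_joinPt_left y).comp measurable_snd).prodMk
    (h2.comp measurable_fst))).enorm

theorem measurable_modelKer_mul_joinPt (c : ℂ) (s : Fin r → ℝ)
    {g : (Fin n → ℂ) × (Fin m → ℂ) → ℝ≥0∞} (hg : Measurable g)
    (y : (Fin n → ℝ) × (Fin m → ℂ)) :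
    Measurable (Function.uncurry fun (x : Fin n → ℝ)
      (w : ((Fin n → ℝ) × (Fin m → ℂ)) × (Fin n → ℝ)) =>
        ‖F.modelKer c s (joinPt w.2 y) (joinPt 0 w.1)‖ₑ * g (joinPt (x - w.2) w.1)) :=
  ((F.measurable_modelKer_joinPt c s y).comp measurable_snd).mul ((hg.comp measurable_joinPt).comp
    ((measurable_fst.sub measurable_snd.snd).prodMk measurable_snd.fst))

theorem posOp_joinPt (c : ℂ) (s α μ : Fin r → ℝ) {g : (Fin n → ℂ) × (Fin m → ℂ) → ℝ≥0∞}
    (hg : Measurable g) (x : Fin n → ℝ) (y : (Fin n → ℝ) × (Fin m → ℂ)) :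
    F.posOp c s α μ g (joinPt x y) = F.wt α y *
      ∫⁻ w, ‖F.modelKer c s (joinPt w.2 y) (joinPt 0 w.1)‖ₑ * g (joinPt (x - w.2) w.1)
        ∂(F.baseV μ).prod volume := by
  have hG : Measurable fun w => ‖F.modelKer c s (joinPt x y) w‖ₑ * g w :=
    (F.measurable_modelKer c s).of_uncurry_left.enorm.mul hg
  rw [posOp, joinPt_im, F.lintegral_V_eq_joinPt μ hG,
    lintegral_prod _ (F.measurable_modelKer_mul_joinPt c s hg y).of_uncurry_left.aemeasurable]
  refine congrArg (F.wt α y * ·) (lintegral_congr fun y' => ?_)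
  -- the kernel depends on `x - x'` only; `ξ = x - x'` is the new variable
  rw [← lintegral_sub_left_eq_self _ x]
  refine lintegral_congr fun ξ => ?_
  simp only [modelKer]
  rw [F.kerArg_joinPt x (x - ξ), sub_sub_cancel]

/-- The operator acts in the real directions by convolution, so Minkowski's inequality reduces
it to an operator on the base. -/
theorem eLpNorm_posOp_le (c : ℂ) (s α μ : Fin r → ℝ) {g : (Fin n → ℂ) × (Fin m → ℂ) → ℝ≥0∞}
    (hg : Measurable g) {p : ℝ≥0∞} (hp : 1 ≤ p) (y : (Fin n → ℝ) × (Fin m → ℂ)) :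
    eLpNorm (fun x => F.posOp c s α μ g (joinPt x y)) p volume ≤
      F.wt α y * ∫⁻ y', (∫⁻ x, ‖F.modelKer c s (joinPt x y) (joinPt 0 y')‖ₑ) *
        eLpNorm (fun x => g (joinPt x y')) p volume ∂F.baseV μ := by
  set k : (Fin n → ℝ) → (Fin n → ℝ) × (Fin m → ℂ) → ℝ≥0∞ := fun x y' =>
    ‖F.modelKer c s (joinPt x y) (joinPt 0 y')‖ₑ with hk
  have hgx : ∀ y', Measurable fun x => g (joinPt x y') := fun y' =>
    hg.comp (measurable_joinPt_left y')
  have hkm : Measurable fun w : ((Fin n → ℝ) × (Fin m → ℂ)) × (Fin n → ℝ) => k w.2 w.1 :=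
    F.measurable_modelKer_joinPt c s y
  have hH := F.measurable_modelKer_mul_joinPt c s hg y
  simp only [F.posOp_joinPt c s α μ hg]
  refine (eLpNorm_const_mul_ennreal _ _ (F.wt_ne_top _ _) _).trans ?_
  gcongr
  refine (eLpNorm_lintegral_le _ _ hp hH).trans ?_
  have h2 : ∀ w : ((Fin n → ℝ) × (Fin m → ℂ)) × (Fin n → ℝ),
      eLpNorm (fun x => k w.2 w.1 * g (joinPt (x - w.2) w.1)) p volume ≤
        k w.2 w.1 * eLpNorm (fun x => g (joinPt x w.1)) p volume := by
    intro w
    refine (eLpNorm_const_mul_ennreal _ _ enorm_ne_top _).trans (le_of_eq ?_)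
    congr 1
    exact eLpNorm_comp_measurePreserving (hgx w.1).aestronglyMeasurable
      (measurePreserving_sub_right volume w.2)
  refine (lintegral_mono h2).trans (le_of_eq ?_)
  have hN : Measurable fun y' : (Fin n → ℝ) × (Fin m → ℂ) =>
      eLpNorm (fun x => g (joinPt x y')) p volume :=
    measurable_eLpNorm_left volume p (f := fun x y' => g (joinPt x y'))
      (hg.comp measurable_joinPt)
  have h3 : Measurable fun w : ((Fin n → ℝ) × (Fin m → ℂ)) × (Fin n → ℝ) =>
      k w.2 w.1 * eLpNorm (fun x => g (joinPt x w.1)) p volume :=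
    hkm.mul (hN.comp measurable_fst)
  rw [lintegral_prod _ h3.aemeasurable]
  refine lintegral_congr fun y' => ?_
  have h4 : Measurable fun x => k x y' := 
    ((F.measurable_modelKer c s).comp ((measurable_joinPt_left y).prodMk measurable_const)).enorm
  exact lintegral_mul_const (eLpNorm (fun x => g (joinPt x y')) p volume) h4

theorem lt_kerExp {α μ : Fin r → ℝ}
    (h₁ : ∀ j, μ j + α j > ((T.mDim j : ℝ) + T.nDim j + F.b j) / 2) (j : Fin r) :
    (T.nDim j : ℝ) / 2 < F.kerExp (μ + α) j := by
  have := h₁ j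
  have : (0 : ℝ) ≤ T.mDim j := by positivity
  have : (0 : ℝ) ≤ F.b j := by positivity
  have : (0 : ℝ) ≤ T.nDim j := by positivity
  simp only [kerExp, Pi.add_apply, TAlgebra.tau]; linarith

/-- The mixed norm estimate for nonnegative functions: the kernel on the base that remains after
Minkowski's inequality is bounded by `baseKer`. -/
theorem exists_eLpNorm_posOp_le (c : ℂ) {α ν μ : Fin r → ℝ} {p q : ℝ≥0∞} (hp : 1 ≤ p) (hq : 1 ≤ q)
    (h₁ : ∀ j, μ j + α j > ((T.mDim j : ℝ) + T.nDim j + F.b j) / 2)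
    (h₂ : q ≠ ∞ → ∀ j,
      μ j * q.toReal - ν j
          > (q.toReal - 1) * ((T.mDim j : ℝ) / 2 + (F.b j : ℝ) / 2) + (T.nDim j : ℝ) / 2 ∧
      α j * q.toReal + ν j
          > (T.mDim j : ℝ) / 2 + (F.b j : ℝ) / 2 + (q.toReal - 1) * ((T.nDim j : ℝ) / 2))
    (h₃ : q = ∞ → ∀ j,
      μ j > (T.mDim j : ℝ) / 2 + (F.b j : ℝ) / 2 ∧ α j > (T.nDim j : ℝ) / 2) :
    ∃ C : ℝ≥0∞, C ≠ ∞ ∧ ∀ g : (Fin n → ℂ) × (Fin m → ℂ) → ℝ≥0∞, Measurable g →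
      eLpNorm (fun y => eLpNorm (fun x => F.posOp c (F.kerExp (μ + α)) α μ g (joinPt x y)) p volume)
          q (F.baseV ν) ≤
        C * eLpNorm (fun y => eLpNorm (fun x => g (joinPt x y)) p volume) q (F.baseV ν) := by
  have hs := F.lt_kerExp h₁
  have hs2 : ∀ j, (T.nDim j : ℝ) / 2 < F.kerExp (μ + α) j / 2 := fun j => by
    have := h₁ j
    have : (0 : ℝ) ≤ T.mDim j := by positivity
    have : (0 : ℝ) ≤ F.b j := by positivity
    simp only [kerExp, Pi.add_apply, TAlgebra.tau]; linarith
  obtain ⟨C₁, hC₁, hK⟩ := F.exists_lintegral_lap_kerArg_le hs hs2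
  obtain ⟨C₂, hC₂, hS⟩ := F.exists_eLpNorm_baseKer_le hq h₁ h₂ h₃
  have hexp : (fun j => F.kerExp (μ + α) j - T.tau j) = fun j => μ j + α j + F.b j / 2 := by
    funext j; simp only [kerExp, Pi.add_apply]; ring
  rw [hexp] at hK
  have hC : ‖c‖ₑ * C₁ ≠ ∞ := ENNReal.mul_ne_top enorm_ne_top hC₁
  refine ⟨‖c‖ₑ * C₁ * C₂, ENNReal.mul_ne_top hC hC₂, fun g hg => ?_⟩
  set N : (Fin n → ℝ) × (Fin m → ℂ) → ℝ≥0∞ := fun y' =>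
    eLpNorm (fun x => g (joinPt x y')) p volume with hN
  have hNm : Measurable N :=
    measurable_eLpNorm_left volume p (f := fun x y' => g (joinPt x y'))
      (hg.comp measurable_joinPt)
  have h1 : ∀ᵐ y ∂F.baseV ν,
      eLpNorm (fun x => F.posOp c (F.kerExp (μ + α)) α μ g (joinPt x y)) p volume ≤
        ‖c‖ₑ * C₁ * (F.wt α y *
          ∫⁻ y', F.baseKer (fun j => μ j + α j + F.b j / 2) y y' * N y' ∂F.baseV μ) := by
    filter_upwards [F.ae_baseV_mem ν] with y hy
    refine (F.eLpNorm_posOp_le c _ α μ hg hp y).trans ?_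
    rw [mul_left_comm, ← lintegral_const_mul' _ _ hC]
    gcongr 1
    refine lintegral_mono_ae ?_
    filter_upwards [F.ae_baseV_mem μ] with y' hy'
    rw [← mul_assoc]
    refine mul_le_mul_left ?_ _
    simp only [modelKer, enorm_mul]
    rw [lintegral_const_mul' _ _ enorm_ne_top, mul_assoc]
    gcongr
    exact hK y hy y' hy'
  calc _ ≤ eLpNorm (fun y => ‖c‖ₑ * C₁ * (F.wt α y *
          ∫⁻ y', F.baseKer (fun j => μ j + α j + F.b j / 2) y y' * N y' ∂F.baseV μ)) q
          (F.baseV ν) := eLpNorm_mono_enorm_ae (by simpa only [enorm_eq_self] using h1)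
    _ ≤ _ := eLpNorm_const_mul_ennreal _ _ hC _
    _ ≤ _ := by
        rw [mul_assoc (‖c‖ₑ * C₁)]
        gcongr
        exact hS N hNm

theorem ae_lt_top_of_eLpNorm {Y : Type*} [MeasurableSpace Y] {κ : Measure Y} {p : ℝ≥0∞}
    (hp : p ≠ 0) {f : Y → ℝ≥0∞} (hf : Measurable f) (h : eLpNorm f p κ < ∞) :
    ∀ᵐ y ∂κ, f y < ∞ := by
  rcases eq_or_ne p ∞ with rfl | hpt
  · rw [eLpNorm_exponent_top] at h
    filter_upwards [enorm_ae_le_eLpNormEssSup f κ] with y hy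
    exact (enorm_eq_self (f y) ▸ hy).trans_lt h
  · have h1 := lintegral_rpow_enorm_lt_top_of_eLpNorm_lt_top hp hpt h
    simp only [enorm_eq_self] at h1
    filter_upwards [ae_lt_top (hf.pow_const _) h1.ne] with y hy
    exact (ENNReal.rpow_lt_top_iff_of_pos (ENNReal.toReal_pos hp hpt)).1 hy

theorem ae_joinPt {P : (Fin n → ℂ) × (Fin m → ℂ) → Prop}
    (h : ∀ᵐ z ∂(volume.restrict F.domain), P z) (ν : Fin r → ℝ) :
    ∀ᵐ y ∂F.baseV ν, ∀ᵐ x : Fin n → ℝ, P (joinPt x y) := by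
  rw [ae_restrict_iff' F.isOpen_domain.measurableSet] at h
  have h1 := measurePreserving_joinPt.quasiMeasurePreserving.ae h
  rw [Measure.volume_eq_prod] at h1
  have h2 := Measure.ae_ae_of_ae_prod 
    (Measure.measurePreserving_swap.quasiMeasurePreserving.ae h1)
  refine (F.ae_baseV_iff ν).2 ?_
  filter_upwards [h2] with y hy hyb
  filter_upwards [hy] with x hx
  exact hx (F.joinPt_mem_domain.2 hyb)

theorem ae_domain_of_ae_joinPt {P : (Fin n → ℂ) × (Fin m → ℂ) → Prop}
    (hP : MeasurableSet {z | P z}) (ν : Fin r → ℝ)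
    (h : ∀ᵐ y ∂F.baseV ν, ∀ᵐ x : Fin n → ℝ, P (joinPt x y)) :
    ∀ᵐ z ∂(volume.restrict F.domain), P z := by
  refine (F.restrict_domain_absolutelyContinuous ν).ae_le ?_
  change ∀ᵐ z ∂F.V ν, P z
  rw [ae_iff]
  change F.V ν {z | P z}ᶜ = 0
  rw [← lintegral_indicator_one hP.compl,
    F.lintegral_V_eq_joinPt ν (measurable_one.indicator hP.compl)]
  refine (lintegral_congr_ae ?_).trans (lintegral_zero)
  filter_upwards [h] with y hy
  refine (lintegral_congr_ae ?_).trans (lintegral_zero)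
  filter_upwards [hy] with x hx
  exact Set.indicator_of_notMem (fun h' : joinPt x y ∈ {z | P z}ᶜ => h' hx) _

end HermitianForm

theorem theorem3p8 {r n m : ℕ} {U : Type*} [NonUnitalNonAssocRing U] [Module ℝ U]
    [IsScalarTower ℝ U U] [SMulCommClass ℝ U U] [StarRing U] [StarModule ℝ U]
    [FiniteDimensional ℝ U] (T : TAlgebra r U)
    (e : Module.Basis (Fin n) ℝ (selfAdjoint.submodule ℝ U)) (F : HermitianForm T e m)
    (α ν μ : Fin r → ℝ) (p q : ℝ≥0∞) (hp : 1 ≤ p) (hq : 1 ≤ q)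
    (h₁ : ∀ j, μ j + α j > ((T.mDim j : ℝ) + T.nDim j + F.b j) / 2)
    (h₂ : q ≠ ∞ → ∀ j,
      μ j * q.toReal - ν j
          > (q.toReal - 1) * ((T.mDim j : ℝ) / 2 + (F.b j : ℝ) / 2) + (T.nDim j : ℝ) / 2 ∧
      α j * q.toReal + ν j
          > (T.mDim j : ℝ) / 2 + (F.b j : ℝ) / 2 + (q.toReal - 1) * ((T.nDim j : ℝ) / 2))
    (h₃ : q = ∞ → ∀ j,
      μ j > (T.mDim j : ℝ) / 2 + (F.b j : ℝ) / 2 ∧ α j > (T.nDim j : ℝ) / 2) :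
    ∃ C : ℝ≥0, ∀ f : (Fin n → ℂ) × (Fin m → ℂ) → ℂ, F.MemMixed p q ν f →
      (∀ᵐ z ∂(volume.restrict F.domain),
        Integrable (fun w => (‖F.bergmanKernel (μ + α) z w‖ : ℂ) * f w) (F.V μ)) ∧
      F.MemMixed p q ν (F.Tplus μ α f) ∧
      F.mixedNorm p q ν (F.Tplus μ α f) ≤ C * F.mixedNorm p q ν f := by
  obtain ⟨c, hc⟩ := F.exists_bergmanKernel_eq (F.lt_kerExp h₁)
  obtain ⟨C, hC, hCg⟩ := F.exists_eLpNorm_posOp_le c hp hq h₁ h₂ h₃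
  set s := F.kerExp (μ + α) with hs
  refine ⟨C.toNNReal, fun f hf => ?_⟩
  rw [ENNReal.coe_toNNReal hC]
  obtain ⟨hfm, hfN⟩ := hf
  have hDm := F.isOpen_domain.measurableSet
  have hVD : F.V μ ≪ volume.restrict F.domain := withDensity_absolutelyContinuous _ _
  have hVmem : ∀ᵐ w ∂F.V μ, w ∈ F.domain := hVD.ae_le (ae_restrict_mem hDm)
  -- `g` is a measurable version of `|f|`
  set g : (Fin n → ℂ) × (Fin m → ℂ) → ℝ≥0∞ := fun z => ‖hfm.mk f z‖ₑ with hg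
  have hgm : Measurable g := hfm.stronglyMeasurable_mk.measurable.enorm
  have hfg : ∀ᵐ z ∂(volume.restrict F.domain), g z = ‖f z‖ₑ :=
    hfm.ae_eq_mk.mono fun z hz => by simp only [hg]; rw [← hz]
  have hgf : eLpNorm (fun y => eLpNorm (fun x => g (joinPt x y)) p volume) q (F.baseV ν) ≤
      F.mixedNorm p q ν f := by
    refine eLpNorm_mono_enorm_ae ?_
    filter_upwards [F.ae_joinPt hfg ν] with y hy
    rw [enorm_eq_self, enorm_eq_self]
    refine eLpNorm_mono_enorm_ae ?_
    filter_upwards [hy] with x hx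
    rw [enorm_eq_self, hx]
    rfl
  have hlint : ∀ z ∈ F.domain,
      ∫⁻ w, ‖(‖F.bergmanKernel (μ + α) z w‖ : ℂ) * f w‖ₑ ∂F.V μ =
        ∫⁻ w, ‖F.modelKer c s z w‖ₑ * g w ∂F.V μ := by
    intro z hz
    refine lintegral_congr_ae ?_
    filter_upwards [hVmem, hVD.ae_le hfg] with w hw hgw
    rw [enorm_mul, enorm_complex_ofReal, enorm_norm, hc z hz w hw, hgw]
    rfl
  have hTle : ∀ z ∈ F.domain, ‖F.Tplus μ α f z‖ₑ ≤ F.posOp c s α μ g z := by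
    intro z hz
    rw [HermitianForm.Tplus, enorm_mul, HermitianForm.posOp, ← hlint z hz, enorm_complex_ofReal,
      Real.enorm_of_nonneg (show 0 ≤ F.weight α _ _ from (T.Qpow_pos e α hz).le)]
    gcongr
    exact enorm_integral_le_lintegral_enorm _
  have hTm := F.measurable_posOp c s α μ hgm
  have hnorm : F.mixedNorm p q ν (F.Tplus μ α f) ≤ C * F.mixedNorm p q ν f := by
    refine le_trans ?_ ((hCg g hgm).trans (mul_le_mul_right hgf C))
    refine eLpNorm_mono_enorm_ae ?_
    filter_upwards [F.ae_baseV_mem ν] with y hy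
    rw [enorm_eq_self, enorm_eq_self]
    refine eLpNorm_mono_enorm_ae (Filter.Eventually.of_forall fun x => ?_)
    rw [enorm_eq_self]
    exact hTle (joinPt x y) (F.joinPt_mem_domain.2 hy)
  have hfin : ∀ᵐ z ∂(volume.restrict F.domain), F.posOp c s α μ g z < ∞ := by
    refine F.ae_domain_of_ae_joinPt (measurableSet_lt hTm measurable_const) ν ?_
    have h1 := (hCg g hgm).trans_lt
      (ENNReal.mul_lt_top hC.lt_top (hgf.trans_lt hfN))
    have h2 := HermitianForm.ae_lt_top_of_eLpNorm (zero_lt_one.trans_le hq).ne'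
      (measurable_eLpNorm_left volume p (f := fun x y => F.posOp c s α μ g (joinPt x y))
        (hTm.comp measurable_joinPt)) h1
    filter_upwards [h2] with y hy
    exact HermitianForm.ae_lt_top_of_eLpNorm (zero_lt_one.trans_le hp).ne'
      (hTm.comp (measurable_joinPt_left y)) hy
  have hkm : Measurable (Function.uncurry fun z w => ((‖F.modelKer c s z w‖ : ℝ) : ℂ)) :=
    Complex.measurable_ofReal.comp (F.measurable_modelKer c s).norm
  have hmodel : ∀ z ∈ F.domain, ∀ᵐ w ∂F.V μ, (‖F.modelKer c s z w‖ : ℂ) * hfm.mk f w =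
      (‖F.bergmanKernel (μ + α) z w‖ : ℂ) * f w := by
    intro z hz
    filter_upwards [hVmem, hVD.ae_le hfm.ae_eq_mk] with w hw hgw
    rw [← hgw, hc z hz w hw]
    rfl
  refine ⟨?_, ⟨?_, hnorm.trans_lt (ENNReal.mul_lt_top hC.lt_top hfN)⟩, hnorm⟩
  · filter_upwards [hfin, ae_restrict_mem hDm] with z hz hzD
    refine ⟨?_, ?_⟩
    · exact ⟨_, (hkm.of_uncurry_left.mul hfm.stronglyMeasurable_mk.measurable).stronglyMeasurable,
        (hmodel z hzD).mono fun w hw => hw.symm⟩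
    · rw [hasFiniteIntegral_iff_enorm, hlint z hzD]
      exact ENNReal.lt_top_of_mul_ne_top_right hz.ne (ENNReal.ofReal_pos.2 (T.Qpow_pos e α hzD)).ne'
  · refine ⟨fun z => (F.weight α (fun k => (z.1 k).im) z.2 : ℂ) *
      ∫ w, (‖F.modelKer c s z w‖ : ℂ) * hfm.mk f w ∂F.V μ, ?_, ?_⟩
    · refine (Complex.measurable_ofReal.comp (F.measurable_weightC α)).stronglyMeasurable.mul ?_
      have h1 : StronglyMeasurable (Function.uncurry fun z w =>
          (‖F.modelKer c s z w‖ : ℂ) * hfm.mk f w) :=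
        (hkm.mul (hfm.stronglyMeasurable_mk.measurable.comp measurable_snd)).stronglyMeasurable
      exact h1.integral_prod_right
    · filter_upwards [ae_restrict_mem hDm] with z hz
      rw [HermitianForm.Tplus]
      congr 1
      exact integral_congr_ae ((hmodel z hz).mono fun w hw => hw.symm)

end
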